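/- **Setting.** Let $g:(\mathbb R^2,0)\to(\mathbb R^3,0)$ be a smooth ($C^\infty$) map-germ that is $\mathcal A$-equivalent (i.e. equivalent by germs of diffeomorphisms of source and target) to one of - $S_k^\pm$: $(x,y^2,y^3\pm x^{k+1}y)$, $k\ge1$; - $B_k^\pm$: $(x,y^2,x^2y\pm y^{2k+1})$, $k\ge2$; - $C_k^\pm$: $(x,y^2,xy^3\pm x^ky)$, $k\ge3$; - $F_4$: $(x,y^2,x^3y+y^5)$, and let $S$ be the singular surface parametrized by $g$. Put $m=k+1,\,2,\,k,\,3$ for $S_k,B_k,C_k,F_4$ respectively. The *tangent line* of $S$ at $g(0)$ is the image of $dg_0$, the *normal plane* is its orthogonal complement, and the *principal plane* is spanned by the tangent line and $D^2g_0(\eta,\eta)$, where $\eta\neq0$ is a null vector, $dg_0(\eta)=0$. The point $g(0)$ is an *inflection point* (possibly degenerate) if the pair of quadratic forms given by the 2-jet of the orthogonal projection of $g$ to the normal plane is equivalent under $GL_2(\mathbb R)\times GL_2(\mathbb R)$ to $(x^2\pm y^2,0)$, $(x^2,0)$ or $(0,0)$. Assume that $g(0)$ is **not** an inflection point. A *tangential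 curve* is a smooth curve germ $\gamma$ in the source with $\gamma(0)=0$ and $\gamma'(0)$ transverse to $\eta$. It is *characteristic* if the curvature at $g(0)$ of the orthogonal projection of $g\circ\gamma$ to the principal plane (signed by a fixed unit normal of the tangent line in that plane) is extremal among all tangential curves. The *parabolic set* is the zero set in the source of $$\Sigma=\langle g_{uu},g_u\times g_v\rangle\langle g_{vv},g_u\times g_v\rangle-\langle g_{uv},g_u\times g_v\rangle^2 .$$ A *(regular) branch* of it is a regular smooth curve germ $P$ through $0$ that is contained in it and that, near each of its points other than $0$, is all of it. For $K\ge2$, *normal form coordinates of order $K$* for $g$ consist of a rotation of $\mathbb R^3$ and a smooth change of coordinates of the source fixing $0$ that bring $g$ into the form $(u,p(u,v),q(u,v))$ with $$p=\tfrac12v^2+\sum_{i=2}^{K}\tfrac{b_i}{i!}u^i+O(u,v)^{K+1},\qquad q=\tfrac12a_{2,0}u^2+O(u,v)^3 .$$ For a unit vector $\boldsymbol v$, $h_{\boldsymbol v}=\langle g,\boldsymbol v\rangle$ is the height function. A function germ $h$ has an $A_j$ singularity at $0$ if $h-h(0)$ becomes $\pm x^{j+1}\pm y^2$ after a smooth change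 of coordinates fixing $0$, and an $A_{\ge j}$ singularity if it so becomes $f(x)\pm y^2$ with $f$ smooth and $f(x)=O(x^{j+1})$ ($f$ infinitely flat is allowed). **Theorem.** There is a branch $P$ of the parabolic set of $S$ such that: 1. $P$ is a characteristic tangential curve. 2. For every $K\ge m$, normal form coordinates of order $K$ for $g$ exist, and in all of them $P$ has at least $m$-point contact at $(0,0)$ with its tangent line. 3. Let $\mathcal L(t)$ be any regular parametrization of the image of $P$ on $S$ with $\mathcal L(0)=g(0)$ (that is, $\mathcal L=g\circ\gamma$ with $\gamma$ a smooth regular parametrization of $P$, $\gamma(0)=0$). Then $\mathcal L'(0)\times\mathcal L''(0)\ne0$, and with $\boldsymbol b$ and $\tau$ the unit binormal vector and the torsion of $\mathcal L$, for both $\boldsymbol v=\boldsymbol b(0)$ and $\boldsymbol v=-\boldsymbol b(0)$ the singularity of $h_{\boldsymbol v}$ at $(0,0)$ is of type $$\begin{aligned}A_2&\iff\tau(0)\ne0,\\ A_3&\iff\tau(0)=0,\ \tau'(0)\neq0,\\ A_{\ge4}&\iff\tau(0)=\tau'(0)=0.\end{aligned}$$ -/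

import Mathlib

open Filter Topology Asymptotics
open scoped ContDiff

noncomputable section

namespace SingSurf

/-- Euclidean three-space, the target of the parametrizations. -/
abbrev E3 : Type := EuclideanSpace ℝ (Fin 3)

/-- The vector product of Euclidean three-space. -/
def cross (a b : E3) : E3 := WithLp.toLp 2 (crossProduct a.ofLp b.ofLp)

section Germs

variable {E F : Type*} [NormedAddCommGroup E] [NormedSpace ℝ E]
  [NormedAddCommGroup F] [NormedSpace ℝ F]

/-- `f` is smooth on a neighbourhood of the origin (one neighbourhood for all orders). -/
def SmoothGerm (f : E → F) : Prop := ∀ᶠ x in 𝓝 (0 : E), ContDiffAt ℝ ∞ f x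

/-- `φ` represents a germ of diffeomorphism `(E, 0) → (E, 0)` (inverse function theorem). -/
def DiffeoGerm (φ : E → E) : Prop :=
  φ 0 = 0 ∧ SmoothGerm φ ∧ (fderiv ℝ φ 0).IsInvertible

end Germs

/-! ### The simple singularities -/

/-- `𝒜`-equivalence `g = Φ ∘ f ∘ φ⁻¹` of map-germs `(ℝ², 0) → (ℝ³, 0)`. -/
def AEquiv (f g : ℝ × ℝ → E3) : Prop :=
  ∃ (φ : ℝ × ℝ → ℝ × ℝ) (Φ : E3 → E3), DiffeoGerm φ ∧ DiffeoGerm Φ ∧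
    (fun w => g (φ w)) =ᶠ[𝓝 0] fun w => Φ (f w)

/-- The types `S_k`, `B_k`, `C_k`, `F_4`. -/
inductive SingType : Type
  | S (k : ℕ)
  | B (k : ℕ)
  | C (k : ℕ)
  | F4

/-- The range of the index `k` for each type. -/
def SingType.Admissible : SingType → Prop
  | .S k => 1 ≤ k
  | .B k => 2 ≤ k
  | .C k => 3 ≤ k
  | .F4 => True

/-- The standard representative of each type; `ε = 1` or `ε = -1` is the superscript `±`
(it plays no role for `F_4`). -/
def SingType.model (ε : ℝ) : SingType → ℝ × ℝ → E3
  | .S k => fun w => !₂[w.1, w.2 ^ 2, w.2 ^ 3 + ε * w.1 ^ (k + 1) * w.2]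
  | .B k => fun w => !₂[w.1, w.2 ^ 2, w.1 ^ 2 * w.2 + ε * w.2 ^ (2 * k + 1)]
  | .C k => fun w => !₂[w.1, w.2 ^ 2, w.1 * w.2 ^ 3 + ε * w.1 ^ k * w.2]
  | .F4 => fun w => !₂[w.1, w.2 ^ 2, w.1 ^ 3 * w.2 + w.2 ^ 5]

/-- `g` is `𝒜`-equivalent to the singularity `T` (with either sign). -/
def HasType (g : ℝ × ℝ → E3) (T : SingType) : Prop :=
  ∃ ε : ℝ, (ε = 1 ∨ ε = -1) ∧ AEquiv (T.model ε) g

/-- The contact order `m` attached to each type. -/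
def SingType.contactOrder : SingType → ℕ
  | .S k => k + 1
  | .B _ => 2
  | .C k => k
  | .F4 => 3

/-! ### Geometry at the singular point -/

/-- Second derivative `D²g(p)(a, b)`. -/
def second (g : ℝ × ℝ → E3) (p a b : ℝ × ℝ) : E3 := fderiv ℝ (fderiv ℝ g) p a b

/-- The direction of the tangent line of the surface at the singular point. -/
def tangentLine (g : ℝ × ℝ → E3) : Submodule ℝ E3 :=
  LinearMap.range (fderiv ℝ g 0 : ℝ × ℝ →ₗ[ℝ] E3)

/-- The 2-jet at the origin of the orthogonal projection of `g` onto the normal plane, in the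
coordinates of the normal plane given by the orthonormal basis `e₁, e₂`. -/
def normalPair (g : ℝ × ℝ → E3) (e₁ e₂ : E3) (w : ℝ × ℝ) : ℝ × ℝ :=
  (inner ℝ (second g 0 w w) e₁ / 2, inner ℝ (second g 0 w w) e₂ / 2)

/-- Equivalence under `GL₂(ℝ) × GL₂(ℝ)` of pairs of binary quadratic forms. -/
def PairEquiv (Q Q' : ℝ × ℝ → ℝ × ℝ) : Prop :=
  ∃ A M : (ℝ × ℝ) ≃ₗ[ℝ] (ℝ × ℝ), ∀ w, Q' w = M (Q (A w))

/-- The singular point is an inflection point, degenerate or not: the pair of quadratic forms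
is in the orbit of `(x² ± y², 0)`, or of `(x², 0)` or `(0, 0)` (the degenerate case). -/
def IsInflection (g : ℝ × ℝ → E3) : Prop :=
  ∃ e₁ e₂ : E3, Orthonormal ℝ ![e₁, e₂] ∧ e₁ ∈ (tangentLine g)ᗮ ∧ e₂ ∈ (tangentLine g)ᗮ ∧
    (PairEquiv (normalPair g e₁ e₂) (fun w => (w.1 ^ 2 + w.2 ^ 2, 0)) ∨
     PairEquiv (normalPair g e₁ e₂) (fun w => (w.1 ^ 2 - w.2 ^ 2, 0)) ∨
     PairEquiv (normalPair g e₁ e₂) (fun w => (w.1 ^ 2, 0)) ∨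
     PairEquiv (normalPair g e₁ e₂) (fun _ => (0, 0)))

/-- The principal plane (as a linear subspace, since `g 0 = 0`): it is spanned by the tangent
line and by `ηηg(0)`, where `η` is a null vector. -/
def principalPlane (g : ℝ × ℝ → E3) : Submodule ℝ E3 :=
  tangentLine g ⊔ Submodule.span ℝ {x | ∃ η : ℝ × ℝ, fderiv ℝ g 0 η = 0 ∧ x = second g 0 η η}

/-- A tangential curve: a smooth curve through the origin of the source, transverse to the
null direction (in particular regular). -/
def IsTangential (g : ℝ × ℝ → E3) (γ : ℝ → ℝ × ℝ) : Prop :=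
  γ 0 = 0 ∧ SmoothGerm γ ∧ fderiv ℝ g 0 (deriv γ 0) ≠ 0

/-- Curvature at `0` of a regular curve `c` in a plane, signed by a unit normal `N` of `c` at `0`
in that plane. -/
def signedCurvature (N : E3) (c : ℝ → E3) : ℝ :=
  inner ℝ (iteratedDeriv 2 c 0) N / ‖deriv c 0‖ ^ 2

/-- The orthogonal projection of `g ∘ γ` onto the principal plane. -/
def projectedCurve (g : ℝ × ℝ → E3) (γ : ℝ → ℝ × ℝ) (t : ℝ) : E3 :=
  (principalPlane g).starProjection (g (γ t))

/-- A characteristic tangential curve: the curvature at `0` of its projection onto the principal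
plane is extremal among all tangential curves. The projections all have the same tangent line;
their curvatures are signed by one unit normal `N` of it in the principal plane. -/
def IsCharacteristic (g : ℝ × ℝ → E3) (γ : ℝ → ℝ × ℝ) : Prop :=
  IsTangential g γ ∧
  ∃ N : E3, N ∈ principalPlane g ∧ N ∈ (tangentLine g)ᗮ ∧ ‖N‖ = 1 ∧
    IsExtrOn (fun σ => signedCurvature N (projectedCurve g σ)) {σ | IsTangential g σ} γ

/-! ### The parabolic set and its branches -/

/-- `⟨g_uu, g_u × g_v⟩ ⟨g_vv, g_u × g_v⟩ - ⟨g_uv, g_u × g_v⟩²`. -/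
def parabolicFun (g : ℝ × ℝ → E3) (p : ℝ × ℝ) : ℝ :=
  let n := cross (fderiv ℝ g p (1, 0)) (fderiv ℝ g p (0, 1))
  inner ℝ (second g p (1, 0) (1, 0)) n * inner ℝ (second g p (0, 1) (0, 1)) n
    - inner ℝ (second g p (1, 0) (0, 1)) n ^ 2

/-- The parabolic set in the source. -/
def parabolicSet (g : ℝ × ℝ → E3) : Set (ℝ × ℝ) := {p | parabolicFun g p = 0}

/-- `γ` parametrizes a (regular) branch of `Z` at the origin: a regular curve through the origin
which lies in `Z` and which, off the origin, is all of `Z` locally. -/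
def IsBranch (Z : Set (ℝ × ℝ)) (γ : ℝ → ℝ × ℝ) : Prop :=
  γ 0 = 0 ∧ SmoothGerm γ ∧ deriv γ 0 ≠ 0 ∧
  ∃ ε > 0, (∀ t ∈ Set.Ioo (-ε) ε, γ t ∈ Z) ∧
    ∀ t ∈ Set.Ioo (-ε) ε, t ≠ 0 → ∀ᶠ p in 𝓝 (γ t), p ∈ Z → p ∈ γ '' Set.Ioo (-ε) ε

/-- The regular curve `γ` has at least `m`-point contact with its tangent line at `γ 0 = 0`:
`l ∘ γ` vanishes to order `m` for the linear forms `l` which vanish on the tangent line. -/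
def ContactAtLeast (m : ℕ) (γ : ℝ → ℝ × ℝ) : Prop :=
  ∀ l : ℝ × ℝ →L[ℝ] ℝ, l (deriv γ 0) = 0 → ∀ j < m, iteratedDeriv j (fun t => l (γ t)) 0 = 0

/-! ### Normal form -/

/-- The map-germ `G` is in normal form up to order `K ≥ 2`: `G = (u, p, q)` with
`p = v²/2 + ∑_{i=2}^K bᵢ uⁱ/i! + O(u,v)^{K+1}` and `q = a₂₀ u²/2 + O(u,v)³`. -/
def IsNormalForm (K : ℕ) (G : ℝ × ℝ → E3) : Prop :=
  SmoothGerm G ∧ (∀ᶠ w in 𝓝 (0 : ℝ × ℝ), G w 0 = w.1) ∧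
  (∃ b : ℕ → ℝ,
    (fun w : ℝ × ℝ => G w 1 - (w.2 ^ 2 / 2 + ∑ i ∈ Finset.Icc 2 K, b i / (Nat.factorial i : ℝ) * w.1 ^ i))
      =O[𝓝 0] fun w => ‖w‖ ^ (K + 1)) ∧
  ∃ a : ℝ, (fun w : ℝ × ℝ => G w 2 - a / 2 * w.1 ^ 2) =O[𝓝 0] fun w => ‖w‖ ^ 3

/-- The rotation `R` of the target and the coordinates `ψ` of the source bring `g` into normal
form up to order `K`. -/
def Normalizes (K : ℕ) (g : ℝ × ℝ → E3) (R : E3 ≃ₗᵢ[ℝ] E3) (ψ : ℝ × ℝ → ℝ × ℝ) : Prop :=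
  LinearMap.det (R.toLinearEquiv : E3 →ₗ[ℝ] E3) = 1 ∧ DiffeoGerm ψ ∧
  ∃ G, IsNormalForm K G ∧ (fun w => R (g w)) =ᶠ[𝓝 0] fun w => G (ψ w)

/-! ### Space curves -/

/-- `L' × L''`. -/
def curveNormal (L : ℝ → E3) (t : ℝ) : E3 := cross (deriv L t) (iteratedDeriv 2 L t)

/-- Unit binormal vector. -/
def binormal (L : ℝ → E3) (t : ℝ) : E3 := ‖curveNormal L t‖⁻¹ • curveNormal L t

/-- Torsion. -/
def torsion (L : ℝ → E3) (t : ℝ) : ℝ :=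
  inner ℝ (curveNormal L t) (iteratedDeriv 3 L t) / ‖curveNormal L t‖ ^ 2

/-! ### Height functions and their singularities -/

/-- The height function along `v`. -/
def height (g : ℝ × ℝ → E3) (v : E3) (w : ℝ × ℝ) : ℝ := inner ℝ (g w) v

/-- `h` has an `A_k` singularity at the origin: `h - h(0)` is right-equivalent to
`± x^{k+1} ± y²`. -/
def IsA (k : ℕ) (h : ℝ × ℝ → ℝ) : Prop :=
  ∃ (φ : ℝ × ℝ → ℝ × ℝ) (ε₁ ε₂ : ℝ), DiffeoGerm φ ∧ (ε₁ = 1 ∨ ε₁ = -1) ∧ (ε₂ = 1 ∨ ε₂ = -1) ∧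
    (fun w => h (φ w)) =ᶠ[𝓝 0] fun w => h 0 + ε₁ * w.1 ^ (k + 1) + ε₂ * w.2 ^ 2

/-- `h` has an `A_{≥ k}` singularity at the origin: `h - h(0)` is right-equivalent to
`f(x) ± y²` with `f` smooth and `f(x) = O(x^{k+1})` (infinitely flat `f` included). -/
def IsAGe (k : ℕ) (h : ℝ × ℝ → ℝ) : Prop :=
  ∃ (φ : ℝ × ℝ → ℝ × ℝ) (f : ℝ → ℝ) (ε : ℝ), DiffeoGerm φ ∧ SmoothGerm f ∧
    (∀ j ≤ k, iteratedDeriv j f 0 = 0) ∧ (ε = 1 ∨ ε = -1) ∧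
    (fun w => h (φ w)) =ᶠ[𝓝 0] fun w => h 0 + f w.1 + ε * w.2 ^ 2

end SingSurf

end

namespace SingSurf

/-! ### Germs of smooth maps and of diffeomorphisms. -/

section Germs

variable {E F G : Type*} [NormedAddCommGroup E] [NormedSpace ℝ E]
  [NormedAddCommGroup F] [NormedSpace ℝ F] [NormedAddCommGroup G] [NormedSpace ℝ G]

/-! Everything is read off from one normal form. After a rotation and a change of source
coordinates, g becomes (u, p, q) with p = v²/2 + u²B(u) and q = u²A(u) + u^m D(u) v + v²E(u,v),
where D(0) ≠ 0 and E(0) = 0 (`exists_normalForm`). Of the singularity type only the exponent m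
survives. It is an 𝒜-invariant: it measures to which order the differential can kill a nonvanishing
vector field along a regular curve (`FieldFlat`). When the first coordinate is u and p_v is a
multiple of v, such a field is nearly vertical and such a curve nearly lies on v = 0, so the order
is that of q_v(u,0), which is m for the models (`IsPrenormal.isBigO_transfer`).

If A(0) = 0, the projected 2-jet is ((v² + 2B(0)u²)/2, 0), an inflection; hence A(0) ≠ 0.
Substituting v = u^m w in the parabolic function extracts u^{2m}, and the cofactor at u = 0 is
affine in w with slope -2A(0)D(0). The implicit function theorem yields the branch v = u^m μ(u),
with A(0)μ(0) = B(0)D(0) (`exists_branch_normalForm`).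

The projected curvature of a tangential curve is (v'/u')² + 2B(0), minimal for v' = 0; as m ≥ 2 the
branch is such a curve. Along it ∂/∂v is killed to order m, a property which survives every change
of coordinates; in any normal form of order K ≥ m it forces v = O(t^m), which is the contact
statement (`IsNormalForm.isBigO_snd`).

The binormal at 0 is proportional to (0, -A(0), B(0)), so the height function is a multiple of H =
B(0)q - A(0)p. It has H_vv(0) ≠ 0, and the relation on μ(0) makes H_v vanish to order m + 1 ≥ 3
along the branch. Splitting H = f(u) ± r², the residual f therefore agrees with H along the branch
modulo order 6 (`type_iff_along_curve`). The derivatives of H along the branch are inner products of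
L' × L'' with derivatives of L: those up to order 2 vanish, the third gives the torsion, and the
fourth its derivative when the torsion is 0. The types A₂, A₃, A_{≥4} exclude each other, because
the order to which dh vanishes along regular curves (`HasFlat`) is invariant; so the three
implications are equivalences. -/

theorem _root_.ContDiff.smoothGerm {f : E → F} (hf : ContDiff ℝ ∞ f) : SmoothGerm f :=
  Eventually.of_forall fun _ => hf.contDiffAt

theorem SmoothGerm.contDiffAt {f : E → F} (hf : SmoothGerm f) : ContDiffAt ℝ ∞ f 0 :=
  hf.self_of_nhds

theorem SmoothGerm.continuousAt {f : E → F} (hf : SmoothGerm f) : ContinuousAt f 0 :=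
  hf.contDiffAt.continuousAt

theorem SmoothGerm.congr {f g : E → F} (hf : SmoothGerm f) (h : g =ᶠ[𝓝 0] f) :
    SmoothGerm g := by
  filter_upwards [hf, h.eventuallyEq_nhds] with x hx hx'
  exact hx.congr_of_eventuallyEq hx'

theorem SmoothGerm.differentiableAt {f : E → F} (hf : SmoothGerm f) :
    ∀ᶠ x in 𝓝 (0 : E), DifferentiableAt ℝ f x :=
  hf.mono fun _ hx => hx.differentiableAt (by simp)

theorem SmoothGerm.comp {f : E → F} {g : F → G} (hg : SmoothGerm g) (hf : SmoothGerm f)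
    (h0 : f 0 = 0) : SmoothGerm fun x => g (f x) := by
  have hc : Tendsto f (𝓝 0) (𝓝 0) := by simpa [ContinuousAt, h0] using hf.continuousAt
  filter_upwards [hf, hc.eventually hg] with x hx hx'
  exact hx'.comp x hx

theorem SmoothGerm.fderiv {f : E → F} (hf : SmoothGerm f) : SmoothGerm (fderiv ℝ f) :=
  hf.mono fun _ hx => hx.fderiv_right (by simp)

/-- Multiplication by a bump function. Replacing germs by global smooth representatives removes the
domain conditions from later calculus. -/
theorem SmoothGerm.exists_contDiff [FiniteDimensional ℝ E] {f : E → F} (hf : SmoothGerm f) :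
    ∃ g : E → F, ContDiff ℝ ∞ g ∧ g =ᶠ[𝓝 0] f := by
  obtain ⟨r, hr, hball⟩ := Metric.eventually_nhds_iff_ball.1 hf
  let χ : ContDiffBump (0 : E) := ⟨r / 4, r / 2, by positivity, by linarith⟩
  refine ⟨fun x => χ x • f x, ?_, ?_⟩
  · rw [contDiff_iff_contDiffAt]
    intro x
    by_cases hx : x ∈ Metric.ball (0 : E) r
    · exact χ.contDiff.contDiffAt.smul (hball x hx)
    · have hx' : x ∈ (Metric.closedBall (0 : E) (r / 2))ᶜ := by
        simp only [Metric.mem_ball, Metric.mem_closedBall, Set.mem_compl_iff, not_le, not_lt]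
          at hx ⊢
        linarith
      have : (fun x => χ x • f x) =ᶠ[𝓝 x] fun _ => 0 := by
        filter_upwards [Metric.isClosed_closedBall.isOpen_compl.mem_nhds hx'] with y hy
        rw [χ.zero_of_le_dist, zero_smul]
        have : r / 2 < dist y 0 := by simpa using hy
        exact this.le
      exact contDiffAt_const.congr_of_eventuallyEq this
  · filter_upwards [χ.eventuallyEq_one] with x hx
    simp [hx]

/-- A germ of diffeomorphism has an inverse germ, represented by a globally smooth map. -/
theorem DiffeoGerm.exists_inverse [FiniteDimensional ℝ E] {φ : E → E} (hφ : DiffeoGerm φ) :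
    ∃ θ : E → E, ContDiff ℝ ∞ θ ∧ DiffeoGerm θ ∧ (∀ᶠ x in 𝓝 0, θ (φ x) = x) ∧
      ∀ᶠ x in 𝓝 0, φ (θ x) = x := by
  have : CompleteSpace E := FiniteDimensional.complete ℝ E
  obtain ⟨h0, hs, ⟨A, hA⟩⟩ := hφ
  have hd : HasFDerivAt φ (A : E →L[ℝ] E) 0 := by
    rw [hA]; exact (hs.contDiffAt.differentiableAt (by simp)).hasFDerivAt
  let Ψ := hs.contDiffAt.toOpenPartialHomeomorph φ hd (by simp)
  have hΨ : (Ψ : E → E) = φ := rfl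
  have hsrc : (0 : E) ∈ Ψ.source := hs.contDiffAt.mem_toOpenPartialHomeomorph_source hd (by simp)
  have htgt : (0 : E) ∈ Ψ.target := by
    have := Ψ.map_source hsrc
    rwa [hΨ, h0] at this
  have hs0 : Ψ.symm 0 = 0 := by
    have := Ψ.left_inv hsrc
    rwa [hΨ, h0] at this
  have hc : Tendsto Ψ.symm (𝓝 0) (𝓝 0) := by
    have := Ψ.continuousAt_symm htgt
    rwa [ContinuousAt, hs0] at this
  -- Invertibility of the differential is an open condition, so the inverse is smooth at all nearby
  -- points, not only at the origin.
  have hinv : ∀ᶠ x in 𝓝 (0 : E), (_root_.fderiv ℝ φ x).IsInvertible := by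
    have h2 : ContinuousAt (_root_.fderiv ℝ φ) 0 := hs.fderiv.continuousAt
    exact h2.preimage_mem_nhds (by simpa [hA] using A.nhds)
  have hsm : SmoothGerm Ψ.symm := by
    filter_upwards [hc.eventually hs, hc.eventually hinv, Ψ.open_target.mem_nhds htgt]
      with x hx ⟨B, hB⟩ hxt
    refine Ψ.contDiffAt_symm (f₀' := B) hxt ?_ hx
    rw [hB]
    exact (hx.differentiableAt (by simp)).hasFDerivAt
  obtain ⟨θ, hθ, hθe⟩ := hsm.exists_contDiff
  have hl : ∀ᶠ x in 𝓝 0, θ (φ x) = x := by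
    have hcφ : Tendsto φ (𝓝 0) (𝓝 0) := by simpa [ContinuousAt, h0] using hs.continuousAt
    filter_upwards [hcφ.eventually hθe, Ψ.open_source.mem_nhds hsrc] with x hx hx'
    rw [hx]; exact Ψ.left_inv hx'
  have hr : ∀ᶠ x in 𝓝 0, φ (θ x) = x := by
    filter_upwards [hθe, Ψ.open_target.mem_nhds htgt] with x hx hx'
    rw [hx]; exact Ψ.right_inv hx'
  have hθ0 : θ 0 = 0 := by rw [hθe.self_of_nhds, hs0]
  refine ⟨θ, hθ, ⟨hθ0, hθ.smoothGerm, ⟨A.symm, ?_⟩⟩, hl, hr⟩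
  have hθd : HasFDerivAt θ (_root_.fderiv ℝ θ 0) (φ 0) := by
    rw [h0]; exact (hθ.differentiable (by simp) 0).hasFDerivAt
  have h1 := hθd.comp 0 hd
  have h2 : HasFDerivAt (θ ∘ φ) (ContinuousLinearMap.id ℝ E) 0 :=
    (hasFDerivAt_id 0).congr_of_eventuallyEq hl
  have h3 := h1.unique h2
  ext x
  have := DFunLike.congr_fun h3 (A.symm x)
  simpa using this.symm

theorem DiffeoGerm.tendsto {φ : E → E} (hφ : DiffeoGerm φ) : Tendsto φ (𝓝 0) (𝓝 0) := by
  simpa [ContinuousAt, hφ.1] using hφ.2.1.continuousAt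

theorem DiffeoGerm.hasFDerivAt {φ : E → E} (hφ : DiffeoGerm φ) :
    HasFDerivAt φ (fderiv ℝ φ 0) 0 :=
  (hφ.2.1.contDiffAt.differentiableAt (by simp)).hasFDerivAt

theorem DiffeoGerm.comp {φ ψ : E → E} (hφ : DiffeoGerm φ) (hψ : DiffeoGerm ψ) :
    DiffeoGerm fun x => φ (ψ x) := by
  refine ⟨by simp [hφ.1, hψ.1], hφ.2.1.comp hψ.2.1 hψ.1, ?_⟩
  have h1 : HasFDerivAt φ (fderiv ℝ φ 0) (ψ 0) := by rw [hψ.1]; exact hφ.hasFDerivAt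
  have : fderiv ℝ (fun x => φ (ψ x)) 0 = (fderiv ℝ φ 0).comp (fderiv ℝ ψ 0) :=
    (h1.comp 0 hψ.hasFDerivAt).fderiv
  rw [this]
  obtain ⟨A, hA⟩ := hφ.2.2
  obtain ⟨B, hB⟩ := hψ.2.2
  exact ⟨B.trans A, by rw [← hA, ← hB]; rfl⟩

theorem DiffeoGerm.injective {φ : E → E} (hφ : DiffeoGerm φ) :
    Function.Injective (fderiv ℝ φ 0) := by
  obtain ⟨A, hA⟩ := hφ.2.2
  rw [← hA]; exact A.injective

theorem DiffeoGerm.of_injective [FiniteDimensional ℝ E] {φ : E → E} (h0 : φ 0 = 0)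
    (hs : SmoothGerm φ) (hi : Function.Injective (_root_.fderiv ℝ φ 0)) : DiffeoGerm φ := by
  refine ⟨h0, hs, ?_⟩
  refine ⟨(LinearEquiv.ofInjectiveEndo (_root_.fderiv ℝ φ 0 : E →ₗ[ℝ] E)
    hi).toContinuousLinearEquiv, ?_⟩
  ext x; rfl

end Germs

/-! ### Smooth dependence on parameters and Hadamard division. -/

section ParametricIntegral

variable {E F : Type} [NormedAddCommGroup E] [NormedSpace ℝ E] [FiniteDimensional ℝ E]
  [NormedAddCommGroup F] [NormedSpace ℝ F]

theorem hasFDerivAt_integral_of_contDiff {f : E × ℝ → F} (hf : ContDiff ℝ 1 f) (x : E) :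
    HasFDerivAt (fun x => ∫ t in (0 : ℝ)..1, f (x, t))
      (∫ t in (0 : ℝ)..1, (fderiv ℝ f (x, t)).comp (ContinuousLinearMap.inl ℝ E ℝ)) x := by
  have hcont : Continuous fun p : E × ℝ =>
      (fderiv ℝ f p).comp (ContinuousLinearMap.inl ℝ E ℝ) :=
    (hf.continuous_fderiv (by simp)).clm_comp continuous_const
  obtain ⟨C, hC⟩ := ((isCompact_closedBall x 1).prod (isCompact_Icc (a := (0 : ℝ)) (b := 1))
    ).exists_bound_of_continuousOn hcont.continuousOn
  refine intervalIntegral.hasFDerivAt_integral_of_dominated_of_fderiv_le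
    (F := fun x t => f (x, t))
    (F' := fun x t => (fderiv ℝ f (x, t)).comp (ContinuousLinearMap.inl ℝ E ℝ))
    (bound := fun _ => C) (Metric.closedBall_mem_nhds x one_pos) ?_ ?_ ?_ ?_ ?_ ?_
  · exact Eventually.of_forall fun y =>
      (hf.continuous.comp (by fun_prop : Continuous fun t : ℝ => (y, t))).aestronglyMeasurable
  · exact (hf.continuous.comp (by fun_prop : Continuous fun t : ℝ => (x, t))).intervalIntegrable _ _
  · exact (hcont.comp (by fun_prop : Continuous fun t : ℝ => (x, t))).aestronglyMeasurable
  · refine Eventually.of_forall fun t ht y hy => hC (y, t) ⟨hy, ?_⟩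
    rw [Set.uIoc_of_le zero_le_one] at ht
    exact ⟨ht.1.le, ht.2⟩
  · exact intervalIntegrable_const
  · refine Eventually.of_forall fun t _ y _ => ?_
    have h1 := (hf.differentiable (by simp) (y, t)).hasFDerivAt
    exact h1.comp y (hasFDerivAt_prodMk_left y t)

/-- The derivative of the integral is an integral of the same kind with values in linear maps, so
the codomain has to vary in the induction on the order. -/
theorem contDiff_integral_of_contDiff (n : ℕ) : ∀ {F : Type} [NormedAddCommGroup F]
    [NormedSpace ℝ F] {f : E × ℝ → F}, ContDiff ℝ ∞ f →
      ContDiff ℝ n fun x => ∫ t in (0 : ℝ)..1, f (x, t) := by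
  induction n with
  | zero =>
    intro F _ _ f hf
    have hd : Differentiable ℝ fun x => ∫ t in (0 : ℝ)..1, f (x, t) := fun x =>
      (hasFDerivAt_integral_of_contDiff (hf.of_le (by simp)) x).differentiableAt
    exact_mod_cast contDiff_zero.2 hd.continuous
  | succ n ih =>
    intro F _ _ f hf
    have hd := fun x => hasFDerivAt_integral_of_contDiff (hf.of_le (by simp)) x
    push_cast
    rw [contDiff_succ_iff_fderiv]
    refine ⟨fun x => (hd x).differentiableAt, by simp, ?_⟩
    have : fderiv ℝ (fun x => ∫ t in (0 : ℝ)..1, f (x, t)) = fun x =>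
        ∫ t in (0 : ℝ)..1, (fderiv ℝ f (x, t)).comp (ContinuousLinearMap.inl ℝ E ℝ) :=
      funext fun x => (hd x).fderiv
    rw [this]
    exact ih ((hf.fderiv_right (by simp)).clm_comp contDiff_const)

end ParametricIntegral

/-- Hadamard's lemma. -/
theorem exists_eq_snd_mul {f : ℝ × ℝ → ℝ} (hf : SmoothGerm f)
    (h0 : ∀ᶠ u in 𝓝 (0 : ℝ), f (u, 0) = 0) :
    ∃ k : ℝ × ℝ → ℝ, ContDiff ℝ ∞ k ∧ ∀ᶠ w in 𝓝 0, f w = w.2 * k w := by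
  obtain ⟨g, hg, hgf⟩ := hf.exists_contDiff
  refine ⟨fun w => ∫ t in (0 : ℝ)..1, fderiv ℝ g (w.1, t * w.2) (0, 1), ?_, ?_⟩
  · rw [contDiff_infty]
    intro n
    refine contDiff_integral_of_contDiff n
      (f := fun p : (ℝ × ℝ) × ℝ => fderiv ℝ g (p.1.1, p.2 * p.1.2) (0, 1)) ?_
    have : ContDiff ℝ ∞ (fderiv ℝ g) := hg.fderiv_right (by simp)
    exact (this.comp (by fun_prop)).clm_apply contDiff_const
  · have hz : ∀ᶠ w : ℝ × ℝ in 𝓝 0, g (w.1, 0) = 0 := by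
      have ht : Tendsto (fun w : ℝ × ℝ => w.1) (𝓝 0) (𝓝 0) := continuous_fst.tendsto' _ _ rfl
      have ht' : Tendsto (fun w : ℝ × ℝ => (w.1, (0 : ℝ))) (𝓝 0) (𝓝 0) :=
        (by fun_prop : Continuous fun w : ℝ × ℝ => (w.1, (0 : ℝ))).tendsto' _ _ rfl
      filter_upwards [ht.eventually h0, ht'.eventually hgf] with w h1 h2
      rw [h2, h1]
    filter_upwards [hgf, hz] with w hw hw0
    have hderiv : ∀ t ∈ Set.uIcc (0 : ℝ) 1, HasDerivAt (fun t : ℝ => g (w.1, t * w.2))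
        (w.2 * fderiv ℝ g (w.1, t * w.2) (0, 1)) t := by
      intro t _
      have h1 := (hg.differentiable (by simp) (w.1, t * w.2)).hasFDerivAt
      have h2 : HasDerivAt (fun t : ℝ => (w.1, t * w.2)) ((0 : ℝ), w.2) t :=
        (hasDerivAt_const t w.1).prodMk (by simpa using (hasDerivAt_id t).mul_const w.2)
      have h3 := h1.comp_hasDerivAt t h2
      have h4 : ((0 : ℝ), w.2) = w.2 • ((0 : ℝ), (1 : ℝ)) := by simp
      rw [h4, map_smul, smul_eq_mul] at h3
      exact h3
    have hcont : Continuous fun t : ℝ => w.2 * fderiv ℝ g (w.1, t * w.2) (0, 1) := by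
      have : Continuous (fderiv ℝ g) := hg.continuous_fderiv (by simp)
      fun_prop
    have := intervalIntegral.integral_eq_sub_of_hasDerivAt hderiv (hcont.intervalIntegrable _ _)
    rw [intervalIntegral.integral_const_mul] at this
    rw [this, ← hw]
    simp [hw0]

/-- Division of a germ of order `n` in the second variable. -/
theorem exists_eq_snd_pow_mul (n : ℕ) : ∀ {f : ℝ × ℝ → ℝ}, SmoothGerm f →
    (f =O[𝓝 0] fun w : ℝ × ℝ => w.2 ^ n) →
    ∃ k : ℝ × ℝ → ℝ, ContDiff ℝ ∞ k ∧ ∀ᶠ w in 𝓝 0, f w = w.2 ^ n * k w := by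
  induction n with
  | zero =>
    intro f hf _
    obtain ⟨g, hg, hgf⟩ := hf.exists_contDiff
    exact ⟨g, hg, hgf.mono fun w hw => by simp [hw]⟩
  | succ n ih =>
    intro f hf hO
    have hz : ∀ᶠ w in 𝓝 (0 : ℝ × ℝ), w.2 = 0 → f w = 0 := by
      obtain ⟨C, hC⟩ := hO.bound
      filter_upwards [hC] with w hw h
      simpa [h] using hw
    have hz' : ∀ᶠ u in 𝓝 (0 : ℝ), f (u, 0) = 0 := by
      have ht : Tendsto (fun u : ℝ => (u, (0 : ℝ))) (𝓝 0) (𝓝 0) :=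
        (by fun_prop : Continuous fun u : ℝ => (u, (0 : ℝ))).tendsto' _ _ rfl
      filter_upwards [ht.eventually hz] with u hu using hu rfl
    obtain ⟨k, hk, hfk⟩ := exists_eq_snd_mul hf hz'
    have hkO : k =O[𝓝 0] fun w : ℝ × ℝ => w.2 ^ n := by
      obtain ⟨C, hC⟩ := hO.bound
      refine IsBigO.of_bound C ?_
      -- Off the axis one factor of the second variable cancels from the bound; on the axis the
      -- bound for k follows by continuity.
      have hev : ∀ᶠ w in 𝓝 (0 : ℝ × ℝ), w.2 ≠ 0 → ‖k w‖ ≤ C * ‖w.2 ^ n‖ := by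
        filter_upwards [hC, hfk] with w h1 h2 h3
        rw [h2, norm_mul, pow_succ', norm_mul, mul_left_comm] at h1
        exact le_of_mul_le_mul_left h1 (norm_pos_iff.2 h3)
      filter_upwards [hev.eventually_nhds] with w hw
      by_cases hw2 : w.2 = 0
      · have ht : Tendsto (fun t : ℝ => (w.1, t)) (𝓝[≠] 0) (𝓝 w) :=
          ((by fun_prop : Continuous fun t : ℝ => (w.1, t)).tendsto' 0 w
            (Prod.ext rfl hw2.symm)).mono_left nhdsWithin_le_nhds
        have h1 : Tendsto (fun t : ℝ => ‖k (w.1, t)‖) (𝓝[≠] 0) (𝓝 ‖k w‖) :=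
          (hk.continuous.norm.tendsto w).comp ht
        have h2 : Tendsto (fun t : ℝ => C * ‖t ^ n‖) (𝓝[≠] 0) (𝓝 (C * ‖w.2 ^ n‖)) :=
          (((by fun_prop : Continuous fun w : ℝ × ℝ => C * ‖w.2 ^ n‖)).tendsto w).comp ht
        refine le_of_tendsto_of_tendsto h1 h2 ?_
        filter_upwards [ht.eventually hw, self_mem_nhdsWithin] with t h3 h4 using h3 h4
      · exact hw.self_of_nhds hw2
    obtain ⟨k', hk', hkk'⟩ := ih hk.smoothGerm hkO
    refine ⟨k', hk', ?_⟩
    filter_upwards [hfk, hkk'] with w h1 h2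
    rw [h1, h2, pow_succ', mul_assoc]

/-- Division of a germ of order `n` in one variable. -/
theorem exists_eq_pow_mul {n : ℕ} {f : ℝ → ℝ} (hf : SmoothGerm f)
    (hO : f =O[𝓝 0] fun t : ℝ => t ^ n) :
    ∃ k : ℝ → ℝ, ContDiff ℝ ∞ k ∧ ∀ᶠ t in 𝓝 0, f t = t ^ n * k t := by
  have ht : Tendsto (fun w : ℝ × ℝ => w.2) (𝓝 0) (𝓝 0) := continuous_snd.tendsto' _ _ rfl
  have ht' : Tendsto (fun t : ℝ => ((0 : ℝ), t)) (𝓝 0) (𝓝 0) :=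
    (by fun_prop : Continuous fun t : ℝ => ((0 : ℝ), t)).tendsto' _ _ rfl
  obtain ⟨k, hk, hfk⟩ := exists_eq_snd_pow_mul n
    (f := fun w : ℝ × ℝ => f w.2) (hf.comp (contDiff_snd.smoothGerm) rfl) (hO.comp_tendsto ht)
  exact ⟨fun t => k (0, t), by fun_prop, ht'.eventually hfk⟩

/-! ### Orders of vanishing in one variable. -/

section OneVariable

theorem isBigO_of_smoothGerm {f : ℝ → ℝ} (hf : SmoothGerm f) (h0 : f 0 = 0) :
    f =O[𝓝 0] fun t : ℝ => t := by
  have := (hf.contDiffAt.differentiableAt (by simp)).isBigO_sub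
  simpa [h0] using this

theorem SmoothGerm.deriv {F : Type*} [NormedAddCommGroup F] [NormedSpace ℝ F] {f : ℝ → F}
    (hf : SmoothGerm f) : SmoothGerm (deriv f) :=
  (hf.fderiv.mono fun _ hx => hx.clm_apply contDiffAt_const :
    SmoothGerm fun x => _root_.fderiv ℝ f x 1)

/-- A growth bound alone cannot be differentiated; for smooth germs it can, because the power of t
divides exactly. -/
theorem isBigO_deriv {n : ℕ} {f : ℝ → ℝ} (hf : SmoothGerm f)
    (hO : f =O[𝓝 0] fun t : ℝ => t ^ (n + 1)) : deriv f =O[𝓝 0] fun t : ℝ => t ^ n := by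
  obtain ⟨k, hk, hfk⟩ := exists_eq_pow_mul hf hO
  have hd : deriv f =ᶠ[𝓝 0] fun t => t ^ n * ((n + 1) * k t + t * deriv k t) := by
    filter_upwards [hfk.eventually_nhds] with t ht
    have h1 : f =ᶠ[𝓝 t] fun t => t ^ (n + 1) * k t := ht
    rw [h1.deriv_eq]
    have h2 := (hasDerivAt_pow (n + 1) t).mul (hk.differentiable (by simp) t).hasDerivAt
    have h3 : deriv (fun t => t ^ (n + 1) * k t) t = _ := h2.deriv
    rw [h3]
    push_cast [Nat.add_sub_cancel]
    ring
  refine hd.trans_isBigO ?_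
  have hc : Continuous fun t => ((n + 1) * k t + t * deriv k t) := by
    have := hk.continuous
    have := hk.continuous_deriv (by simp)
    fun_prop
  simpa using (isBigO_refl (fun t : ℝ => t ^ n) (𝓝 0)).mul (hc.continuousAt.isBigO_one ℝ)

theorem isBigO_of_deriv {n : ℕ} {f : ℝ → ℝ} (hf : SmoothGerm f) (h0 : f 0 = 0)
    (hO : deriv f =O[𝓝 0] fun t : ℝ => t ^ n) : f =O[𝓝 0] fun t : ℝ => t ^ (n + 1) := by
  obtain ⟨C, hC⟩ := hO.bound
  obtain ⟨r, hr, hball⟩ := Metric.eventually_nhds_iff_ball.1 (hC.and hf.differentiableAt)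
  refine IsBigO.of_bound C ?_
  filter_upwards [Metric.ball_mem_nhds 0 hr] with t ht
  have htr : ‖t‖ < r := by simpa using ht
  have hsub : Metric.closedBall (0 : ℝ) ‖t‖ ⊆ Metric.ball 0 r := Metric.closedBall_subset_ball htr
  have hCt : 0 ≤ C * ‖t‖ ^ n := by
    have := (hball t ht).1
    rw [norm_pow] at this
    exact (norm_nonneg _).trans this
  have := (convex_closedBall (0 : ℝ) ‖t‖).norm_image_sub_le_of_norm_deriv_le (f := f)
    (C := C * ‖t‖ ^ n) (x := 0) (y := t) (fun x hx => (hball x (hsub hx)).2) (fun x hx => ?_)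
    (by simp) (by simp)
  · rw [h0, sub_zero, sub_zero] at this
    rw [norm_pow, pow_succ, ← mul_assoc]
    exact this
  · have h1 := (hball x (hsub hx)).1
    rw [norm_pow] at h1
    refine h1.trans ?_
    have hx' : ‖x‖ ≤ ‖t‖ := by simpa using hx
    -- The constant C comes from an arbitrary bound and may be negative, in which case the bound
    -- forces ‖x‖ ^ n = 0.
    by_cases hC0 : 0 ≤ C
    · gcongr
    · push Not at hC0
      have hx0 : ‖x‖ ^ n = 0 := by
        have := (norm_nonneg _).trans h1
        have h3 : 0 ≤ ‖x‖ ^ n := by positivity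
        nlinarith
      rw [hx0]; simpa using hCt

/-- The dictionary between growth bounds, which behave well under products and reparametrization,
and vanishing derivatives, in which the contact order and the A_{≥k} condition are phrased. -/
theorem isBigO_pow_iff {f : ℝ → ℝ} (n : ℕ) (hf : SmoothGerm f) :
    (f =O[𝓝 0] fun t : ℝ => t ^ n) ↔ ∀ j < n, iteratedDeriv j f 0 = 0 := by
  induction n generalizing f with
  | zero => simpa using hf.continuousAt.isBigO_one ℝ
  | succ n ih =>
    have key : (f =O[𝓝 0] fun t : ℝ => t ^ (n + 1)) ↔
        f 0 = 0 ∧ (deriv f =O[𝓝 0] fun t : ℝ => t ^ n) := by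
      constructor
      · intro h
        refine ⟨?_, isBigO_deriv hf h⟩
        obtain ⟨C, hC⟩ := h.bound
        simpa using hC.self_of_nhds
      · rintro ⟨h0, h⟩
        exact isBigO_of_deriv hf h0 h
    rw [key, ih hf.deriv]
    constructor
    · rintro ⟨h0, h⟩ j hj
      cases j with
      | zero => simpa using h0
      | succ j => rw [iteratedDeriv_succ']; exact h j (by omega)
    · intro h
      refine ⟨by simpa using h 0 (by omega), fun j hj => ?_⟩
      rw [← iteratedDeriv_succ']
      exact h (j + 1) (by omega)

theorem isBigO_pow_succ_iff {f : ℝ → ℝ} {n : ℕ} (hf : SmoothGerm f)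
    (hO : f =O[𝓝 0] fun t : ℝ => t ^ n) :
    (f =O[𝓝 0] fun t : ℝ => t ^ (n + 1)) ↔ iteratedDeriv n f 0 = 0 := by
  rw [isBigO_pow_iff _ hf]
  rw [isBigO_pow_iff _ hf] at hO
  refine ⟨fun h => h n (by omega), fun h j hj => ?_⟩
  rcases (Nat.lt_succ_iff_lt_or_eq.1 hj) with h1 | rfl
  · exact hO j h1
  · exact h

theorem pow_isBigO_pow {m n : ℕ} (h : m ≤ n) :
    (fun t : ℝ => t ^ n) =O[𝓝 0] fun t : ℝ => t ^ m :=
  isBigO_iff.2 ⟨1, by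
    filter_upwards [Metric.closedBall_mem_nhds (0 : ℝ) one_pos] with t ht
    rw [norm_pow, norm_pow, one_mul]
    exact pow_le_pow_of_le_one (norm_nonneg _) (by simpa using ht) h⟩

theorem not_pow_isBigO_pow_succ (n : ℕ) :
    ¬ (fun t : ℝ => t ^ n) =O[𝓝 0] fun t : ℝ => t ^ (n + 1) := by
  intro h
  have h1 := (isBigO_pow_iff (n + 1) ((contDiff_id.pow n).smoothGerm)).1 h n (by omega)
  simp at h1

theorem diffeoGerm_of_deriv_ne_zero {s : ℝ → ℝ} (h0 : s 0 = 0) (hs : SmoothGerm s)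
    (hd : deriv s 0 ≠ 0) : DiffeoGerm s := by
  refine DiffeoGerm.of_injective h0 hs ?_
  rw [injective_iff_map_eq_zero]
  intro x hx
  have : fderiv ℝ s 0 x = x * deriv s 0 := by
    simp
  rw [this] at hx
  exact (mul_eq_zero.1 hx).resolve_right hd

theorem DiffeoGerm.deriv_ne_zero {s : ℝ → ℝ} (hs : DiffeoGerm s) : deriv s 0 ≠ 0 := by
  intro h
  exact one_ne_zero (hs.injective (a₁ := 1) (a₂ := 0) (by simpa using h))

theorem DiffeoGerm.isBigO_comp {s f : ℝ → ℝ} {n : ℕ} (hs : DiffeoGerm s)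
    (hf : f =O[𝓝 0] fun t : ℝ => t ^ n) : (fun t => f (s t)) =O[𝓝 0] fun t : ℝ => t ^ n :=
  (hf.comp_tendsto hs.tendsto).trans ((isBigO_of_smoothGerm hs.2.1 hs.1).pow n)

theorem DiffeoGerm.isBigO_comp_iff {s f : ℝ → ℝ} {n : ℕ} (hs : DiffeoGerm s) :
    ((fun t => f (s t)) =O[𝓝 0] fun t : ℝ => t ^ n) ↔ f =O[𝓝 0] fun t : ℝ => t ^ n := by
  refine ⟨fun h => ?_, hs.isBigO_comp⟩
  obtain ⟨r, -, hr, -, hsr⟩ := hs.exists_inverse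
  refine IsBigO.congr' (hr.isBigO_comp h) ?_ EventuallyEq.rfl
  filter_upwards [hsr] with t ht
  rw [ht]

theorem deriv_eq_zero_of_isBigO {f : ℝ → ℝ} {n : ℕ} (hn : 2 ≤ n) (hf : SmoothGerm f)
    (hO : f =O[𝓝 0] fun t : ℝ => t ^ n) : deriv f 0 = 0 := by
  have := (isBigO_pow_iff n hf).1 hO 1 (by omega)
  simpa using this

end OneVariable

/-! ### Regular curves in the plane. -/

section Curves

variable {E F : Type*} [NormedAddCommGroup E] [NormedSpace ℝ E]
  [NormedAddCommGroup F] [NormedSpace ℝ F]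

theorem SmoothGerm.clm_comp {f : E → F} {G : Type*} [NormedAddCommGroup G] [NormedSpace ℝ G]
    (hf : SmoothGerm f) (l : F →L[ℝ] G) : SmoothGerm fun x => l (f x) :=
  hf.mono fun _ hx => l.contDiff.contDiffAt.comp _ hx

theorem SmoothGerm.fst {f : E → ℝ × ℝ} (hf : SmoothGerm f) : SmoothGerm fun x => (f x).1 :=
  hf.clm_comp (ContinuousLinearMap.fst ℝ ℝ ℝ)

theorem SmoothGerm.snd {f : E → ℝ × ℝ} (hf : SmoothGerm f) : SmoothGerm fun x => (f x).2 :=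
  hf.clm_comp (ContinuousLinearMap.snd ℝ ℝ ℝ)

theorem SmoothGerm.prodMk {f g : E → ℝ} (hf : SmoothGerm f) (hg : SmoothGerm g) :
    SmoothGerm fun x => (f x, g x) := by
  filter_upwards [hf, hg] with x h1 h2 using h1.prodMk h2

theorem SmoothGerm.tendsto {f : E → F} (hf : SmoothGerm f) (h0 : f 0 = 0) :
    Tendsto f (𝓝 0) (𝓝 0) := by
  simpa [ContinuousAt, h0] using hf.continuousAt

theorem deriv_fst {c : ℝ → ℝ × ℝ} (hc : SmoothGerm c) :
    deriv (fun t => (c t).1) 0 = (deriv c 0).1 :=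
  (((ContinuousLinearMap.fst ℝ ℝ ℝ).hasFDerivAt.comp_hasDerivAt (0 : ℝ)
    (hc.contDiffAt.differentiableAt (by simp)).hasDerivAt)).deriv

theorem deriv_snd {c : ℝ → ℝ × ℝ} (hc : SmoothGerm c) :
    deriv (fun t => (c t).2) 0 = (deriv c 0).2 :=
  (((ContinuousLinearMap.snd ℝ ℝ ℝ).hasFDerivAt.comp_hasDerivAt (0 : ℝ)
    (hc.contDiffAt.differentiableAt (by simp)).hasDerivAt)).deriv

/-- If the second coordinate of a regular curve is flat, its first coordinate is a parameter. -/
theorem diffeoGerm_fst {c : ℝ → ℝ × ℝ} (hc : SmoothGerm c) (h0 : c 0 = 0) (hd : deriv c 0 ≠ 0)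
    {n : ℕ} (hn : 2 ≤ n) (hO : (fun t => (c t).2) =O[𝓝 0] fun t : ℝ => t ^ n) :
    DiffeoGerm fun t => (c t).1 := by
  refine diffeoGerm_of_deriv_ne_zero (by simp [h0]) hc.fst fun h => hd ?_
  have h2 := deriv_eq_zero_of_isBigO hn hc.snd hO
  rw [deriv_snd hc] at h2
  rw [deriv_fst hc] at h
  exact Prod.ext h h2

theorem deriv_comp_curve {φ : E → F} {c : ℝ → E} (hφ : SmoothGerm φ) (hc : SmoothGerm c)
    (h0 : c 0 = 0) : deriv (fun t => φ (c t)) 0 = fderiv ℝ φ 0 (deriv c 0) := by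
  have h1 : HasFDerivAt φ (fderiv ℝ φ 0) (c 0) := by
    rw [h0]; exact (hφ.contDiffAt.differentiableAt (by simp)).hasFDerivAt
  exact (h1.comp_hasDerivAt 0 (hc.contDiffAt.differentiableAt (by simp)).hasDerivAt).deriv

theorem DiffeoGerm.deriv_comp_ne_zero {φ : E → E} {c : ℝ → E} (hφ : DiffeoGerm φ)
    (hc : SmoothGerm c) (h0 : c 0 = 0) (hd : deriv c 0 ≠ 0) :
    deriv (fun t => φ (c t)) 0 ≠ 0 := by
  rw [deriv_comp_curve hφ.2.1 hc h0]
  intro h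
  exact hd (hφ.injective (by rw [h, map_zero]))

end Curves

/-! ### The implicit function theorem and the Morse lemma with a parameter. -/

section Splitting

/-- Derivative in the second variable. -/
noncomputable def dsnd (f : ℝ × ℝ → ℝ) (w : ℝ × ℝ) : ℝ := fderiv ℝ f w (0, 1)

theorem SmoothGerm.dsnd {f : ℝ × ℝ → ℝ} (hf : SmoothGerm f) : SmoothGerm (dsnd f) :=
  hf.fderiv.mono fun _ hx => hx.clm_apply contDiffAt_const

theorem _root_.ContDiff.dsnd {f : ℝ × ℝ → ℝ} (hf : ContDiff ℝ ∞ f) : ContDiff ℝ ∞ (dsnd f) :=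
  (hf.fderiv_right (by simp)).clm_apply contDiff_const

theorem hasDerivAt_snd {f : ℝ × ℝ → ℝ} {w : ℝ × ℝ} (hf : DifferentiableAt ℝ f w) :
    HasDerivAt (fun t => f (w.1, t)) (dsnd f w) w.2 := by
  have h2 : HasDerivAt (fun t : ℝ => (w.1, t)) ((0 : ℝ), (1 : ℝ)) w.2 :=
    (hasDerivAt_const w.2 w.1).prodMk (hasDerivAt_id w.2)
  exact hf.hasFDerivAt.comp_hasDerivAt w.2 h2

theorem dsnd_eq_of_hasDerivAt {f : ℝ × ℝ → ℝ} {w : ℝ × ℝ} {d : ℝ} (hf : DifferentiableAt ℝ f w)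
    (h : HasDerivAt (fun t => f (w.1, t)) d w.2) : dsnd f w = d :=
  (hasDerivAt_snd hf).unique h

theorem dsnd_congr {f g : ℝ × ℝ → ℝ} {w : ℝ × ℝ} (h : f =ᶠ[𝓝 w] g) : dsnd f w = dsnd g w := by
  rw [dsnd, h.fderiv_eq, dsnd]

theorem dsnd_snd_mul {k : ℝ × ℝ → ℝ} {w : ℝ × ℝ} (hk : DifferentiableAt ℝ k w) :
    dsnd (fun w => w.2 * k w) w = k w + w.2 * dsnd k w := by
  refine dsnd_eq_of_hasDerivAt (by fun_prop) ?_
  simpa using (hasDerivAt_id' w.2).fun_mul (hasDerivAt_snd hk)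

/-- A germ preserving the first variable, with nonzero derivative in the second one, is a
diffeomorphism. -/
theorem diffeoGerm_fibered {f : ℝ × ℝ → ℝ} (hf : SmoothGerm f) (h0 : f 0 = 0)
    (hd : dsnd f 0 ≠ 0) : DiffeoGerm fun w : ℝ × ℝ => (w.1, f w) := by
  have hs : SmoothGerm fun w : ℝ × ℝ => (w.1, f w) := contDiff_fst.smoothGerm.prodMk hf
  refine DiffeoGerm.of_injective (by simp [h0]) hs ?_
  have hfd : HasFDerivAt (fun w : ℝ × ℝ => (w.1, f w))
      ((ContinuousLinearMap.fst ℝ ℝ ℝ).prod (fderiv ℝ f 0)) 0 :=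
    hasFDerivAt_fst.prodMk (hf.contDiffAt.differentiableAt (by simp)).hasFDerivAt
  rw [hfd.fderiv, injective_iff_map_eq_zero]
  rintro ⟨a, b⟩ hab
  simp only [ContinuousLinearMap.prod_apply, ContinuousLinearMap.coe_fst', Prod.mk_eq_zero] at hab
  obtain ⟨rfl, h2⟩ := hab
  have h3 : ((0 : ℝ), b) = b • ((0 : ℝ), (1 : ℝ)) := by simp
  rw [h3, map_smul, smul_eq_mul] at h2
  have := (mul_eq_zero.1 h2).resolve_right hd
  simp [this]

/-- The implicit function theorem, for a germ of functions of two variables. -/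
theorem exists_implicit {f : ℝ × ℝ → ℝ} (hf : SmoothGerm f) (h0 : f 0 = 0)
    (hd : dsnd f 0 ≠ 0) : ∃ c : ℝ → ℝ, ContDiff ℝ ∞ c ∧ c 0 = 0 ∧
      (∀ᶠ u in 𝓝 0, f (u, c u) = 0) ∧ ∀ᶠ w in 𝓝 (0 : ℝ × ℝ), f w = 0 → w.2 = c w.1 := by
  obtain ⟨θ, hθ, hθd, hl, hr⟩ := (diffeoGerm_fibered hf h0 hd).exists_inverse
  have ht : Tendsto (fun u : ℝ => (u, (0 : ℝ))) (𝓝 0) (𝓝 0) :=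
    (by fun_prop : Continuous fun u : ℝ => (u, (0 : ℝ))).tendsto' _ _ rfl
  refine ⟨fun u => (θ (u, 0)).2, by fun_prop, ?_, ?_, ?_⟩
  · have h1 : θ (0, 0) = 0 := hθd.1
    simp [h1]
  · filter_upwards [ht.eventually hr] with u hu
    simp only [Prod.mk.injEq] at hu
    have : (u, (θ (u, 0)).2) = θ (u, 0) := Prod.ext hu.1.symm rfl
    rw [this]; exact hu.2
  · filter_upwards [hl] with w hw h
    rw [h] at hw
    rw [hw]

/-- The Morse lemma with a parameter. -/
theorem exists_splitting {P : ℝ × ℝ → ℝ} (hP : SmoothGerm P) (h1 : dsnd P 0 = 0) {κ : ℝ}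
    (h2 : 0 < κ * dsnd (dsnd P) 0) :
    ∃ (b : ℝ → ℝ) (r : ℝ × ℝ → ℝ), ContDiff ℝ ∞ b ∧ SmoothGerm r ∧ r 0 = 0 ∧ dsnd r 0 ≠ 0 ∧
      ∀ᶠ w in 𝓝 0, P w = b w.1 + κ * r w ^ 2 := by
  obtain ⟨p, hp, hpP⟩ := hP.exists_contDiff
  have e1 : dsnd p =ᶠ[𝓝 0] dsnd P := by
    filter_upwards [hpP.eventuallyEq_nhds] with w hw using dsnd_congr hw
  have e2 : dsnd (dsnd p) 0 = dsnd (dsnd P) 0 := dsnd_congr e1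
  have hκ : κ ≠ 0 := by rintro rfl; simp at h2
  rw [← e2] at h2
  -- The curve of points critical in the second variable. Translated to this curve, P minus its
  -- critical value is divisible by the square of the second variable, with quotient `l`.
  obtain ⟨c, hc, hc0, hcz, -⟩ := exists_implicit hp.dsnd.smoothGerm
    (by rw [e1.self_of_nhds, h1]) (fun h => by rw [h, mul_zero] at h2; exact h2.ne rfl)
  let f : ℝ × ℝ → ℝ := fun w => p (w.1, c w.1 + w.2) - p (w.1, c w.1)
  have hf : ContDiff ℝ ∞ f := by fun_prop
  have hfd : ∀ w, dsnd f w = dsnd p (w.1, c w.1 + w.2) := by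
    intro w
    refine dsnd_eq_of_hasDerivAt (hf.differentiable (by simp) w) ?_
    have := hasDerivAt_snd (hp.differentiable (by simp) (w.1, c w.1 + w.2))
    exact (this.comp_const_add (c w.1) w.2).sub_const (p (w.1, c w.1))
  obtain ⟨k, hk, hfk⟩ := exists_eq_snd_mul hf.smoothGerm (by simp [f])
  have hkd : ∀ᶠ w in 𝓝 0, dsnd f w = k w + w.2 * dsnd k w := by
    filter_upwards [hfk.eventually_nhds] with w hw
    rw [dsnd_congr hw, dsnd_snd_mul (hk.differentiable (by simp) w)]
  have ht : Tendsto (fun u : ℝ => (u, (0 : ℝ))) (𝓝 0) (𝓝 0) :=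
    (by fun_prop : Continuous fun u : ℝ => (u, (0 : ℝ))).tendsto' _ _ rfl
  obtain ⟨l, hl, hkl⟩ := exists_eq_snd_mul hk.smoothGerm (by
    filter_upwards [ht.eventually hkd, hcz] with u h3 h4
    rw [hfd] at h3
    simpa [h4] using h3.symm)
  have hl0 : dsnd (dsnd p) 0 = 2 * l 0 := by
    have h3 : dsnd (dsnd f) 0 = dsnd (dsnd p) 0 := by
      have := hasDerivAt_snd (hp.dsnd.differentiable (by simp) ((0 : ℝ), c 0 + 0))
      have h4 := (this.comp_const_add (c 0) 0)
      rw [funext hfd]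
      refine (dsnd_eq_of_hasDerivAt ?_ h4).trans ?_
      · exact (by have := hp.dsnd; fun_prop :
          ContDiff ℝ ∞ fun w : ℝ × ℝ => dsnd p (w.1, c w.1 + w.2)).differentiable (by simp) _
      · simp [hc0, Prod.mk_zero_zero]
    have h4 : ∀ᶠ w in 𝓝 0, dsnd f w = w.2 * (2 * l w + w.2 * dsnd l w) := by
      filter_upwards [hkd, hkl.eventually_nhds] with w h5 h6
      rw [h5, dsnd_congr h6, dsnd_snd_mul (hl.differentiable (by simp) w), h6.self_of_nhds]
      ring
    rw [← h3]
    have hld := hl.dsnd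
    have hcd : ContDiff ℝ ∞ fun w : ℝ × ℝ => (2 * l w + w.2 * dsnd l w) := by fun_prop
    rw [dsnd_congr h4, dsnd_snd_mul (hcd.differentiable (by simp) 0)]
    simp
  have hpos : 0 < l 0 / κ := by
    rw [hl0] at h2
    have : l 0 / κ = (κ * (2 * l 0)) / (2 * κ ^ 2) := by field_simp
    rw [this]; positivity
  -- Since l / κ is positive near 0, the difference v² l equals κ (v √(l/κ))²; the map `σ` below
  -- undoes the translation.
  let r₀ : ℝ × ℝ → ℝ := fun w => w.2 * Real.sqrt (l w / κ)
  have hq : SmoothGerm fun w => Real.sqrt (l w / κ) := by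
    have : ∀ᶠ w in 𝓝 0, 0 < l w / κ :=
      (hl.continuous.div_const κ).continuousAt.eventually_const_lt hpos
    filter_upwards [this] with w hw
    exact ((hl.div_const κ).contDiffAt).sqrt hw.ne'
  have hr₀ : SmoothGerm r₀ := by
    filter_upwards [hq] with w hw using contDiffAt_snd.mul hw
  let σ : ℝ × ℝ → ℝ × ℝ := fun w => (w.1, w.2 - c w.1)
  have hσ : ContDiff ℝ ∞ σ := by fun_prop
  have hσ0 : σ 0 = 0 := by simp [σ, hc0]
  have hσt : Tendsto σ (𝓝 0) (𝓝 0) := hσ.continuous.tendsto' _ _ hσ0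
  have hr : SmoothGerm fun w => r₀ (σ w) := hr₀.comp hσ.smoothGerm hσ0
  refine ⟨fun u => p (u, c u), fun w => r₀ (σ w), by fun_prop, hr, ?_, ?_, ?_⟩
  · simp [r₀, hσ0]
  · have h3 : HasDerivAt (fun t => r₀ (σ ((0 : ℝ × ℝ).1, t))) (Real.sqrt (l 0 / κ))
        (0 : ℝ × ℝ).2 := by
      have h4 := (hasDerivAt_id' (0 : ℝ × ℝ).2).fun_mul
        (hasDerivAt_snd (hq.contDiffAt.differentiableAt (by simp)))
      simpa [r₀, σ, hc0, Prod.mk_zero_zero] using h4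
    rw [dsnd_eq_of_hasDerivAt (hr.contDiffAt.differentiableAt (by simp)) h3]
    exact (Real.sqrt_pos.2 hpos).ne'
  · have hpos' : ∀ᶠ w in 𝓝 0, 0 < l w / κ :=
      (hl.continuous.div_const κ).continuousAt.eventually_const_lt hpos
    filter_upwards [hpP, hσt.eventually hfk, hσt.eventually hkl, hσt.eventually hpos']
      with w h3 h4 h5 h6
    rw [← h3]
    have h7 : f (σ w) = p w - p (w.1, c w.1) := by simp [f, σ]
    have h8 : r₀ (σ w) ^ 2 = (σ w).2 ^ 2 * (l (σ w) / κ) := by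
      simp only [r₀, mul_pow, Real.sq_sqrt h6.le]
    rw [h8]
    rw [h7, h5] at h4
    field_simp
    linarith

end Splitting

/-! ### Recognition of A_k singularities. -/

/-- The differential of `h` vanishes to order `j` along some regular curve. -/
def HasFlat (j : ℕ) (h : ℝ × ℝ → ℝ) : Prop :=
  ∃ c : ℝ → ℝ × ℝ, SmoothGerm c ∧ c 0 = 0 ∧ deriv c 0 ≠ 0 ∧
    (fun t => fderiv ℝ h (c t)) =O[𝓝 0] fun t : ℝ => t ^ j

/-- By the chain rule dh = dk ∘ dθ, and dθ stays bounded along the curve. This makes flatness an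
invariant of right-equivalence, which is what separates the types. -/
theorem HasFlat.comp {j : ℕ} {h k : ℝ × ℝ → ℝ} {θ : ℝ × ℝ → ℝ × ℝ} (hk : SmoothGerm k)
    (hθ : DiffeoGerm θ) (he : h =ᶠ[𝓝 0] fun w => k (θ w)) (hf : HasFlat j k) : HasFlat j h := by
  obtain ⟨c, hc, hc0, hcd, hO⟩ := hf
  obtain ⟨φ, hφs, hφ, hl, hr⟩ := hθ.exists_inverse
  refine ⟨fun t => φ (c t), hφs.smoothGerm.comp hc hc0, by simp [hc0, hφ.1],
    hφ.deriv_comp_ne_zero hc hc0 hcd, ?_⟩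
  have hct := hc.tendsto hc0
  have hφc : Tendsto (fun t => φ (c t)) (𝓝 0) (𝓝 0) := hφ.tendsto.comp hct
  have e : (fun t => fderiv ℝ h (φ (c t))) =ᶠ[𝓝 0]
      fun t => (fderiv ℝ k (c t)).comp (fderiv ℝ θ (φ (c t))) := by
    filter_upwards [hφc.eventually he.eventuallyEq_nhds, hct.eventually hr,
      hφc.eventually hθ.2.1.differentiableAt, hct.eventually hk.differentiableAt]
      with t h1 h2 h3 h4
    rw [h1.fderiv_eq]
    have h5 : HasFDerivAt k (fderiv ℝ k (c t)) (θ (φ (c t))) := by rw [h2]; exact h4.hasFDerivAt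
    exact (h5.comp _ h3.hasFDerivAt).fderiv
  refine e.trans_isBigO ?_
  have hb : (fun t => fderiv ℝ θ (φ (c t))) =O[𝓝 0] fun _ => (1 : ℝ) :=
    (hθ.2.1.fderiv.continuousAt.tendsto.comp hφc).isBigO_one ℝ
  have := hO.norm_left.mul hb.norm_left
  simp only [mul_one] at this
  refine IsBigO.trans (IsBigO.of_bound 1 (Eventually.of_forall fun t => ?_)) this
  rw [one_mul, Real.norm_of_nonneg (by positivity)]
  exact ContinuousLinearMap.opNorm_comp_le _ _

theorem fderiv_split {f : ℝ → ℝ} {a ε : ℝ} {w : ℝ × ℝ} (hf : DifferentiableAt ℝ f w.1) :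
    fderiv ℝ (fun w : ℝ × ℝ => a + f w.1 + ε * w.2 ^ 2) w =
      deriv f w.1 • ContinuousLinearMap.fst ℝ ℝ ℝ +
        (2 * ε * w.2) • ContinuousLinearMap.snd ℝ ℝ ℝ := by
  have h1 : HasFDerivAt (fun w : ℝ × ℝ => f w.1)
      (deriv f w.1 • ContinuousLinearMap.fst ℝ ℝ ℝ) w :=
    hf.hasDerivAt.comp_hasFDerivAt w hasFDerivAt_fst
  have h2 : HasFDerivAt (fun w : ℝ × ℝ => ε * w.2 ^ 2)
      ((2 * ε * w.2) • ContinuousLinearMap.snd ℝ ℝ ℝ) w := by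
    have h3 : HasDerivAt (fun y : ℝ => ε * y ^ 2) (2 * ε * w.2) w.2 := by
      convert! (hasDerivAt_pow 2 w.2).const_mul ε using 1
      push_cast; ring
    exact h3.comp_hasFDerivAt w hasFDerivAt_snd
  exact ((h1.const_add a).add h2).fderiv

theorem hasFlat_split {j : ℕ} {f : ℝ → ℝ} {a ε : ℝ} (hf : SmoothGerm f)
    (hO : deriv f =O[𝓝 0] fun t : ℝ => t ^ j) :
    HasFlat j fun w : ℝ × ℝ => a + f w.1 + ε * w.2 ^ 2 := by
  have hd : HasDerivAt (fun t : ℝ => (t, (0 : ℝ))) ((1 : ℝ), (0 : ℝ)) 0 :=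
    (hasDerivAt_id (0 : ℝ)).prodMk (hasDerivAt_const _ _)
  refine ⟨fun t => (t, 0), (by fun_prop : ContDiff ℝ ∞ fun t : ℝ => (t, (0 : ℝ))).smoothGerm,
    rfl, by simp [hd.deriv], ?_⟩
  refine IsBigO.trans (IsBigO.of_bound ‖ContinuousLinearMap.fst ℝ ℝ ℝ‖ ?_) hO
  filter_upwards [hf.differentiableAt] with t ht
  rw [fderiv_split ht]
  simp [norm_smul, mul_comm]

/-- The derivative 2εy forces the second coordinate of the flat curve to be O(t^j). With j ≥ 2 the
first coordinate is then a parameter of the curve, and the order of f' can be read along it. -/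
theorem isBigO_of_hasFlat_split {j : ℕ} (hj : 2 ≤ j) {f : ℝ → ℝ} {a ε : ℝ} (hε : ε ≠ 0)
    (hf : SmoothGerm f) (h : HasFlat j fun w : ℝ × ℝ => a + f w.1 + ε * w.2 ^ 2) :
    deriv f =O[𝓝 0] fun t : ℝ => t ^ j := by
  obtain ⟨c, hc, hc0, hcd, hO⟩ := h
  have hct : Tendsto (fun t => (c t).1) (𝓝 0) (𝓝 0) := hc.fst.tendsto (by simp [hc0])
  have happ : ∀ v : ℝ × ℝ, (fun t => deriv f (c t).1 * v.1 + 2 * ε * (c t).2 * v.2) =O[𝓝 0]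
      fun t : ℝ => t ^ j := by
    intro v
    refine IsBigO.trans (IsBigO.of_bound ‖v‖ ?_) hO
    filter_upwards [hct.eventually hf.differentiableAt] with t ht
    have h1 := (fderiv ℝ (fun w : ℝ × ℝ => a + f w.1 + ε * w.2 ^ 2) (c t)).le_opNorm v
    rw [mul_comm] at h1
    refine le_of_eq_of_le ?_ h1
    rw [fderiv_split ht]
    simp
  have h2 : (fun t => (c t).2) =O[𝓝 0] fun t : ℝ => t ^ j := by
    have := happ (0, 1)
    simp only [mul_zero, zero_add, mul_one] at this
    exact (isBigO_const_mul_left_iff (by positivity : 2 * ε ≠ 0)).1 this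
  have h1 := happ (1, 0)
  simp only [mul_zero, add_zero, mul_one] at h1
  exact (diffeoGerm_fst hc hc0 hcd hj h2).isBigO_comp_iff.1 h1

theorem smoothGerm_split {f : ℝ → ℝ} {a ε : ℝ} (hf : SmoothGerm f) :
    SmoothGerm fun w : ℝ × ℝ => a + f w.1 + ε * w.2 ^ 2 := by
  have h1 : SmoothGerm fun w : ℝ × ℝ => f w.1 := hf.comp contDiff_fst.smoothGerm rfl
  filter_upwards [h1] with w hw
  exact (contDiffAt_const.add hw).add (by fun_prop)

theorem IsA.isAGe {k : ℕ} {h : ℝ × ℝ → ℝ} (hA : IsA k h) : IsAGe k h := by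
  obtain ⟨φ, ε₁, ε₂, hφ, -, h2, he⟩ := hA
  have hs : SmoothGerm fun t : ℝ => ε₁ * t ^ (k + 1) :=
    (by fun_prop : ContDiff ℝ ∞ fun t : ℝ => ε₁ * t ^ (k + 1)).smoothGerm
  refine ⟨φ, fun t => ε₁ * t ^ (k + 1), ε₂, hφ, hs, ?_, h2, he⟩
  have := (isBigO_pow_iff (k + 1) hs).1 (isBigO_const_mul_self _ _ _)
  exact fun j hj => this j (by omega)

theorem IsAGe.hasFlat {k : ℕ} {h : ℝ × ℝ → ℝ} (hA : IsAGe k h) : HasFlat k h := by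
  obtain ⟨φ, f, ε, hφ, hf, hz, -, he⟩ := hA
  obtain ⟨θ, -, hθ, -, hr⟩ := hφ.exists_inverse
  have hO := (isBigO_pow_iff (k + 1) hf).2 fun j hj => hz j (by omega)
  refine (hasFlat_split (a := h 0) (ε := ε) hf (isBigO_deriv hf hO)).comp (smoothGerm_split hf) hθ ?_
  filter_upwards [hr, hθ.tendsto.eventually he] with w h1 h2
  rw [← h2, h1]

theorem IsA.not_hasFlat {k j : ℕ} {h : ℝ × ℝ → ℝ} (hA : IsA k h) (hk : 1 ≤ k) (hkj : k < j) :
    ¬ HasFlat j h := by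
  intro hF
  obtain ⟨φ, ε₁, ε₂, hφ, h1, h2, he⟩ := hA
  have hs : SmoothGerm fun t : ℝ => ε₁ * t ^ (k + 1) :=
    (by fun_prop : ContDiff ℝ ∞ fun t : ℝ => ε₁ * t ^ (k + 1)).smoothGerm
  have hε₁ : ε₁ ≠ 0 := by rcases h1 with rfl | rfl <;> norm_num
  have hε₂ : ε₂ ≠ 0 := by rcases h2 with rfl | rfl <;> norm_num
  obtain ⟨θ, -, hθ, -, hr⟩ := hφ.exists_inverse
  have hsm : SmoothGerm h := by
    refine ((smoothGerm_split (a := h 0) (ε := ε₂) hs).comp hθ.2.1 hθ.1).congr ?_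
    filter_upwards [hr, hθ.tendsto.eventually he] with w h1 h2
    rw [← h2, h1]
  have hF' := hF.comp hsm hφ he.symm
  have := isBigO_of_deriv hs (by simp) (isBigO_of_hasFlat_split (by omega) hε₂ hs hF')
  have h3 := this.trans (pow_isBigO_pow (by omega : k + 1 + 1 ≤ j + 1))
  exact not_pow_isBigO_pow_succ (k + 1) ((isBigO_const_mul_left_iff hε₁).1 h3)

theorem IsA.comp {k : ℕ} {h H : ℝ × ℝ → ℝ} {ψ : ℝ × ℝ → ℝ × ℝ} (hψ : DiffeoGerm ψ)
    (he : h =ᶠ[𝓝 0] fun w => H (ψ w)) (hA : IsA k H) : IsA k h := by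
  obtain ⟨φ, ε₁, ε₂, hφ, h1, h2, hH⟩ := hA
  obtain ⟨θ, -, hθ, -, hr⟩ := hψ.exists_inverse
  refine ⟨fun w => θ (φ w), ε₁, ε₂, hθ.comp hφ, h1, h2, ?_⟩
  have h0 : h 0 = H 0 := he.self_of_nhds.trans (congrArg H hψ.1)
  filter_upwards [hH, hφ.tendsto.eventually hr,
    (hθ.tendsto.comp hφ.tendsto).eventually he] with w h3 h4 h5
  simp only [Function.comp] at h5
  rw [h5, h4, h3, h0]

theorem IsAGe.comp {k : ℕ} {h H : ℝ × ℝ → ℝ} {ψ : ℝ × ℝ → ℝ × ℝ} (hψ : DiffeoGerm ψ)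
    (he : h =ᶠ[𝓝 0] fun w => H (ψ w)) (hA : IsAGe k H) : IsAGe k h := by
  obtain ⟨φ, f, ε, hφ, hf, hz, h2, hH⟩ := hA
  obtain ⟨θ, -, hθ, -, hr⟩ := hψ.exists_inverse
  refine ⟨fun w => θ (φ w), f, ε, hθ.comp hφ, hf, hz, h2, ?_⟩
  have h0 : h 0 = H 0 := he.self_of_nhds.trans (congrArg H hψ.1)
  filter_upwards [hH, hφ.tendsto.eventually hr,
    (hθ.tendsto.comp hφ.tendsto).eventually he] with w h3 h4 h5
  simp only [Function.comp] at h5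
  rw [h5, h4, h3, h0]

theorem eventuallyEq_comp_symm {h H : ℝ × ℝ → ℝ} {ψ : ℝ × ℝ → ℝ × ℝ} (hψ : DiffeoGerm ψ)
    (he : h =ᶠ[𝓝 0] fun w => H (ψ w)) :
    ∃ θ, DiffeoGerm θ ∧ H =ᶠ[𝓝 0] fun w => h (θ w) := by
  obtain ⟨θ, -, hθ, -, hr⟩ := hψ.exists_inverse
  refine ⟨θ, hθ, ?_⟩
  filter_upwards [hr, hθ.tendsto.eventually he] with w h1 h2
  rw [h2, h1]

theorem isA_comp_iff {k : ℕ} {h H : ℝ × ℝ → ℝ} {ψ : ℝ × ℝ → ℝ × ℝ} (hψ : DiffeoGerm ψ)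
    (he : h =ᶠ[𝓝 0] fun w => H (ψ w)) : IsA k h ↔ IsA k H := by
  obtain ⟨θ, hθ, he'⟩ := eventuallyEq_comp_symm hψ he
  exact ⟨IsA.comp hθ he', IsA.comp hψ he⟩

theorem isAGe_comp_iff {k : ℕ} {h H : ℝ × ℝ → ℝ} {ψ : ℝ × ℝ → ℝ × ℝ} (hψ : DiffeoGerm ψ)
    (he : h =ᶠ[𝓝 0] fun w => H (ψ w)) : IsAGe k h ↔ IsAGe k H := by
  obtain ⟨θ, hθ, he'⟩ := eventuallyEq_comp_symm hψ he
  exact ⟨IsAGe.comp hθ he', IsAGe.comp hψ he⟩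

theorem diffeoGerm_triangular {ξ : ℝ → ℝ} {r : ℝ × ℝ → ℝ} (hξ : DiffeoGerm ξ)
    (hr : SmoothGerm r) (h0 : r 0 = 0) (hd : dsnd r 0 ≠ 0) :
    DiffeoGerm fun w : ℝ × ℝ => (ξ w.1, r w) := by
  have h1 : DiffeoGerm fun w : ℝ × ℝ => (ξ w.1, w.2) := by
    have hf : HasFDerivAt (fun w : ℝ × ℝ => (ξ w.1, w.2))
        ((deriv ξ 0 • ContinuousLinearMap.fst ℝ ℝ ℝ).prod (ContinuousLinearMap.snd ℝ ℝ ℝ)) 0 := by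
      refine HasFDerivAt.prodMk ?_ hasFDerivAt_snd
      have : HasDerivAt ξ (deriv ξ 0) (0 : ℝ × ℝ).1 := by
        exact (hξ.2.1.contDiffAt.differentiableAt (by simp)).hasDerivAt
      exact this.comp_hasFDerivAt (0 : ℝ × ℝ) hasFDerivAt_fst
    refine DiffeoGerm.of_injective (by simp [hξ.1])
      ((hξ.2.1.comp contDiff_fst.smoothGerm rfl).prodMk contDiff_snd.smoothGerm) ?_
    rw [hf.fderiv, injective_iff_map_eq_zero]
    rintro ⟨a, b⟩ hab
    simpa [hξ.deriv_ne_zero] using hab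
  exact h1.comp (diffeoGerm_fibered hr h0 hd)

theorem exists_eq_pow_mul_ne_zero {n : ℕ} {f : ℝ → ℝ} (hf : SmoothGerm f)
    (hO : f =O[𝓝 0] fun t : ℝ => t ^ n) (hO' : ¬ f =O[𝓝 0] fun t : ℝ => t ^ (n + 1)) :
    ∃ k : ℝ → ℝ, ContDiff ℝ ∞ k ∧ k 0 ≠ 0 ∧ ∀ᶠ t in 𝓝 0, f t = t ^ n * k t := by
  obtain ⟨k, hk, hfk⟩ := exists_eq_pow_mul hf hO
  refine ⟨k, hk, fun h0 => hO' ?_, hfk⟩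
  refine IsBigO.trans (EventuallyEq.isBigO hfk) ?_
  simp only [pow_succ]
  exact (isBigO_refl _ _).mul (isBigO_of_smoothGerm hk.smoothGerm h0)

/-- Write f = t^{k+1} e(t) with e(0) ≠ 0. The (k+1)-st root of |e| is smooth near 0 and is absorbed
into the first coordinate; r becomes the second one. -/
theorem isA_of_split {k : ℕ} {H : ℝ × ℝ → ℝ} {f : ℝ → ℝ} {r : ℝ × ℝ → ℝ} {ε : ℝ}
    (hε : ε = 1 ∨ ε = -1) (hf : SmoothGerm f) (hr : SmoothGerm r) (hr0 : r 0 = 0)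
    (hrd : dsnd r 0 ≠ 0) (he : ∀ᶠ w in 𝓝 0, H w = f w.1 + ε * r w ^ 2)
    (hO : f =O[𝓝 0] fun t : ℝ => t ^ (k + 1)) (hO' : ¬ f =O[𝓝 0] fun t : ℝ => t ^ (k + 2)) :
    IsA k H := by
  obtain ⟨e, hes, he0, hfe⟩ := exists_eq_pow_mul_ne_zero hf hO hO'
  have hne : ∀ᶠ t in 𝓝 0, e t ≠ 0 := hes.continuous.continuousAt.eventually_ne he0
  obtain ⟨ε₁, hε₁, hsign⟩ : ∃ ε₁ : ℝ, (ε₁ = 1 ∨ ε₁ = -1) ∧ ∀ᶠ t in 𝓝 0, 0 < ε₁ * e t := by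
    rcases lt_or_gt_of_ne he0 with h | h
    · exact ⟨-1, Or.inr rfl, by
        filter_upwards [hes.continuous.continuousAt.eventually_lt_const h] with t ht; linarith⟩
    · exact ⟨1, Or.inl rfl, by
        filter_upwards [hes.continuous.continuousAt.eventually_const_lt h] with t ht; linarith⟩
  have hε₁2 : ε₁ * ε₁ = 1 := by rcases hε₁ with rfl | rfl <;> norm_num
  let ρ : ℝ → ℝ := fun t => (ε₁ * e t) ^ ((1 : ℝ) / (k + 1))
  have hρ : SmoothGerm ρ := by
    filter_upwards [hsign] with t ht
    exact (contDiffAt_const.mul hes.contDiffAt).rpow_const_of_ne ht.ne'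
  have hρ0 : 0 < ρ 0 := Real.rpow_pos_of_pos hsign.self_of_nhds _
  have hξ : DiffeoGerm fun t => t * ρ t := by
    refine diffeoGerm_of_deriv_ne_zero (by simp) ?_ ?_
    · filter_upwards [hρ] with t ht using contDiffAt_id.mul ht
    · have h1 := (hasDerivAt_id' (0 : ℝ)).fun_mul
        (hρ.contDiffAt.differentiableAt (by simp)).hasDerivAt
      rw [h1.deriv]
      simpa using hρ0.ne'
  have hχ := diffeoGerm_triangular hξ hr hr0 hrd
  obtain ⟨φ, -, hφ, -, hφr⟩ := hχ.exists_inverse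
  refine ⟨φ, ε₁, ε, hφ, hε₁, hε, ?_⟩
  have hH0 : H 0 = 0 := by
    rw [he.self_of_nhds, hr0]
    have := hfe.self_of_nhds
    simp [this]
  have hφ1 : Tendsto (fun w => (φ w).1) (𝓝 0) (𝓝 0) := hφ.2.1.fst.tendsto (by simp [hφ.1])
  filter_upwards [hφr, hφ.tendsto.eventually he, hφ1.eventually hfe, hφ1.eventually hsign]
    with w h1 h2 h3 h4
  have h5 : ρ (φ w).1 ^ (k + 1) = ε₁ * e (φ w).1 := by
    simp only [ρ]
    rw [← Real.rpow_natCast, ← Real.rpow_mul h4.le]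
    have : (1 : ℝ) / (k + 1) * ((k + 1 : ℕ) : ℝ) = 1 := by push_cast; field_simp
    rw [this, Real.rpow_one]
  have h6 : w.1 ^ (k + 1) = (φ w).1 ^ (k + 1) * (ε₁ * e (φ w).1) := by
    rw [← congrArg Prod.fst h1, mul_pow, h5]
  have h7 : w.2 = r (φ w) := (congrArg Prod.snd h1).symm
  rw [h2, h3, hH0, h6, h7]
  linear_combination -((φ w).1 ^ (k + 1) * e (φ w).1) * hε₁2

theorem isAGe_of_split {k : ℕ} {H : ℝ × ℝ → ℝ} {f : ℝ → ℝ} {r : ℝ × ℝ → ℝ} {ε : ℝ}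
    (hε : ε = 1 ∨ ε = -1) (hf : SmoothGerm f) (hr : SmoothGerm r) (hr0 : r 0 = 0)
    (hrd : dsnd r 0 ≠ 0) (he : ∀ᶠ w in 𝓝 0, H w = f w.1 + ε * r w ^ 2)
    (hO : f =O[𝓝 0] fun t : ℝ => t ^ (k + 1)) : IsAGe k H := by
  have hχ := diffeoGerm_fibered hr hr0 hrd
  obtain ⟨φ, -, hφ, -, hφr⟩ := hχ.exists_inverse
  have hz := (isBigO_pow_iff (k + 1) hf).1 hO
  refine ⟨φ, f, ε, hφ, hf, fun j hj => hz j (by omega), hε, ?_⟩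
  have hH0 : H 0 = 0 := by
    rw [he.self_of_nhds, hr0]
    have := hz 0 (by omega)
    simpa using this
  filter_upwards [hφr, hφ.tendsto.eventually he] with w h1 h2
  have h6 : (φ w).1 = w.1 := (Prod.ext_iff.1 h1).1
  have h7 : r (φ w) = w.2 := (Prod.ext_iff.1 h1).2
  rw [h2, hH0, zero_add, h6, h7]

/-- The hypotheses p, q split into three exhaustive cases; since the conclusions exclude each other,
each implication has its converse. -/
theorem iff_of_exclusive {p q a b c : Prop} (h1 : ¬ p → a) (h2 : p → ¬ q → b) (h3 : p → q → c)
    (hab : a → b → False) (hac : a → c → False) (hbc : b → c → False) :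
    (a ↔ ¬ p) ∧ (b ↔ p ∧ ¬ q) ∧ (c ↔ p ∧ q) := by
  tauto

/-- The type of a corank one singularity is read off from its values along a curve on which the
derivative transverse to the kernel direction of the Hessian vanishes to third order. -/
theorem type_iff_along_curve {H : ℝ × ℝ → ℝ} {c : ℝ → ℝ × ℝ} (hH : SmoothGerm H)
    (h1 : dsnd H 0 = 0) (h2 : dsnd (dsnd H) 0 ≠ 0) (hc : SmoothGerm c) (hc0 : c 0 = 0)
    (hcd : DiffeoGerm fun t => (c t).1)
    (hcrit : (fun t => dsnd H (c t)) =O[𝓝 0] fun t : ℝ => t ^ 3)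
    (hval : (fun t => H (c t)) =O[𝓝 0] fun t : ℝ => t ^ 3) :
    (IsA 2 H ↔ iteratedDeriv 3 (fun t => H (c t)) 0 ≠ 0) ∧
    (IsA 3 H ↔ iteratedDeriv 3 (fun t => H (c t)) 0 = 0 ∧
      iteratedDeriv 4 (fun t => H (c t)) 0 ≠ 0) ∧
    (IsAGe 4 H ↔ iteratedDeriv 3 (fun t => H (c t)) 0 = 0 ∧
      iteratedDeriv 4 (fun t => H (c t)) 0 = 0) := by
  obtain ⟨κ, hκ, hpos⟩ : ∃ κ : ℝ, (κ = 1 ∨ κ = -1) ∧ 0 < κ * dsnd (dsnd H) 0 := by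
    rcases lt_or_gt_of_ne h2 with h | h
    · exact ⟨-1, Or.inr rfl, by linarith⟩
    · exact ⟨1, Or.inl rfl, by linarith⟩
  have hκ0 : κ ≠ 0 := by rcases hκ with rfl | rfl <;> norm_num
  obtain ⟨f, r, hf, hr, hr0, hrd, he⟩ := exists_splitting hH h1 hpos
  have hct := hc.tendsto hc0
  -- Differentiating the splitting gives H_v = 2κ r_v r with r_v ≠ 0 near 0, so r inherits the order
  -- of H_v along the curve.
  have hrc : (fun t => r (c t)) =O[𝓝 0] fun t : ℝ => t ^ 3 := by
    have hev : ∀ᶠ w in 𝓝 (0 : ℝ × ℝ), dsnd H w = 2 * κ * dsnd r w * r w := by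
      filter_upwards [he.eventually_nhds, hr.differentiableAt] with w hw hd
      rw [dsnd_congr hw]
      have hfd : DifferentiableAt ℝ (fun w : ℝ × ℝ => f w.1) w :=
        (hf.differentiable (by simp) w.1).comp w differentiableAt_fst
      refine dsnd_eq_of_hasDerivAt (hfd.add ((hd.pow 2).const_mul κ)) ?_
      convert! (((hasDerivAt_snd hd).pow 2).const_mul κ).const_add (f w.1) using 1
      push_cast; ring
    have hne : ∀ᶠ w in 𝓝 (0 : ℝ × ℝ), 2 * κ * dsnd r w ≠ 0 :=
      (continuousAt_const.mul hr.dsnd.continuousAt).eventually_ne (by simp [hκ0, hrd])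
    have hinv : (fun t => (2 * κ * dsnd r (c t))⁻¹) =O[𝓝 0] fun _ => (1 : ℝ) := by
      refine Tendsto.isBigO_one ℝ (c := (2 * κ * dsnd r 0)⁻¹) ?_
      exact (((hr.dsnd.continuousAt.tendsto.comp hct).const_mul (2 * κ)).inv₀
        hne.self_of_nhds)
    refine IsBigO.congr' (hinv.mul hcrit) ?_ (by simp)
    filter_upwards [hct.eventually hev, hct.eventually hne] with t h3 h4
    rw [h3, ← mul_assoc, inv_mul_cancel₀ h4, one_mul]
  have hsq : (fun t => κ * r (c t) ^ 2) =O[𝓝 0] fun t : ℝ => t ^ 6 := by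
    have := (hrc.pow 2).const_mul_left κ
    simpa only [← pow_mul] using this
  have hcomp : ∀ᶠ t in 𝓝 0, H (c t) = f (c t).1 + κ * r (c t) ^ 2 := hct.eventually he
  -- The square term is O(t^6) along the curve and does not affect orders up to 6; orders 3, 4 and 5
  -- are the ones needed.
  have hfO : ∀ n ≤ 6, (f =O[𝓝 0] fun t : ℝ => t ^ n) ↔
      (fun t => H (c t)) =O[𝓝 0] fun t : ℝ => t ^ n := by
    intro n hn
    rw [← hcd.isBigO_comp_iff]
    have h6 := hsq.trans (pow_isBigO_pow hn)
    constructor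
    · exact fun h => (h.add h6).congr' (hcomp.mono fun t ht => ht.symm) EventuallyEq.rfl
    · intro h
      refine (h.sub h6).congr' (hcomp.mono fun t ht => ?_) EventuallyEq.rfl
      simp only; rw [ht]; ring
  have hHc : SmoothGerm fun t => H (c t) := hH.comp hc hc0
  have hf3 := (hfO 3 (by norm_num)).2 hval
  have hf4 : (f =O[𝓝 0] fun t : ℝ => t ^ 4) ↔ iteratedDeriv 3 (fun t => H (c t)) 0 = 0 :=
    (hfO 4 (by norm_num)).trans (isBigO_pow_succ_iff hHc hval)
  have hf5 : (f =O[𝓝 0] fun t : ℝ => t ^ 5) ↔ iteratedDeriv 3 (fun t => H (c t)) 0 = 0 ∧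
      iteratedDeriv 4 (fun t => H (c t)) 0 = 0 := by
    constructor
    · intro h
      have h4 := h.trans (pow_isBigO_pow (by norm_num : 4 ≤ 5))
      exact ⟨hf4.1 h4, (isBigO_pow_succ_iff hHc ((hfO 4 (by norm_num)).1 h4)).1
        ((hfO 5 (by norm_num)).1 h)⟩
    · rintro ⟨h3, h4⟩
      exact (hfO 5 (by norm_num)).2 ((isBigO_pow_succ_iff hHc
        ((hfO 4 (by norm_num)).1 (hf4.2 h3))).2 h4)
  have A2 : iteratedDeriv 3 (fun t => H (c t)) 0 ≠ 0 → IsA 2 H := fun h =>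
    isA_of_split hκ hf.smoothGerm hr hr0 hrd he hf3 (fun h' => h (hf4.1 h'))
  have A3 : iteratedDeriv 3 (fun t => H (c t)) 0 = 0 →
      iteratedDeriv 4 (fun t => H (c t)) 0 ≠ 0 → IsA 3 H := fun h h' =>
    isA_of_split hκ hf.smoothGerm hr hr0 hrd he (hf4.2 h) (fun h'' => h' (hf5.1 h'').2)
  have A4 : iteratedDeriv 3 (fun t => H (c t)) 0 = 0 →
      iteratedDeriv 4 (fun t => H (c t)) 0 = 0 → IsAGe 4 H := fun h h' =>
    isAGe_of_split hκ hf.smoothGerm hr hr0 hrd he (hf5.2 ⟨h, h'⟩)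
  have X23 : IsA 2 H → IsA 3 H → False := fun a b =>
    a.not_hasFlat (by norm_num) (by norm_num) b.isAGe.hasFlat
  have X24 : IsA 2 H → IsAGe 4 H → False := fun a b =>
    a.not_hasFlat (by norm_num) (by norm_num) b.hasFlat
  have X34 : IsA 3 H → IsAGe 4 H → False := fun a b =>
    a.not_hasFlat (by norm_num) (by norm_num) b.hasFlat
  exact iff_of_exclusive A2 A3 A4 X23 X24 X34

/-! ### Rotations and vector products in three-space. -/

section EuclideanThree

theorem inner_E3 (x y : E3) : inner ℝ x y = x 0 * y 0 + x 1 * y 1 + x 2 * y 2 := by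
  simp [PiLp.inner_apply, Fin.sum_univ_three, mul_comm]

theorem cross_zero (a b : E3) : cross a b 0 = a 1 * b 2 - a 2 * b 1 := by
  simp [cross, cross_apply]

theorem cross_one (a b : E3) : cross a b 1 = a 2 * b 0 - a 0 * b 2 := by
  simp [cross, cross_apply]

theorem cross_two (a b : E3) : cross a b 2 = a 0 * b 1 - a 1 * b 0 := by
  simp [cross, cross_apply]

theorem ext_E3 {x y : E3} (h0 : x 0 = y 0) (h1 : x 1 = y 1) (h2 : x 2 = y 2) : x = y := by
  ext i
  fin_cases i <;> assumption

/-- The linear isometry sending an oriented orthonormal frame to the standard one. -/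
theorem exists_rotation_of_orthonormal {e₁ e₂ : E3} (h11 : inner ℝ e₁ e₁ = 1)
    (h22 : inner ℝ e₂ e₂ = 1) (h12 : inner ℝ e₁ e₂ = 0) :
    ∃ R : E3 ≃ₗᵢ[ℝ] E3, LinearMap.det (R.toLinearEquiv : E3 →ₗ[ℝ] E3) = 1 ∧
      ∀ x, R x 0 = inner ℝ e₁ x ∧ R x 1 = inner ℝ e₂ x ∧ R x 2 = inner ℝ (cross e₁ e₂) x := by
  let v : Fin 3 → E3 := ![e₁, e₂, cross e₁ e₂]
  have h21 : inner ℝ e₂ e₁ = 0 := by rw [real_inner_comm, h12]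
  rw [inner_E3] at h11 h22 h12 h21
  have hv : Orthonormal ℝ v := by
    rw [orthonormal_iff_ite]
    intro i j
    rw [inner_E3]
    fin_cases i <;> fin_cases j <;> simp [v, cross_zero, cross_one, cross_two] <;>
      try linarith
    linear_combination (e₂ 0 * e₂ 0 + e₂ 1 * e₂ 1 + e₂ 2 * e₂ 2) * h11 + h22 -
      (e₁ 0 * e₂ 0 + e₁ 1 * e₂ 1 + e₁ 2 * e₂ 2) * h12
  have hspan : ⊤ ≤ Submodule.span ℝ (Set.range v) :=
    (hv.linearIndependent.span_eq_top_of_card_eq_finrank (by simp)).ge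
  let b := OrthonormalBasis.mk hv hspan
  have hb : ∀ x i, b.repr x i = inner ℝ (v i) x := fun x i => by
    rw [b.repr_apply_apply]; simp [b]
  refine ⟨b.repr, ?_, fun x => ⟨hb x 0, hb x 1, hb x 2⟩⟩
  let s := (EuclideanSpace.basisFun (Fin 3) ℝ).toBasis
  rw [← LinearMap.det_toMatrix s, Matrix.det_fin_three]
  have hentry : ∀ i j, LinearMap.toMatrix s s (b.repr.toLinearEquiv : E3 →ₗ[ℝ] E3) i j = v i j := by
    intro i j
    rw [LinearMap.toMatrix_apply]
    simp only [s, OrthonormalBasis.coe_toBasis, EuclideanSpace.basisFun_apply]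
    change b.repr (EuclideanSpace.single j 1) i = v i j
    rw [hb, inner_E3]
    fin_cases j <;> simp
  simp only [hentry]
  simp [v, cross_zero, cross_one, cross_two]
  -- The determinant of the frame e₁, e₂, e₁ × e₂ is |e₁ × e₂|², which equals 1 by Lagrange's
  -- identity. It is stated for free variables so that it can be closed by polynomial arithmetic.
  have h : ∀ a b c d e f : ℝ, a * a + b * b + c * c = 1 → d * d + e * e + f * f = 1 →
      a * d + b * e + c * f = 0 →
      a * e * (a * e - b * d) - a * f * (c * d - a * f) - b * d * (a * e - b * d)
        + b * f * (b * f - c * e) + c * d * (c * d - a * f) - c * e * (b * f - c * e) = 1 := by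
    intro a b c d e f h1 h2 h3
    linear_combination (d * d + e * e + f * f) * h1 + h2 - (a * d + b * e + c * f) * h3
  exact h _ _ _ _ _ _ h11 h22 h12

/-- The orthogonal triangularization of two independent vectors by a rotation. -/
theorem exists_rotation_triangular {a₁ a₂ : E3} (h : LinearIndependent ℝ ![a₁, a₂]) :
    ∃ R : E3 ≃ₗᵢ[ℝ] E3, LinearMap.det (R.toLinearEquiv : E3 →ₗ[ℝ] E3) = 1 ∧
      R a₁ 0 ≠ 0 ∧ R a₁ 1 = 0 ∧ R a₁ 2 = 0 ∧ 0 < R a₂ 1 ∧ R a₂ 2 = 0 := by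
  rw [LinearIndependent.pair_iff] at h
  have h1 : a₁ ≠ 0 := by
    rintro rfl
    have := h 1 0 (by simp)
    simp at this
  have hn : ‖a₁‖ ≠ 0 := norm_ne_zero_iff.2 h1
  set e₁ : E3 := ‖a₁‖⁻¹ • a₁ with he₁
  have h11 : inner ℝ e₁ e₁ = 1 := by
    rw [he₁, real_inner_smul_left, real_inner_smul_right, real_inner_self_eq_norm_sq]
    field_simp
  have ha₁ : a₁ = ‖a₁‖ • e₁ := by rw [he₁, smul_smul, mul_inv_cancel₀ hn, one_smul]
  set w : E3 := a₂ - inner ℝ e₁ a₂ • e₁ with hw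
  have hw0 : w ≠ 0 := by
    intro h0
    have := h (inner ℝ e₁ a₂ * ‖a₁‖⁻¹) (-1) (by
      rw [mul_smul, ← he₁, neg_smul, one_smul]
      have h2 := sub_eq_zero.1 (hw.symm.trans h0)
      rw [← h2]; simp)
    norm_num at this
  have hwn : ‖w‖ ≠ 0 := norm_ne_zero_iff.2 hw0
  have h1w : inner ℝ e₁ w = 0 := by
    rw [hw, inner_sub_right, real_inner_smul_right, h11]; ring
  set e₂ : E3 := ‖w‖⁻¹ • w with he₂
  have h22 : inner ℝ e₂ e₂ = 1 := by
    rw [he₂, real_inner_smul_left, real_inner_smul_right, real_inner_self_eq_norm_sq]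
    field_simp
  have h12 : inner ℝ e₁ e₂ = 0 := by rw [he₂, real_inner_smul_right, h1w, mul_zero]
  have hwe : w = ‖w‖ • e₂ := by rw [he₂, smul_smul, mul_inv_cancel₀ hwn, one_smul]
  have ha₂ : a₂ = inner ℝ e₁ a₂ • e₁ + ‖w‖ • e₂ := by rw [← hwe, hw]; abel
  have h31 : inner ℝ (cross e₁ e₂) e₁ = 0 := by
    simp only [inner_E3, cross_zero, cross_one, cross_two]; ring
  have h32 : inner ℝ (cross e₁ e₂) e₂ = 0 := by
    simp only [inner_E3, cross_zero, cross_one, cross_two]; ring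
  have h21 : inner ℝ e₂ e₁ = 0 := by rw [real_inner_comm, h12]
  obtain ⟨R, hR, hx⟩ := exists_rotation_of_orthonormal h11 h22 h12
  refine ⟨R, hR, ?_, ?_, ?_, ?_, ?_⟩
  · rw [(hx _).1, ha₁, real_inner_smul_right, h11]; simpa using hn
  · rw [(hx _).2.1, ha₁, real_inner_smul_right, h21, mul_zero]
  · rw [(hx _).2.2, ha₁, real_inner_smul_right, h31, mul_zero]
  · rw [(hx _).2.1, ha₂, inner_add_right, real_inner_smul_right e₂ e₁,
      real_inner_smul_right e₂ e₂, h21, h22]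
    simpa using hw0
  · rw [(hx _).2.2, ha₂, inner_add_right, real_inner_smul_right _ e₁,
      real_inner_smul_right _ e₂, h31, h32]
    simp

/-- The triple product is the determinant of the three vectors, hence is multiplied by det R = 1. -/
theorem inner_cross_map {R : E3 ≃ₗᵢ[ℝ] E3} (hR : LinearMap.det (R.toLinearEquiv : E3 →ₗ[ℝ] E3) = 1)
    (a b c : E3) : inner ℝ (cross (R a) (R b)) (R c) = inner ℝ (cross a b) c := by
  have key : ∀ x y z : E3, inner ℝ (cross x y) z =
      (EuclideanSpace.basisFun (Fin 3) ℝ).toBasis.det ![x, y, z] := by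
    intro x y z
    rw [Module.Basis.det_apply, Matrix.det_fin_three]
    simp [inner_E3, cross_zero, cross_one, cross_two, Module.Basis.toMatrix_apply]
    ring
  have hcomp := (EuclideanSpace.basisFun (Fin 3) ℝ).toBasis.det_comp
    (R.toLinearEquiv : E3 →ₗ[ℝ] E3) ![a, b, c]
  rw [hR, one_mul] at hcomp
  rw [key, key, ← hcomp]
  congr 1
  funext i
  fin_cases i <;> rfl

theorem cross_map {R : E3 ≃ₗᵢ[ℝ] E3} (hR : LinearMap.det (R.toLinearEquiv : E3 →ₗ[ℝ] E3) = 1)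
    (a b : E3) : cross (R a) (R b) = R (cross a b) := by
  refine ext_inner_right ℝ fun v => ?_
  obtain ⟨c, rfl⟩ := R.surjective v
  rw [inner_cross_map hR, R.inner_map_map]

end EuclideanThree

/-! ### Vector fields along curves that are nearly killed by the differential. -/

theorem SmoothGerm.apply_E3 {E : Type*} [NormedAddCommGroup E] [NormedSpace ℝ E] {G : E → E3}
    (hG : SmoothGerm G) (i : Fin 3) : SmoothGerm fun w => G w i :=
  hG.clm_comp (EuclideanSpace.proj i : E3 →L[ℝ] ℝ)

theorem fderiv_apply_E3 {E : Type*} [NormedAddCommGroup E] [NormedSpace ℝ E] {G : E → E3} {p : E}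
    (hG : DifferentiableAt ℝ G p) (i : Fin 3) (v : E) :
    fderiv ℝ G p v i = fderiv ℝ (fun w => G w i) p v := by
  have h := ((EuclideanSpace.proj i : E3 →L[ℝ] ℝ).hasFDerivAt.comp p hG.hasFDerivAt).fderiv
  have h2 : fderiv ℝ (fun w => G w i) p = _ := h
  rw [h2]; rfl

theorem isBigO_apply_E3 {f : ℝ → E3} {g : ℝ → ℝ} (h : f =O[𝓝 0] g) (i : Fin 3) :
    (fun t => f t i) =O[𝓝 0] g :=
  ((EuclideanSpace.proj i : E3 →L[ℝ] ℝ).isBigO_comp f (𝓝 0)).trans h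

/-- A regular curve `c` with a nonvanishing vector field `ξ` along it which the differential of
`g` kills to order `j`. -/
structure FieldFlat (j : ℕ) (g : ℝ × ℝ → E3) (c ξ : ℝ → ℝ × ℝ) : Prop where
  smooth : SmoothGerm c
  zero : c 0 = 0
  regular : deriv c 0 ≠ 0
  continuousAt : ContinuousAt ξ 0
  ne_zero : ξ 0 ≠ 0
  flat : (fun t => fderiv ℝ g (c t) (ξ t)) =O[𝓝 0] fun t : ℝ => t ^ j

/-- Differentiating g ∘ φ = Φ ∘ f gives dg(dφ ξ) = dΦ(df ξ), and dΦ is bounded along the curve. Only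
smoothness of Φ is needed, while φ must be a diffeomorphism to keep the curve regular and the field
nonzero. -/
theorem FieldFlat.transport {j : ℕ} {f g : ℝ × ℝ → E3} {c ξ : ℝ → ℝ × ℝ} {φ : ℝ × ℝ → ℝ × ℝ}
    {Φ : E3 → E3} (h : FieldFlat j f c ξ) (hf : SmoothGerm f) (hg : SmoothGerm g) (hf0 : f 0 = 0)
    (hφ : DiffeoGerm φ) (hΦ : SmoothGerm Φ) (he : (fun w => g (φ w)) =ᶠ[𝓝 0] fun w => Φ (f w)) :
    FieldFlat j g (fun t => φ (c t)) fun t => fderiv ℝ φ (c t) (ξ t) := by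
  have hct := h.smooth.tendsto h.zero
  have hDφ : ContinuousAt (fun t => fderiv ℝ φ (c t)) 0 := by
    have := hφ.2.1.fderiv.continuousAt.tendsto.comp hct
    simpa [ContinuousAt, h.zero, Function.comp_def] using this
  refine ⟨hφ.2.1.comp h.smooth h.zero, by simp [h.zero, hφ.1],
    hφ.deriv_comp_ne_zero h.smooth h.zero h.regular, hDφ.clm_apply h.continuousAt, ?_, ?_⟩
  · rw [h.zero]
    exact fun h0 => h.ne_zero (hφ.injective (by rw [h0, map_zero]))
  · have hft := hf.tendsto hf0
    have e : (fun t => fderiv ℝ g (φ (c t)) (fderiv ℝ φ (c t) (ξ t))) =ᶠ[𝓝 0]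
        fun t => fderiv ℝ Φ (f (c t)) (fderiv ℝ f (c t) (ξ t)) := by
      filter_upwards [hct.eventually he.eventuallyEq_nhds, hct.eventually hf.differentiableAt,
        hct.eventually hφ.2.1.differentiableAt, (hφ.tendsto.comp hct).eventually hg.differentiableAt,
        (hft.comp hct).eventually hΦ.differentiableAt] with t h1 h2 h3 h4 h5
      have h6 := (h4.hasFDerivAt.comp (c t) h3.hasFDerivAt).fderiv
      have h7 := (h5.hasFDerivAt.comp (c t) h2.hasFDerivAt).fderiv
      have h8 : fderiv ℝ (g ∘ φ) (c t) = fderiv ℝ (Φ ∘ f) (c t) := h1.fderiv_eq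
      rw [h6, h7] at h8
      exact DFunLike.congr_fun h8 (ξ t)
    refine e.trans_isBigO ?_
    have hb : (fun t => fderiv ℝ Φ (f (c t))) =O[𝓝 0] fun _ => (1 : ℝ) :=
      (hΦ.fderiv.continuousAt.tendsto.comp (hft.comp hct)).isBigO_one ℝ
    have := hb.norm_left.mul h.flat.norm_left
    simp only [one_mul] at this
    refine IsBigO.trans (IsBigO.of_bound 1 (Eventually.of_forall fun t => ?_)) this
    rw [one_mul, Real.norm_of_nonneg (by positivity)]
    exact ContinuousLinearMap.le_opNorm _ _

/-- The first coordinate of G being u, flatness makes the first component of ξ of order j. The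
second component is then nonzero near 0, and dividing by it shows that ∂/∂v itself is killed to
order j. -/
theorem FieldFlat.vertical {j : ℕ} (hj : 1 ≤ j) {G : ℝ × ℝ → E3} {c ξ : ℝ → ℝ × ℝ}
    (h : FieldFlat j G c ξ) (hG : SmoothGerm G) (h1 : ∀ᶠ w in 𝓝 (0 : ℝ × ℝ), G w 0 = w.1)
    (i : Fin 3) : (fun t => dsnd (fun w => G w i) (c t)) =O[𝓝 0] fun t : ℝ => t ^ j := by
  have hct := h.smooth.tendsto h.zero
  have hξ1 : (fun t => (ξ t).1) =O[𝓝 0] fun t : ℝ => t ^ j := by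
    refine (isBigO_apply_E3 h.flat 0).congr' ?_ EventuallyEq.rfl
    filter_upwards [hct.eventually hG.differentiableAt, hct.eventually h1.eventually_nhds]
      with t h2 h3
    rw [fderiv_apply_E3 h2]
    have h4 : (fun w => G w 0) =ᶠ[𝓝 (c t)] fun w : ℝ × ℝ => w.1 := h3
    rw [h4.fderiv_eq, fderiv_fst]; rfl
  -- This uses j ≥ 1: for j = 0 the bound would say nothing at the origin.
  have hξ10 : (ξ 0).1 = 0 := by
    obtain ⟨C, hC⟩ := hξ1.bound
    simpa [zero_pow (by omega : j ≠ 0)] using hC.self_of_nhds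
  have hξ20 : (ξ 0).2 ≠ 0 := fun h2 => h.ne_zero (Prod.ext hξ10 h2)
  have hξ2 : ContinuousAt (fun t => (ξ t).2) 0 := h.continuousAt.snd
  have hinv : (fun t => ((ξ t).2)⁻¹) =O[𝓝 0] fun _ => (1 : ℝ) :=
    (hξ2.tendsto.inv₀ hξ20).isBigO_one ℝ
  have hu : (fun t => fderiv ℝ (fun w => G w i) (c t) (1, 0)) =O[𝓝 0] fun _ => (1 : ℝ) := by
    have h2 : ContinuousAt (fun w => fderiv ℝ (fun w => G w i) w (1, 0)) 0 :=
      (hG.apply_E3 i).fderiv.continuousAt.clm_apply continuousAt_const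
    exact (h2.tendsto.comp hct).isBigO_one ℝ
  have h3 := hinv.mul ((isBigO_apply_E3 h.flat i).sub (by simpa using hξ1.mul hu))
  simp only [one_mul] at h3
  refine h3.congr' ?_ EventuallyEq.rfl
  filter_upwards [hct.eventually hG.differentiableAt, hξ2.eventually_ne hξ20] with t h4 h5
  rw [fderiv_apply_E3 h4]
  have h6 : ξ t = (ξ t).1 • ((1 : ℝ), (0 : ℝ)) + (ξ t).2 • ((0 : ℝ), (1 : ℝ)) := by simp
  have h7 : fderiv ℝ (fun w => G w i) (c t) (ξ t) =
      (ξ t).1 * fderiv ℝ (fun w => G w i) (c t) (1, 0) +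
        (ξ t).2 * fderiv ℝ (fun w => G w i) (c t) (0, 1) := by
    conv_lhs => rw [h6]
    rw [map_add, map_smul, map_smul, smul_eq_mul, smul_eq_mul]
  rw [h7, dsnd]
  field_simp
  ring

/-! ### Expansion in the second variable; the order of q_v as an invariant. -/

theorem tendsto_inl : Tendsto (fun u : ℝ => (u, (0 : ℝ))) (𝓝 0) (𝓝 0) :=
  (by fun_prop : Continuous fun u : ℝ => (u, (0 : ℝ))).tendsto' _ _ rfl

theorem tendsto_inr : Tendsto (fun v : ℝ => ((0 : ℝ), v)) (𝓝 0) (𝓝 0) :=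
  (by fun_prop : Continuous fun v : ℝ => ((0 : ℝ), v)).tendsto' _ _ rfl

theorem smoothGerm_inl {F : Type*} [NormedAddCommGroup F] [NormedSpace ℝ F] {f : ℝ × ℝ → F}
    (hf : SmoothGerm f) : SmoothGerm fun u : ℝ => f (u, 0) :=
  hf.comp (f := fun u : ℝ => (u, (0 : ℝ)))
    (by fun_prop : ContDiff ℝ ∞ fun u : ℝ => (u, (0 : ℝ))).smoothGerm rfl

theorem smoothGerm_inr {F : Type*} [NormedAddCommGroup F] [NormedSpace ℝ F] {f : ℝ × ℝ → F}
    (hf : SmoothGerm f) : SmoothGerm fun v : ℝ => f (0, v) :=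
  hf.comp (f := fun v : ℝ => ((0 : ℝ), v))
    (by fun_prop : ContDiff ℝ ∞ fun v : ℝ => ((0 : ℝ), v)).smoothGerm rfl

theorem SmoothGerm.sub {E : Type*} [NormedAddCommGroup E] [NormedSpace ℝ E]
    {F : Type*} [NormedAddCommGroup F] [NormedSpace ℝ F] {f g : E → F}
    (hf : SmoothGerm f) (hg : SmoothGerm g) : SmoothGerm fun x => f x - g x := by
  filter_upwards [hf, hg] with x h1 h2 using h1.sub h2

/-- A germ minus its restriction to the first axis is divisible by the second variable. -/
theorem exists_eq_add_snd_mul {f : ℝ × ℝ → ℝ} (hf : SmoothGerm f) :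
    ∃ k : ℝ × ℝ → ℝ, ContDiff ℝ ∞ k ∧ (∀ᶠ w in 𝓝 0, f w = f (w.1, 0) + w.2 * k w) ∧
      ∀ᶠ u in 𝓝 0, dsnd f (u, 0) = k (u, 0) := by
  have h1 : SmoothGerm fun w : ℝ × ℝ => f (w.1, 0) :=
    (smoothGerm_inl hf).comp contDiff_fst.smoothGerm rfl
  obtain ⟨k, hk, he⟩ := exists_eq_snd_mul (f := fun w => f w - f (w.1, 0)) (hf.sub h1) (by simp)
  refine ⟨k, hk, he.mono fun w hw => by linarith, ?_⟩
  filter_upwards [tendsto_inl.eventually he.eventually_nhds,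
    tendsto_inl.eventually hf.differentiableAt] with u h2 h3
  have h4 := dsnd_congr h2
  rw [dsnd_snd_mul (hk.differentiable (by simp) _), zero_mul, add_zero] at h4
  rw [← h4]
  exact (dsnd_eq_of_hasDerivAt (((contDiff_snd.mul hk).differentiable (by simp)
    _).congr_of_eventuallyEq h2) ((hasDerivAt_snd h3).sub_const (f (u, 0)))).symm

/-- The mean value inequality for f - df(0), whose differential is O(‖x‖). -/
theorem isBigO_sq_sub_fderiv {E F : Type*} [NormedAddCommGroup E] [NormedSpace ℝ E]
    [NormedAddCommGroup F] [NormedSpace ℝ F] {f : E → F} (hf : SmoothGerm f) (h0 : f 0 = 0) :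
    (fun x => f x - fderiv ℝ f 0 x) =O[𝓝 0] fun x => ‖x‖ ^ 2 := by
  have hl : (fun x => fderiv ℝ f x - fderiv ℝ f 0) =O[𝓝 0] fun x => x := by
    have := (hf.fderiv.contDiffAt.differentiableAt (by simp)).isBigO_sub
    simpa using this
  obtain ⟨C, hC0, hC⟩ := hl.exists_pos
  obtain ⟨r, hr, hball⟩ := Metric.eventually_nhds_iff_ball.1 (hC.bound.and hf.differentiableAt)
  refine IsBigO.of_bound C ?_
  filter_upwards [Metric.ball_mem_nhds 0 hr] with x hx
  have hsub : Metric.closedBall (0 : E) ‖x‖ ⊆ Metric.ball 0 r :=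
    Metric.closedBall_subset_ball (by simpa using hx)
  have := (convex_closedBall (0 : E) ‖x‖).norm_image_sub_le_of_norm_hasFDerivWithin_le
    (f := fun x => f x - fderiv ℝ f 0 x) (f' := fun x => fderiv ℝ f x - fderiv ℝ f 0)
    (C := C * ‖x‖) (x := 0) (y := x) (fun y hy =>
      ((hball y (hsub hy)).2.hasFDerivAt.sub (fderiv ℝ f 0).hasFDerivAt).hasFDerivWithinAt)
    (fun y hy => (hball y (hsub hy)).1.trans (by
      have : ‖y‖ ≤ ‖x‖ := by simpa using hy
      gcongr)) (by simp) (by simp)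
  simp only [h0, map_zero, sub_zero] at this
  rw [norm_pow, norm_norm, pow_two, ← mul_assoc]
  exact this

/-- The expansion of the third coordinate function of a surface in normal form. -/
theorem exists_expansion {q : ℝ × ℝ → ℝ} {m : ℕ} (hm : 1 ≤ m) (hq : SmoothGerm q)
    (h1 : (fun u : ℝ => q (u, 0)) =O[𝓝 0] fun u : ℝ => u ^ 2)
    (h2 : (fun u : ℝ => dsnd q (u, 0)) =O[𝓝 0] fun u : ℝ => u ^ m)
    (h3 : (fun v : ℝ => q (0, v)) =O[𝓝 0] fun v : ℝ => v ^ 3) :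
    ∃ (A D : ℝ → ℝ) (E : ℝ × ℝ → ℝ), ContDiff ℝ ∞ A ∧ ContDiff ℝ ∞ D ∧ ContDiff ℝ ∞ E ∧
      E 0 = 0 ∧ (∀ᶠ u in 𝓝 0, dsnd q (u, 0) = u ^ m * D u) ∧
      ∀ᶠ w in 𝓝 (0 : ℝ × ℝ),
        q w = w.1 ^ 2 * A w.1 + w.1 ^ m * D w.1 * w.2 + w.2 ^ 2 * E w := by
  obtain ⟨A, hA, hqA⟩ := exists_eq_pow_mul (smoothGerm_inl hq) h1
  obtain ⟨D, hD, hqD⟩ := exists_eq_pow_mul (smoothGerm_inl hq.dsnd) h2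
  obtain ⟨k, hk, hqk, hdk⟩ := exists_eq_add_snd_mul hq
  obtain ⟨E, hE, hkE, -⟩ := exists_eq_add_snd_mul hk.smoothGerm
  have hfst : Tendsto (fun w : ℝ × ℝ => w.1) (𝓝 0) (𝓝 0) := continuous_fst.tendsto' _ _ rfl
  have hmain : ∀ᶠ w in 𝓝 (0 : ℝ × ℝ),
      q w = w.1 ^ 2 * A w.1 + w.1 ^ m * D w.1 * w.2 + w.2 ^ 2 * E w := by
    filter_upwards [hqk, hkE, hfst.eventually hqA, hfst.eventually hqD, hfst.eventually hdk]
      with w e1 e2 e3 e4 e5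
    rw [e1, e2, e3, ← e5, e4]; ring
  refine ⟨A, D, E, hA, hD, hE, ?_, hqD, hmain⟩
  have h4 : (fun v : ℝ => v ^ 2 * E (0, v)) =O[𝓝 0] fun v : ℝ => v ^ 3 := by
    refine h3.congr' ?_ EventuallyEq.rfl
    filter_upwards [tendsto_inr.eventually hmain] with v hv
    rw [hv]; simp [zero_pow (by omega : m ≠ 0)]
  have h5 := (isBigO_pow_iff 3 (by fun_prop :
    ContDiff ℝ ∞ fun v : ℝ => v ^ 2 * E (0, v)).smoothGerm).1 h4
  -- On u = 0 the mixed term disappears since m ≥ 1, leaving v² E(0,v) = O(v³). If E(0) were nonzero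
  -- one could divide by it and get v² = O(v³).
  by_contra hne
  refine not_pow_isBigO_pow_succ 2 ?_
  have hc : ContinuousAt (fun v : ℝ => E (0, v)) 0 := by
    have := hE.continuous; fun_prop
  have hne' : E ((0 : ℝ), (0 : ℝ)) ≠ 0 := hne
  have h6 : (fun v : ℝ => (E (0, v))⁻¹) =O[𝓝 0] fun _ => (1 : ℝ) :=
    (hc.tendsto.inv₀ hne').isBigO_one ℝ
  have h7 := h6.mul h4
  simp only [one_mul] at h7
  refine h7.congr' ?_ EventuallyEq.rfl
  filter_upwards [hc.eventually_ne hne'] with v hv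
  field_simp

/-- Surfaces `(u, p, q)` with `p_v = a v`, `a ≠ 0`. -/
structure IsPrenormal (G : ℝ × ℝ → E3) : Prop where
  smooth : SmoothGerm G
  zero : G 0 = 0
  fst : ∀ᶠ w in 𝓝 (0 : ℝ × ℝ), G w 0 = w.1
  snd : ∃ a : ℝ, a ≠ 0 ∧ ∀ᶠ w in 𝓝 (0 : ℝ × ℝ), dsnd (fun w => G w 1) w = a * w.2

theorem fderiv_snd_apply {G : ℝ × ℝ → E3} {p : ℝ × ℝ} (hG : DifferentiableAt ℝ G p) :
    fderiv ℝ G p (0, 1) = !₂[dsnd (fun w => G w 0) p, dsnd (fun w => G w 1) p,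
      dsnd (fun w => G w 2) p] := by
  apply ext_E3 <;> rw [fderiv_apply_E3 hG] <;> rfl

theorem isBigO_vec {f₀ f₁ f₂ g : ℝ → ℝ} (h0 : f₀ =O[𝓝 0] g) (h1 : f₁ =O[𝓝 0] g)
    (h2 : f₂ =O[𝓝 0] g) : (fun t => (!₂[f₀ t, f₁ t, f₂ t] : E3)) =O[𝓝 0] g := by
  have : ∀ t, (!₂[f₀ t, f₁ t, f₂ t] : E3) = f₀ t • (!₂[1, 0, 0] : E3) +
      f₁ t • (!₂[0, 1, 0] : E3) + f₂ t • (!₂[0, 0, 1] : E3) := by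
    intro t; apply ext_E3 <;> simp
  simp only [this]
  have hs : ∀ {f : ℝ → ℝ} (v : E3), f =O[𝓝 0] g → (fun t => f t • v) =O[𝓝 0] g := by
    intro f v hf
    have := hf.smul (isBigO_const_one ℝ v (𝓝 (0 : ℝ)))
    simpa using this
  exact ((hs _ h0).add (hs _ h1)).add (hs _ h2)

theorem fieldFlat_of_isBigO {j : ℕ} {G : ℝ × ℝ → E3} {s : ℝ → ℝ} (hG : SmoothGerm G)
    (h1 : ∀ᶠ w in 𝓝 (0 : ℝ × ℝ), G w 0 = w.1) (hs : SmoothGerm s) (hs0 : s 0 = 0)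
    (hd1 : (fun t : ℝ => dsnd (fun w => G w 1) (t, s t)) =O[𝓝 0] fun t : ℝ => t ^ j)
    (hd2 : (fun t : ℝ => dsnd (fun w => G w 2) (t, s t)) =O[𝓝 0] fun t : ℝ => t ^ j) :
    FieldFlat j G (fun t => (t, s t)) fun _ => (0, 1) := by
  have hc : SmoothGerm fun t : ℝ => (t, s t) := contDiff_id.smoothGerm.prodMk hs
  have hct := hc.tendsto (by simp [hs0])
  refine ⟨hc, by simp [hs0], ?_, continuousAt_const, by simp, ?_⟩
  · intro h
    have h2 := deriv_fst hc
    rw [h] at h2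
    simp at h2
  · refine (isBigO_vec (isBigO_zero _ _) hd1 hd2).congr' ?_ EventuallyEq.rfl
    filter_upwards [hct.eventually hG.differentiableAt, hct.eventually h1.eventually_nhds]
      with t h2 h3
    rw [fderiv_snd_apply h2]
    have h4 : dsnd (fun w => G w 0) (t, s t) = 0 := by
      have h5 : (fun w => G w 0) =ᶠ[𝓝 (t, s t)] fun w : ℝ × ℝ => w.1 := h3
      rw [dsnd_congr h5, dsnd, fderiv_fst]; rfl
    rw [h4]

theorem IsPrenormal.fieldFlat {j : ℕ} {G : ℝ × ℝ → E3} (hG : IsPrenormal G)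
    (h : (fun u : ℝ => dsnd (fun w => G w 2) (u, 0)) =O[𝓝 0] fun u : ℝ => u ^ j) :
    FieldFlat j G (fun t => (t, 0)) fun _ => (0, 1) := by
  obtain ⟨a, -, ha⟩ := hG.snd
  refine fieldFlat_of_isBigO hG.smooth hG.fst contDiff_const.smoothGerm rfl ?_ h
  refine (isBigO_zero _ _).congr' ?_ EventuallyEq.rfl
  filter_upwards [tendsto_inl.eventually ha] with t ht
  rw [ht, mul_zero]

/-- The second coordinate, with p_v = a v, places the curve within O(t^j) of the axis v = 0.
Replacing q_v on the curve by q_v on the axis costs only O(t^j), and j ≥ 2 makes the first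
coordinate a parameter. -/
theorem IsPrenormal.isBigO {j : ℕ} (hj : 2 ≤ j) {G : ℝ × ℝ → E3} (hG : IsPrenormal G)
    {c ξ : ℝ → ℝ × ℝ} (h : FieldFlat j G c ξ) :
    (fun u : ℝ => dsnd (fun w => G w 2) (u, 0)) =O[𝓝 0] fun u : ℝ => u ^ j := by
  have hct := h.smooth.tendsto h.zero
  obtain ⟨a, ha0, ha⟩ := hG.snd
  have hv : (fun t => (c t).2) =O[𝓝 0] fun t : ℝ => t ^ j := by
    refine (isBigO_const_mul_left_iff ha0).1
      ((h.vertical (by omega) hG.smooth hG.fst 1).congr' ?_ EventuallyEq.rfl)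
    exact hct.eventually ha
  rw [← (diffeoGerm_fst h.smooth h.zero h.regular hj hv).isBigO_comp_iff]
  obtain ⟨k, hk, hek, -⟩ := exists_eq_add_snd_mul (hG.smooth.apply_E3 2).dsnd
  have hkc : (fun t => k (c t)) =O[𝓝 0] fun _ => (1 : ℝ) :=
    ((hk.continuous.tendsto 0).comp hct).isBigO_one ℝ
  have h3 := hv.mul hkc
  simp only [mul_one] at h3
  refine ((h.vertical (by omega) hG.smooth hG.fst 2).sub h3).congr' ?_ EventuallyEq.rfl
  filter_upwards [hct.eventually hek] with t ht
  rw [ht]; ring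

/-- The order of `q_v` on the line `v = 0` is an invariant of `𝒜`-equivalence. -/
theorem IsPrenormal.isBigO_transfer {j : ℕ} (hj : 2 ≤ j) {f G : ℝ × ℝ → E3}
    (hf : IsPrenormal f) (hG : IsPrenormal G) {φ : ℝ × ℝ → ℝ × ℝ} {Φ : E3 → E3}
    (hφ : DiffeoGerm φ) (hΦ : SmoothGerm Φ) (he : (fun w => G (φ w)) =ᶠ[𝓝 0] fun w => Φ (f w))
    (h : (fun u : ℝ => dsnd (fun w => f w 2) (u, 0)) =O[𝓝 0] fun u : ℝ => u ^ j) :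
    (fun u : ℝ => dsnd (fun w => G w 2) (u, 0)) =O[𝓝 0] fun u : ℝ => u ^ j :=
  hG.isBigO hj ((hf.fieldFlat h).transport hf.smooth hG.smooth hf.zero hφ hΦ he)

/-! ### The models and their reduction to normal form. -/

/-- The common shape of the standard representatives. -/
noncomputable def modelMap (P Q : ℝ × ℝ → ℝ) (w : ℝ × ℝ) : E3 :=
  !₂[w.1, w.2 ^ 2, w.2 * (w.2 ^ 2 * P w + w.1 * Q w)]

theorem SingType.two_le_contactOrder {T : SingType} (hT : T.Admissible) : 2 ≤ T.contactOrder := by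
  cases T <;> simp only [SingType.Admissible, SingType.contactOrder] at * <;> omega

/-- All models have third coordinate v(v²P + uQ). The order of uQ(u,0), which is q_v on the axis, is
the contact order m; the term with P is irrelevant for it. -/
theorem exists_modelMap_eq {T : SingType} (hT : T.Admissible) {ε : ℝ} (hε : ε = 1 ∨ ε = -1) :
    ∃ (P Q : ℝ × ℝ → ℝ) (e : ℝ), ContDiff ℝ ∞ P ∧ ContDiff ℝ ∞ Q ∧ e ≠ 0 ∧
      (∀ x : ℝ, x * Q (x, 0) = e * x ^ T.contactOrder) ∧ T.model ε = modelMap P Q := by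
  have hε0 : ε ≠ 0 := by rcases hε with rfl | rfl <;> norm_num
  cases T with
  | S k =>
    refine ⟨fun _ => 1, fun w => ε * w.1 ^ k, ε, by fun_prop, by fun_prop, hε0, fun x => ?_, ?_⟩
    · simp only [SingType.contactOrder]; ring
    · funext w
      simp only [SingType.model, modelMap]
      congr 2
      simp only [Matrix.vecCons_inj, and_true, true_and]
      ring
  | B k =>
    -- With k = l + 2 the factorization v^{2k+1} = v · v² · v^{2l+2} needs no truncated subtraction.
    obtain ⟨l, rfl⟩ : ∃ l, k = l + 2 := ⟨k - 2, by simp only [SingType.Admissible] at hT; omega⟩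
    refine ⟨fun w => ε * w.2 ^ (2 * l + 2), fun w => w.1, 1, by fun_prop, by fun_prop, one_ne_zero,
      fun x => ?_, ?_⟩
    · simp only [SingType.contactOrder]; ring
    · funext w
      simp only [SingType.model, modelMap]
      congr 2
      simp only [Matrix.vecCons_inj, and_true, true_and]
      ring
  | C k =>
    obtain ⟨l, rfl⟩ : ∃ l, k = l + 1 := ⟨k - 1, by simp only [SingType.Admissible] at hT; omega⟩
    refine ⟨fun w => w.1, fun w => ε * w.1 ^ l, ε, by fun_prop, by fun_prop, hε0,
      fun x => ?_, ?_⟩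
    · simp only [SingType.contactOrder]; ring
    · funext w
      simp only [SingType.model, modelMap]
      congr 2
      simp only [Matrix.vecCons_inj, and_true, true_and]
      ring
  | F4 =>
    refine ⟨fun w => w.2 ^ 2, fun w => w.1 ^ 2, 1, by fun_prop, by fun_prop, one_ne_zero,
      fun x => ?_, ?_⟩
    · simp only [SingType.contactOrder]; ring
    · funext w
      simp only [SingType.model, modelMap]
      congr 2
      simp only [Matrix.vecCons_inj, and_true, true_and]
      ring

theorem contDiff_vec {E : Type*} [NormedAddCommGroup E] [NormedSpace ℝ E] {f₀ f₁ f₂ : E → ℝ}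
    (h0 : ContDiff ℝ ∞ f₀) (h1 : ContDiff ℝ ∞ f₁) (h2 : ContDiff ℝ ∞ f₂) :
    ContDiff ℝ ∞ fun w => (!₂[f₀ w, f₁ w, f₂ w] : E3) := by
  rw [contDiff_euclidean]
  intro i
  fin_cases i
  · exact h0
  · exact h1
  · exact h2

theorem contDiff_modelMap {P Q : ℝ × ℝ → ℝ} (hP : ContDiff ℝ ∞ P) (hQ : ContDiff ℝ ∞ Q) :
    ContDiff ℝ ∞ (modelMap P Q) :=
  contDiff_vec (by fun_prop) (by fun_prop) (by fun_prop)

theorem isPrenormal_modelMap {P Q : ℝ × ℝ → ℝ} (hP : ContDiff ℝ ∞ P) (hQ : ContDiff ℝ ∞ Q) :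
    IsPrenormal (modelMap P Q) := by
  refine ⟨(contDiff_modelMap hP hQ).smoothGerm, ?_, Eventually.of_forall fun w => rfl, 2,
    two_ne_zero, Eventually.of_forall fun w => ?_⟩
  · apply ext_E3 <;> simp [modelMap]
  · refine dsnd_eq_of_hasDerivAt
      ((by fun_prop : Differentiable ℝ fun w : ℝ × ℝ => w.2 ^ 2) w) ?_
    change HasDerivAt (fun t : ℝ => t ^ 2) (2 * w.2) w.2
    simpa using hasDerivAt_pow 2 w.2

theorem dsnd_modelMap {P Q : ℝ × ℝ → ℝ} (hP : ContDiff ℝ ∞ P) (hQ : ContDiff ℝ ∞ Q) (x : ℝ) :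
    dsnd (fun w => modelMap P Q w 2) (x, 0) = x * Q (x, 0) := by
  have h := dsnd_snd_mul (k := fun w => w.2 ^ 2 * P w + w.1 * Q w) (w := (x, 0))
    ((by fun_prop : ContDiff ℝ ∞ fun w : ℝ × ℝ => w.2 ^ 2 * P w + w.1 * Q w).differentiable
      (by simp) _)
  refine h.trans ?_
  simp

/-- The normal form of a surface at a singular point. -/
noncomputable def normalForm (m : ℕ) (A B D : ℝ → ℝ) (E : ℝ × ℝ → ℝ) (w : ℝ × ℝ) : E3 :=
  !₂[w.1, w.2 ^ 2 / 2 + w.1 ^ 2 * B w.1,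
    w.1 ^ 2 * A w.1 + w.1 ^ m * D w.1 * w.2 + w.2 ^ 2 * E w]

theorem hasFDerivAt_modelMap_zero {P Q : ℝ × ℝ → ℝ} (hP : ContDiff ℝ ∞ P) (hQ : ContDiff ℝ ∞ Q)
    (v : ℝ × ℝ) : fderiv ℝ (modelMap P Q) 0 v = v.1 • (EuclideanSpace.single 0 1 : E3) := by
  have hd := (contDiff_modelMap hP hQ).differentiable (by simp) 0
  apply ext_E3 <;> rw [fderiv_apply_E3 hd]
  · change fderiv ℝ (fun w : ℝ × ℝ => w.1) 0 v = _
    rw [fderiv_fst]; simp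
  · have h : HasFDerivAt (fun w : ℝ × ℝ => w.2 ^ 2) (0 : ℝ × ℝ →L[ℝ] ℝ) 0 := by
      have := (hasFDerivAt_snd (𝕜 := ℝ) (p := (0 : ℝ × ℝ))).pow 2
      simpa using! this
    change fderiv ℝ (fun w : ℝ × ℝ => w.2 ^ 2) 0 v = _
    rw [h.fderiv]; simp
  · have hk : ContDiff ℝ ∞ fun w : ℝ × ℝ => w.2 ^ 2 * P w + w.1 * Q w := by fun_prop
    have h := (hasFDerivAt_snd (𝕜 := ℝ) (p := (0 : ℝ × ℝ))).mul
      (hk.differentiable (by simp) 0).hasFDerivAt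
    change fderiv ℝ (fun w : ℝ × ℝ => w.2 * (w.2 ^ 2 * P w + w.1 * Q w)) 0 v = _
    have h2 : fderiv ℝ (fun w : ℝ × ℝ => w.2 * (w.2 ^ 2 * P w + w.1 * Q w)) 0 = _ := h.fderiv
    rw [h2]; simp

theorem smoothGerm_E3_isBigO_sq {f : ℝ → ℝ} (hf : SmoothGerm f) (h0 : f 0 = 0)
    (h1 : deriv f 0 = 0) : f =O[𝓝 0] fun t : ℝ => t ^ 2 := by
  rw [isBigO_pow_iff 2 hf]
  intro j hj
  interval_cases j
  · simpa using h0
  · simpa using h1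

/-- A map-germ whose first differential has image the first axis and whose second coordinate
has nondegenerate second derivative in the null direction can be brought into the form
`(u, b(u) + v²/2, q(u, v))`. -/
theorem exists_prenormal {P Q : ℝ × ℝ → ℝ} (hP : ContDiff ℝ ∞ P) (hQ : ContDiff ℝ ∞ Q)
    {Ψ : E3 → E3} (hΨ : SmoothGerm Ψ) (hΨ0 : Ψ 0 = 0)
    (h10 : fderiv ℝ Ψ 0 (EuclideanSpace.single 0 1) 0 ≠ 0)
    (h11 : fderiv ℝ Ψ 0 (EuclideanSpace.single 0 1) 1 = 0)
    (h12 : fderiv ℝ Ψ 0 (EuclideanSpace.single 0 1) 2 = 0)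
    (h21 : 0 < fderiv ℝ Ψ 0 (EuclideanSpace.single 1 1) 1)
    (h22 : fderiv ℝ Ψ 0 (EuclideanSpace.single 1 1) 2 = 0) :
    ∃ (Θ : ℝ × ℝ → ℝ × ℝ) (b : ℝ → ℝ) (G : ℝ × ℝ → E3), DiffeoGerm Θ ∧ ContDiff ℝ ∞ b ∧
      SmoothGerm G ∧ G 0 = 0 ∧ (fun w => Ψ (modelMap P Q (Θ w))) =ᶠ[𝓝 0] G ∧
      (∀ᶠ w in 𝓝 (0 : ℝ × ℝ), G w 0 = w.1) ∧
      (∀ᶠ w in 𝓝 (0 : ℝ × ℝ), G w 1 = b w.1 + w.2 ^ 2 / 2) ∧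
      (∀ v, fderiv ℝ G 0 v 1 = 0) ∧ (∀ v, fderiv ℝ G 0 v 2 = 0) ∧
      (fun v : ℝ => G (0, v) 2) =O[𝓝 0] fun v : ℝ => v ^ 3 := by
  set f := modelMap P Q with hf_def
  have hf := contDiff_modelMap hP hQ
  have hf0 : f 0 = 0 := (isPrenormal_modelMap hP hQ).zero
  let W : ℝ × ℝ → E3 := fun w => Ψ (f w)
  have hW : SmoothGerm W := hΨ.comp hf.smoothGerm hf0
  have hW0 : W 0 = 0 := by simp [W, hf0, hΨ0]
  have hdW : ∀ v, fderiv ℝ W 0 v = v.1 • fderiv ℝ Ψ 0 (EuclideanSpace.single 0 1) := by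
    intro v
    have h1 : HasFDerivAt Ψ (fderiv ℝ Ψ 0) (f 0) := by
      rw [hf0]; exact (hΨ.contDiffAt.differentiableAt (by simp)).hasFDerivAt
    have h2 := (h1.comp 0 (hf.differentiable (by simp) 0).hasFDerivAt).fderiv
    have h3 : fderiv ℝ W 0 = _ := h2
    rw [h3, ContinuousLinearMap.comp_apply, hasFDerivAt_modelMap_zero hP hQ, map_smul]
  have hWd : DifferentiableAt ℝ W 0 := hW.contDiffAt.differentiableAt (by simp)
  -- the first coordinate as a parameter
  have hα : DiffeoGerm fun w : ℝ × ℝ => (W w 0, w.2) := by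
    refine DiffeoGerm.of_injective (by simp [hW0]) ((hW.apply_E3 0).prodMk contDiff_snd.smoothGerm) ?_
    have h1 : HasFDerivAt (fun w : ℝ × ℝ => (W w 0, w.2))
        ((fderiv ℝ (fun w => W w 0) 0).prod (ContinuousLinearMap.snd ℝ ℝ ℝ)) 0 :=
      ((hW.apply_E3 0).contDiffAt.differentiableAt (by simp)).hasFDerivAt.prodMk hasFDerivAt_snd
    rw [h1.fderiv, injective_iff_map_eq_zero]
    intro v hv
    simp only [ContinuousLinearMap.prod_apply, Prod.mk_eq_zero] at hv
    rw [← fderiv_apply_E3 hWd, hdW] at hv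
    refine Prod.ext ?_ hv.2
    have := hv.1
    simp only [PiLp.smul_apply, smul_eq_mul, mul_eq_zero] at this
    exact this.resolve_right h10
  obtain ⟨β, hβs, hβ, -, hαβ⟩ := hα.exists_inverse
  let W₁ : ℝ × ℝ → E3 := fun w => W (β w)
  have hW₁ : SmoothGerm W₁ := hW.comp hβ.2.1 hβ.1
  have hW₁0 : W₁ 0 = 0 := by simp [W₁, hβ.1, hW0]
  have hcomp : ∀ {K : ℝ × ℝ → E3} {θ : ℝ × ℝ → ℝ × ℝ}, SmoothGerm K → DiffeoGerm θ → ∀ v,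
      fderiv ℝ (fun w => K (θ w)) 0 v = fderiv ℝ K 0 (fderiv ℝ θ 0 v) := by
    intro K θ hK hθ v
    have h1 : HasFDerivAt K (fderiv ℝ K 0) (θ 0) := by
      rw [hθ.1]; exact (hK.contDiffAt.differentiableAt (by simp)).hasFDerivAt
    have h2 : fderiv ℝ (fun w => K (θ w)) 0 = _ := (h1.comp 0 hθ.hasFDerivAt).fderiv
    rw [h2]; rfl
  have hd1 : ∀ v, fderiv ℝ W₁ 0 v 1 = 0 := fun v => by
    rw [hcomp hW hβ, hdW]; simp [h11]
  have hd2 : ∀ v, fderiv ℝ W₁ 0 v 2 = 0 := fun v => by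
    rw [hcomp hW hβ, hdW]; simp [h12]
  have hW₁fst : ∀ᶠ w in 𝓝 (0 : ℝ × ℝ), W₁ w 0 = w.1 := hαβ.mono fun w hw => (Prod.ext_iff.1 hw).1
  have hβsnd : ∀ᶠ w in 𝓝 (0 : ℝ × ℝ), (β w).2 = w.2 := hαβ.mono fun w hw => (Prod.ext_iff.1 hw).2
  -- expansion along the null direction
  let x : ℝ → ℝ := fun t => (β (0, t)).1
  have hx : ContDiff ℝ ∞ x := by fun_prop
  have hβ00 : β ((0 : ℝ), (0 : ℝ)) = 0 := hβ.1
  have hx0 : x 0 = 0 := by simp [x, hβ00]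
  have hc : SmoothGerm fun t : ℝ => β (0, t) := smoothGerm_inr hβ.2.1
  have hxO : x =O[𝓝 0] fun t : ℝ => t ^ 2 := by
    refine smoothGerm_E3_isBigO_sq hx.smoothGerm hx0 ?_
    have h1 := deriv_comp_curve (hW.apply_E3 0) hc hβ00
    have h2 : (fun t : ℝ => W (β (0, t)) 0) =ᶠ[𝓝 0] fun _ => (0 : ℝ) := by
      filter_upwards [tendsto_inr.eventually hW₁fst] with t ht using ht
    rw [h2.deriv_eq, ← fderiv_apply_E3 hWd, hdW] at h1
    simp only [deriv_const, PiLp.smul_apply, smul_eq_mul] at h1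
    have h3 := (mul_eq_zero.1 h1.symm).resolve_right h10
    rwa [← deriv_fst hc] at h3
  have hfc : ∀ᶠ t in 𝓝 (0 : ℝ), f (β (0, t)) = x t • (EuclideanSpace.single 0 1 : E3) +
      t ^ 2 • (EuclideanSpace.single 1 1 : E3) +
      (t * (t ^ 2 * P (β (0, t)) + x t * Q (β (0, t)))) • (EuclideanSpace.single 2 1 : E3) := by
    filter_upwards [tendsto_inr.eventually hβsnd] with t ht
    apply ext_E3 <;> simp [hf_def, modelMap, x, ht]
  have h3O : (fun t : ℝ => t * (t ^ 2 * P (β (0, t)) + x t * Q (β (0, t)))) =O[𝓝 0]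
      fun t : ℝ => t ^ 3 := by
    have hb : ∀ {R : ℝ × ℝ → ℝ}, ContDiff ℝ ∞ R →
        (fun t : ℝ => R (β (0, t))) =O[𝓝 0] fun _ => (1 : ℝ) := by
      intro R hR
      have : ContDiff ℝ ∞ fun t : ℝ => R (β (0, t)) := by fun_prop
      exact this.continuous.continuousAt.isBigO_one ℝ
    have h1 := (isBigO_refl (fun t : ℝ => t) (𝓝 0)).mul
      (((isBigO_refl (fun t : ℝ => t ^ 2) (𝓝 0)).mul (hb hP)).add (by
        simpa using hxO.mul (hb hQ)))
    refine h1.congr_right fun t => ?_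
    ring
  have hfcO : (fun t : ℝ => f (β (0, t))) =O[𝓝 0] fun t : ℝ => t ^ 2 := by
    have hs : ∀ {k : ℝ → ℝ} (v : E3), (k =O[𝓝 0] fun t : ℝ => t ^ 2) →
        (fun t => k t • v) =O[𝓝 0] fun t : ℝ => t ^ 2 := by
      intro k v hk
      have := hk.smul (isBigO_const_one ℝ v (𝓝 (0 : ℝ)))
      simpa using this
    refine IsBigO.congr' ?_ (hfc.mono fun t ht => ht.symm) EventuallyEq.rfl
    exact ((hs _ hxO).add (hs _ (isBigO_refl _ _))).add
      (hs _ (h3O.trans (pow_isBigO_pow (by norm_num))))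
  -- The model is O(t²) along this line, so the quadratic remainder of Ψ is O(t⁴); up to O(t³) only
  -- the linear part of Ψ counts.
  have hrem : (fun t : ℝ => W₁ (0, t) - fderiv ℝ Ψ 0 (f (β (0, t)))) =O[𝓝 0]
      fun t : ℝ => t ^ 3 := by
    have ht : Tendsto (fun t : ℝ => f (β (0, t))) (𝓝 0) (𝓝 0) :=
      (hf.continuous.tendsto' 0 0 hf0).comp (hc.tendsto hβ00)
    have h1 := (isBigO_sq_sub_fderiv hΨ hΨ0).comp_tendsto ht
    refine (h1.trans ((hfcO.norm_left).pow 2)).trans ?_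
    simp only [← pow_mul]
    exact pow_isBigO_pow (by norm_num)
  have hcoord : ∀ i : Fin 3, fderiv ℝ Ψ 0 (EuclideanSpace.single 0 1) i = 0 →
      (fun t : ℝ => W₁ (0, t) i - fderiv ℝ Ψ 0 (EuclideanSpace.single 1 1) i * t ^ 2) =O[𝓝 0]
        fun t : ℝ => t ^ 3 := by
    intro i hi
    have h1 := (isBigO_apply_E3 hrem i).add
      (h3O.const_mul_left (fderiv ℝ Ψ 0 (EuclideanSpace.single 2 1) i))
    refine h1.congr' ?_ EventuallyEq.rfl
    filter_upwards [hfc] with t ht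
    rw [ht]
    simp only [map_add, map_smul, PiLp.sub_apply, PiLp.add_apply, PiLp.smul_apply, smul_eq_mul, hi]
    ring
  -- splitting of the second coordinate
  have hsm1 := hW₁.apply_E3 1
  have hs1 : dsnd (fun w => W₁ w 1) 0 = 0 := by
    rw [dsnd, ← fderiv_apply_E3 (hW₁.contDiffAt.differentiableAt (by simp)), hd1]
  have hs2 : dsnd (dsnd fun w => W₁ w 1) 0 =
      2 * fderiv ℝ Ψ 0 (EuclideanSpace.single 1 1) 1 := by
    set μ := fderiv ℝ Ψ 0 (EuclideanSpace.single 1 1) 1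
    have hp : SmoothGerm fun t : ℝ => W₁ (0, t) 1 - μ * t ^ 2 :=
      (smoothGerm_inr hsm1).sub (by fun_prop : ContDiff ℝ ∞ fun t : ℝ => μ * t ^ 2).smoothGerm
    have h1 := isBigO_deriv hp (hcoord 1 h11)
    have h2 := deriv_eq_zero_of_isBigO le_rfl hp.deriv h1
    have h3 : deriv (fun t : ℝ => W₁ (0, t) 1 - μ * t ^ 2) =ᶠ[𝓝 0]
        fun t => dsnd (fun w => W₁ w 1) (0, t) - μ * (2 * t) := by
      filter_upwards [tendsto_inr.eventually hsm1.differentiableAt] with t ht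
      have h4 := (hasDerivAt_snd ht).sub ((hasDerivAt_pow 2 t).const_mul μ)
      have h5 : deriv (fun t : ℝ => W₁ (0, t) 1 - μ * t ^ 2) t = _ := h4.deriv
      rw [h5]; simp
    have h4 := (hasDerivAt_snd (hsm1.dsnd.contDiffAt.differentiableAt (by simp))).sub
      (((hasDerivAt_id' (0 : ℝ)).const_mul 2).const_mul μ)
    have h5 : deriv (fun t : ℝ => dsnd (fun w => W₁ w 1) (0, t) - μ * (2 * t)) 0 = _ := h4.deriv
    rw [h3.deriv_eq, h5] at h2
    linarith
  -- The choice κ = 1/2 produces the term v²/2 of the normal form once r is taken as second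
  -- coordinate.
  obtain ⟨b, r, hb, hr, hr0, hrd, he⟩ := exists_splitting (κ := 1 / 2) hsm1 hs1 (by
    rw [hs2]; linarith)
  obtain ⟨θ, hθs, hθ, -, hθr⟩ := (diffeoGerm_fibered hr hr0 hrd).exists_inverse
  have hθ1 : ∀ᶠ w in 𝓝 (0 : ℝ × ℝ), (θ w).1 = w.1 := hθr.mono fun w hw => (Prod.ext_iff.1 hw).1
  have hθ2 : ∀ᶠ w in 𝓝 (0 : ℝ × ℝ), r (θ w) = w.2 := hθr.mono fun w hw => (Prod.ext_iff.1 hw).2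
  refine ⟨fun w => β (θ w), b, fun w => W₁ (θ w), hβ.comp hθ, hb, hW₁.comp hθ.2.1 hθ.1,
    by simp [hθ.1, hW₁0], EventuallyEq.rfl, ?_, ?_, ?_, ?_, ?_⟩
  · filter_upwards [hθ.tendsto.eventually hW₁fst, hθ1] with w h1 h2
    rw [h1, h2]
  · filter_upwards [hθ.tendsto.eventually he, hθ1, hθ2] with w h1 h2 h3
    rw [h1, h2, h3]; ring
  · exact fun v => by rw [hcomp hW₁ hθ, hd1]
  · exact fun v => by rw [hcomp hW₁ hθ, hd2]
  · have hs : SmoothGerm fun v : ℝ => (θ (0, v)).2 := (smoothGerm_inr hθ.2.1).snd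
    have hθ00 : θ ((0 : ℝ), (0 : ℝ)) = 0 := hθ.1
    have hs0 : (θ ((0 : ℝ), (0 : ℝ))).2 = 0 := by rw [hθ00]; rfl
    have h1 := hcoord 2 h12
    simp only [h22, zero_mul, sub_zero] at h1
    -- The change `θ` preserves the line u = 0 and reparametrizes it, so the order 3 of the third
    -- coordinate persists.
    have h2 := (h1.comp_tendsto (hs.tendsto hs0)).trans ((isBigO_of_smoothGerm hs hs0).pow 3)
    refine h2.congr' ?_ EventuallyEq.rfl
    filter_upwards [tendsto_inr.eventually hθ1] with v hv
    have : ((0 : ℝ), (θ (0, v)).2) = θ (0, v) := Prod.ext hv.symm rfl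
    simp only [Function.comp, this]

/-- A rotation puts the tangent line on the first axis and the principal plane on the first two,
after which the source coordinates are chosen by `exists_prenormal`. The exponent is found by
transferring the order of q_v on v = 0 in both directions: from the model to g it gives divisibility
by u^m, and from g to the model it gives D(0) ≠ 0. -/
theorem exists_normalForm {T : SingType} (hT : T.Admissible) {g : ℝ × ℝ → E3}
    (hgT : HasType g T) :
    ∃ (R : E3 ≃ₗᵢ[ℝ] E3) (ψ : ℝ × ℝ → ℝ × ℝ) (A B D : ℝ → ℝ) (E : ℝ × ℝ → ℝ),
      LinearMap.det (R.toLinearEquiv : E3 →ₗ[ℝ] E3) = 1 ∧ DiffeoGerm ψ ∧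
      ContDiff ℝ ∞ A ∧ ContDiff ℝ ∞ B ∧ ContDiff ℝ ∞ D ∧ ContDiff ℝ ∞ E ∧ D 0 ≠ 0 ∧ E 0 = 0 ∧
      (fun w => R (g w)) =ᶠ[𝓝 0] fun w => normalForm T.contactOrder A B D E (ψ w) := by
  have hm := SingType.two_le_contactOrder hT
  obtain ⟨ε, hε, φ, Φ, hφ, hΦ, he⟩ := hgT
  obtain ⟨P, Q, e, hP, hQ, he0, hQe, hmod⟩ := exists_modelMap_eq hT hε
  rw [hmod] at he
  have hpre := isPrenormal_modelMap hP hQ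
  set f := modelMap P Q with hf_def
  have hf := contDiff_modelMap hP hQ
  have hind : LinearIndependent ℝ ![fderiv ℝ Φ 0 (EuclideanSpace.single 0 1),
      fderiv ℝ Φ 0 (EuclideanSpace.single 1 1)] := by
    rw [LinearIndependent.pair_iff]
    intro s t hst
    rw [← map_smul, ← map_smul, ← map_add] at hst
    have h1 := (injective_iff_map_eq_zero _).1 hΦ.injective _ hst
    have h2 := congrArg (fun z : E3 => z 0) h1
    have h3 := congrArg (fun z : E3 => z 1) h1
    simp at h2 h3
    exact ⟨h2, h3⟩
  -- The images under dΦ of the first two basis vectors span the tangent line and the principal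
  -- plane, since the model is (x, y², …) with third coordinate of order 3 on x = 0.
  obtain ⟨R, hR, r1, r2, r3, r4, r5⟩ := exists_rotation_triangular hind
  let Ψ : E3 → E3 := fun z => R (Φ z)
  have hRd : ∀ z, HasFDerivAt R (R.toContinuousLinearEquiv : E3 →L[ℝ] E3) z := fun z =>
    R.toContinuousLinearEquiv.hasFDerivAt
  have hΨd : ∀ v, fderiv ℝ Ψ 0 v = R (fderiv ℝ Φ 0 v) := by
    intro v
    have h1 : fderiv ℝ Ψ 0 = _ := ((hRd (Φ 0)).comp 0 hΦ.hasFDerivAt).fderiv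
    rw [h1]; rfl
  have hΨs : SmoothGerm Ψ := hΦ.2.1.clm_comp (R.toContinuousLinearEquiv : E3 →L[ℝ] E3)
  have hΨ : DiffeoGerm Ψ := by
    refine DiffeoGerm.of_injective (by simp [Ψ, hΦ.1]) hΨs ?_
    intro v w hvw
    rw [hΨd, hΨd] at hvw
    exact hΦ.injective (R.injective hvw)
  obtain ⟨Θ, b, G, hΘ, hb, hG, hG0, hGe, hG1, hG2, hd1, hd2, hq3⟩ := exists_prenormal hP hQ hΨs
    hΨ.1 (by rwa [hΨd]) (by rwa [hΨd]) (by rwa [hΨd]) (by rwa [hΨd]) (by rwa [hΨd])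
  have hGd : DifferentiableAt ℝ G 0 := hG.contDiffAt.differentiableAt (by simp)
  have hGpre : IsPrenormal G := by
    refine ⟨hG, hG0, hG1, 1, one_ne_zero, ?_⟩
    filter_upwards [hG2.eventually_nhds] with w hw
    rw [dsnd_congr hw]
    refine dsnd_eq_of_hasDerivAt ((by fun_prop : ContDiff ℝ ∞ fun w : ℝ × ℝ =>
      b w.1 + w.2 ^ 2 / 2).differentiable (by simp) w) ?_
    convert! ((hasDerivAt_pow 2 w.2).div_const 2).const_add (b w.1) using 1
    push_cast; ring
  -- transfer of the order of `q_v` on `v = 0`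
  obtain ⟨Θ', -, hΘ', -, hΘr⟩ := hΘ.exists_inverse
  obtain ⟨Ψ', -, hΨ', hΨl, -⟩ := hΨ.exists_inverse
  have hrel : (fun w => G (Θ' w)) =ᶠ[𝓝 0] fun w => Ψ (f w) := by
    filter_upwards [hΘ'.tendsto.eventually hGe, hΘr] with w h1 h2
    rw [← h1, h2]
  have hrel' : (fun w => f (Θ w)) =ᶠ[𝓝 0] fun w => Ψ' (G w) := by
    have hft : Tendsto (fun w => f (Θ w)) (𝓝 0) (𝓝 0) :=
      (hf.continuous.tendsto' 0 0 hpre.zero).comp hΘ.tendsto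
    filter_upwards [hGe, hft.eventually hΨl] with w h1 h2
    rw [← h1]; exact h2.symm
  have hfO : (fun u : ℝ => dsnd (fun w => f w 2) (u, 0)) = fun u => e * u ^ T.contactOrder :=
    funext fun u => (dsnd_modelMap hP hQ u).trans (hQe u)
  have hup := hpre.isBigO_transfer hm hGpre hΘ' hΨs hrel (by
    rw [hfO]; exact isBigO_const_mul_self _ _ _)
  have hlow : ¬ (fun u : ℝ => dsnd (fun w => G w 2) (u, 0)) =O[𝓝 0]
      fun u : ℝ => u ^ (T.contactOrder + 1) := by
    intro h
    have h1 := hGpre.isBigO_transfer (by omega) hpre hΘ hΨ'.2.1 hrel' h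
    rw [hfO] at h1
    exact not_pow_isBigO_pow_succ _ ((isBigO_const_mul_left_iff he0).1 h1)
  have hinl : HasDerivAt (fun u : ℝ => (u, (0 : ℝ))) ((1 : ℝ), (0 : ℝ)) 0 :=
    (hasDerivAt_id (0 : ℝ)).prodMk (hasDerivAt_const _ _)
  have haxis : ∀ i : Fin 3, (∀ v, fderiv ℝ G 0 v i = 0) →
      (fun u : ℝ => G (u, 0) i) =O[𝓝 0] fun u : ℝ => u ^ 2 := by
    intro i hi
    refine smoothGerm_E3_isBigO_sq (smoothGerm_inl (hG.apply_E3 i)) ?_ ?_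
    · change G 0 i = 0
      rw [hG0]; rfl
    · have := deriv_comp_curve (hG.apply_E3 i) (c := fun u : ℝ => (u, (0 : ℝ)))
        (by fun_prop : ContDiff ℝ ∞ fun u : ℝ => (u, (0 : ℝ))).smoothGerm rfl
      rw [this, ← fderiv_apply_E3 hGd, hi]
  obtain ⟨A, D, E, hA, hD, hE, hE0, hqD, hq⟩ := exists_expansion (by omega) (hG.apply_E3 2)
    (haxis 2 hd2) hup hq3
  have hbO : b =O[𝓝 0] fun u : ℝ => u ^ 2 := by
    refine (haxis 1 hd1).congr' ?_ EventuallyEq.rfl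
    filter_upwards [tendsto_inl.eventually hG2] with u hu
    rw [hu]; simp
  obtain ⟨B, hB, hbB⟩ := exists_eq_pow_mul hb.smoothGerm hbO
  have hD0 : D 0 ≠ 0 := by
    intro h0
    refine hlow (IsBigO.congr' ?_ (hqD.mono fun u hu => hu.symm) EventuallyEq.rfl)
    simp only [pow_succ]
    exact (isBigO_refl _ _).mul (isBigO_of_smoothGerm hD.smoothGerm h0)
  have hfst : Tendsto (fun w : ℝ × ℝ => w.1) (𝓝 0) (𝓝 0) := continuous_fst.tendsto' _ _ rfl
  have hGN : ∀ᶠ w in 𝓝 (0 : ℝ × ℝ), G w = normalForm T.contactOrder A B D E w := by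
    filter_upwards [hG1, hG2, hq, hfst.eventually hbB] with w e1 e2 e3 e4
    apply ext_E3
    · exact e1
    · rw [e2, e4]; simp [normalForm]; ring
    · exact e3
  obtain ⟨ψ, -, hψ, -, hψr⟩ := (hφ.comp hΘ).exists_inverse
  refine ⟨R, ψ, A, B, D, E, hR, hψ, hA, hB, hD, hE, hD0, hE0, ?_⟩
  filter_upwards [hψr, (hΘ.tendsto.comp hψ.tendsto).eventually he, hψ.tendsto.eventually hGe,
    hψ.tendsto.eventually hGN] with w h1 h2 h3 h4
  rw [← h4, ← h3]
  simp only [Function.comp] at h2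
  rw [h1] at h2
  rw [h2]

/-! ### The parabolic function under changes of coordinates. -/

theorem second_eq {g : ℝ × ℝ → E3} {p : ℝ × ℝ} (hg : ContDiffAt ℝ ∞ g p) (a b : ℝ × ℝ) :
    second g p a b = fderiv ℝ (fun q => fderiv ℝ g q b) p a := by
  have h1 : DifferentiableAt ℝ (fderiv ℝ g) p :=
    (hg.fderiv_right (m := ∞) (by simp)).differentiableAt (by simp)
  rw [second, fderiv_clm_apply h1 (differentiableAt_const b)]
  simp

theorem second_symm {g : ℝ × ℝ → E3} {p : ℝ × ℝ} (hg : ContDiffAt ℝ ∞ g p) (a b : ℝ × ℝ) :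
    second g p a b = second g p b a :=
  (hg.isSymmSndFDerivAt (by
    rw [minSmoothness_of_isRCLikeNormedField]; exact WithTop.coe_le_coe.2 le_top)) a b

theorem map_second {g : ℝ × ℝ → E3} {p : ℝ × ℝ} (hg : ContDiffAt ℝ ∞ g p) (R : E3 ≃ₗᵢ[ℝ] E3)
    (a b : ℝ × ℝ) : second (fun w => R (g w)) p a b = R (second g p a b) := by
  have hR : ContDiff ℝ ∞ R := R.contDiff
  have hRg : ContDiffAt ℝ ∞ (fun w => R (g w)) p := hR.contDiffAt.comp p hg
  rw [second_eq hg, second_eq hRg]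
  have h1 : (fun q => fderiv ℝ (fun w => R (g w)) q b) = fun q => R (fderiv ℝ g q b) := by
    funext q
    have := R.toContinuousLinearEquiv.comp_fderiv (f := g) (x := q)
    exact DFunLike.congr_fun this b
  rw [h1]
  have := R.toContinuousLinearEquiv.comp_fderiv (f := fun q => fderiv ℝ g q b) (x := p)
  exact DFunLike.congr_fun this a

theorem second_comp {N : ℝ × ℝ → E3} {ψ : ℝ × ℝ → ℝ × ℝ} {p : ℝ × ℝ} (hN : ContDiff ℝ ∞ N)
    (hψ : ContDiffAt ℝ ∞ ψ p) (hψ' : ∀ᶠ q in 𝓝 p, DifferentiableAt ℝ ψ q) (a b : ℝ × ℝ) :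
    second (fun w => N (ψ w)) p a b = second N (ψ p) (fderiv ℝ ψ p a) (fderiv ℝ ψ p b) +
      fderiv ℝ N (ψ p) (fderiv ℝ (fun q => fderiv ℝ ψ q b) p a) := by
  have hNψ : ContDiffAt ℝ ∞ (fun w => N (ψ w)) p := hN.contDiffAt.comp p hψ
  rw [second_eq hNψ]
  have h1 : (fun q => fderiv ℝ (fun w => N (ψ w)) q b) =ᶠ[𝓝 p]
      fun q => fderiv ℝ N (ψ q) (fderiv ℝ ψ q b) := by
    filter_upwards [hψ'] with q hq
    have h2 : fderiv ℝ (fun w => N (ψ w)) q = _ :=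
      ((hN.differentiable (by simp) (ψ q)).hasFDerivAt.comp q hq.hasFDerivAt).fderiv
    rw [h2]; rfl
  have h3 : HasFDerivAt (fun q => fderiv ℝ N (ψ q))
      ((fderiv ℝ (fderiv ℝ N) (ψ p)).comp (fderiv ℝ ψ p)) p := by
    have h4 : ContDiff ℝ ∞ (fderiv ℝ N) := hN.fderiv_right (by simp)
    exact (h4.differentiable (by simp) (ψ p)).hasFDerivAt.comp p
      (hψ.differentiableAt (by simp)).hasFDerivAt
  have h5 : DifferentiableAt ℝ (fun q => fderiv ℝ ψ q b) p := by
    have h6 : DifferentiableAt ℝ (fderiv ℝ ψ) p :=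
      (hψ.fderiv_right (m := ∞) (by simp)).differentiableAt (by simp)
    exact h6.clm_apply (differentiableAt_const b)
  rw [h1.fderiv_eq, (h3.clm_apply h5.hasFDerivAt).fderiv]
  simp [second, add_comm]

/-- The Jacobian determinant. -/
noncomputable def jacobian (ψ : ℝ × ℝ → ℝ × ℝ) (p : ℝ × ℝ) : ℝ :=
  (fderiv ℝ ψ p (1, 0)).1 * (fderiv ℝ ψ p (0, 1)).2 -
    (fderiv ℝ ψ p (1, 0)).2 * (fderiv ℝ ψ p (0, 1)).1

theorem DiffeoGerm.jacobian_ne_zero {ψ : ℝ × ℝ → ℝ × ℝ} (hψ : DiffeoGerm ψ) :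
    ∀ᶠ p in 𝓝 (0 : ℝ × ℝ), jacobian ψ p ≠ 0 := by
  have hc : ContinuousAt (jacobian ψ) 0 := by
    have h : ∀ v, ContinuousAt (fun p => fderiv ℝ ψ p v) 0 := fun v =>
      hψ.2.1.fderiv.continuousAt.clm_apply continuousAt_const
    exact ((h _).fst.mul (h _).snd).sub ((h _).snd.mul (h _).fst)
  refine hc.eventually_ne fun h0 => ?_
  have hv : ∀ a b : ℝ, fderiv ℝ ψ 0 (a, b) =
      a • fderiv ℝ ψ 0 (1, 0) + b • fderiv ℝ ψ 0 (0, 1) := by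
    intro a b
    rw [← map_smul, ← map_smul, ← map_add]; simp
  rw [jacobian] at h0
  set x := fderiv ℝ ψ 0 (1, 0) with hx
  set y := fderiv ℝ ψ 0 (0, 1) with hy
  have hinj := (injective_iff_map_eq_zero _).1 hψ.injective
  have h1 := hinj (y.1, -x.1) (by
    rw [hv]; refine Prod.ext ?_ ?_
    · simp; ring
    · simp; linarith)
  have h2 := hinj (y.2, -x.2) (by
    rw [hv]; refine Prod.ext ?_ ?_
    · simp; linarith
    · simp; ring)
  simp only [Prod.mk_eq_zero, neg_eq_zero] at h1 h2
  have h3 := hinj (1, 0) (by rw [← hx]; exact Prod.ext h1.2 h2.2)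
  simp at h3

theorem cross_add_smul (a b : E3) (x₁ x₂ y₁ y₂ : ℝ) :
    cross (x₁ • a + x₂ • b) (y₁ • a + y₂ • b) = (x₁ * y₂ - x₂ * y₁) • cross a b := by
  apply ext_E3 <;> simp [cross_zero, cross_one, cross_two] <;> ring

theorem inner_comb_cross (a b : E3) (x₁ x₂ : ℝ) :
    inner ℝ (x₁ • a + x₂ • b) (cross a b) = 0 := by
  simp [inner_E3, cross_zero, cross_one, cross_two]; ring

theorem map_eq_comb {F : Type*} [NormedAddCommGroup F] [NormedSpace ℝ F] (l : ℝ × ℝ →L[ℝ] F)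
    (v : ℝ × ℝ) : l v = v.1 • l (1, 0) + v.2 • l (0, 1) := by
  rw [← map_smul, ← map_smul, ← map_add]; simp

/-- The term of the second-order chain rule containing second derivatives of ψ is tangential, so the
normal does not see it. Each coefficient gains a factor J from the normal, and the discriminant of
the quadratic form gains J² from the substitution: together J⁴. -/
theorem parabolicFun_comp {g N : ℝ × ℝ → E3} {R : E3 ≃ₗᵢ[ℝ] E3} {ψ : ℝ × ℝ → ℝ × ℝ}
    {p : ℝ × ℝ} (hR : LinearMap.det (R.toLinearEquiv : E3 →ₗ[ℝ] E3) = 1) (hg : ContDiffAt ℝ ∞ g p)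
    (hN : ContDiff ℝ ∞ N) (hψ : ContDiffAt ℝ ∞ ψ p) (hψ' : ∀ᶠ q in 𝓝 p, DifferentiableAt ℝ ψ q)
    (he : (fun w => R (g w)) =ᶠ[𝓝 p] fun w => N (ψ w)) :
    parabolicFun g p = jacobian ψ p ^ 4 * parabolicFun N (ψ p) := by
  have hfd : ∀ v, R (fderiv ℝ g p v) = fderiv ℝ N (ψ p) (fderiv ℝ ψ p v) := by
    intro v
    have h1 := R.toContinuousLinearEquiv.comp_fderiv (f := g) (x := p)
    have h2 : fderiv ℝ (fun w => N (ψ w)) p = _ :=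
      ((hN.differentiable (by simp) (ψ p)).hasFDerivAt.comp p
        (hψ.differentiableAt (by simp)).hasFDerivAt).fderiv
    have h3 : fderiv ℝ (fun w => R (g w)) p = _ := h1
    rw [he.fderiv_eq, h2] at h3
    exact (DFunLike.congr_fun h3 v).symm
  have hsd : ∀ a b, R (second g p a b) = second N (ψ p) (fderiv ℝ ψ p a) (fderiv ℝ ψ p b) +
      fderiv ℝ N (ψ p) (fderiv ℝ (fun q => fderiv ℝ ψ q b) p a) := by
    intro a b
    rw [← map_second hg, ← second_comp hN hψ hψ']
    rw [second, second, EventuallyEq.fderiv_eq (EventuallyEq.fderiv he)]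
  set Nu := fderiv ℝ N (ψ p) (1, 0) with hNu
  set Nv := fderiv ℝ N (ψ p) (0, 1) with hNv
  have hn : R (cross (fderiv ℝ g p (1, 0)) (fderiv ℝ g p (0, 1))) =
      jacobian ψ p • cross Nu Nv := by
    rw [← cross_map hR, hfd, hfd, map_eq_comb _ (fderiv ℝ ψ p (1, 0)),
      map_eq_comb _ (fderiv ℝ ψ p (0, 1)), cross_add_smul]
    rfl
  have hin : ∀ a b, inner ℝ (second g p a b)
      (cross (fderiv ℝ g p (1, 0)) (fderiv ℝ g p (0, 1))) =
      jacobian ψ p * inner ℝ (second N (ψ p) (fderiv ℝ ψ p a) (fderiv ℝ ψ p b)) (cross Nu Nv) := by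
    intro a b
    rw [← R.inner_map_map, hn, hsd, inner_smul_right, inner_add_left,
      map_eq_comb (fderiv ℝ N (ψ p)), inner_comb_cross, add_zero]
  have hbil : ∀ x y : ℝ × ℝ, second N (ψ p) x y =
      (x.1 * y.1) • second N (ψ p) (1, 0) (1, 0) +
      (x.1 * y.2 + x.2 * y.1) • second N (ψ p) (1, 0) (0, 1) +
      (x.2 * y.2) • second N (ψ p) (0, 1) (0, 1) := by
    intro x y
    have h1 : second N (ψ p) x y = x.1 • second N (ψ p) (1, 0) y +
        x.2 • second N (ψ p) (0, 1) y := by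
      have := map_eq_comb (fderiv ℝ (fderiv ℝ N) (ψ p)) x
      exact DFunLike.congr_fun this y
    have h2 : ∀ z, second N (ψ p) z y = y.1 • second N (ψ p) z (1, 0) +
        y.2 • second N (ψ p) z (0, 1) := fun z =>
      map_eq_comb (fderiv ℝ (fderiv ℝ N) (ψ p) z) y
    rw [h1, h2, h2, second_symm hN.contDiffAt (0, 1) (1, 0)]
    module
  simp only [parabolicFun, hin, ← hNu, ← hNv]
  rw [hbil (fderiv ℝ ψ p (1, 0)) (fderiv ℝ ψ p (1, 0)),
    hbil (fderiv ℝ ψ p (0, 1)) (fderiv ℝ ψ p (0, 1)),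
    hbil (fderiv ℝ ψ p (1, 0)) (fderiv ℝ ψ p (0, 1))]
  simp only [inner_add_left, real_inner_smul_left, jacobian]
  ring

/-! ### The branch of the parabolic set. -/

/-- Derivative in the first variable. -/
noncomputable def dfst (f : ℝ × ℝ → ℝ) (w : ℝ × ℝ) : ℝ := fderiv ℝ f w (1, 0)

theorem hasDerivAt_fst {f : ℝ × ℝ → ℝ} {w : ℝ × ℝ} (hf : DifferentiableAt ℝ f w) :
    HasDerivAt (fun t => f (t, w.2)) (dfst f w) w.1 := by
  have h2 : HasDerivAt (fun t : ℝ => (t, w.2)) ((1 : ℝ), (0 : ℝ)) w.1 :=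
    (hasDerivAt_id w.1).prodMk (hasDerivAt_const w.1 w.2)
  exact hf.hasFDerivAt.comp_hasDerivAt w.1 h2

theorem dfst_eq_of_hasDerivAt {f : ℝ × ℝ → ℝ} {w : ℝ × ℝ} {d : ℝ} (hf : DifferentiableAt ℝ f w)
    (h : HasDerivAt (fun t => f (t, w.2)) d w.1) : dfst f w = d :=
  (hasDerivAt_fst hf).unique h

theorem _root_.ContDiff.dfst {f : ℝ × ℝ → ℝ} (hf : ContDiff ℝ ∞ f) : ContDiff ℝ ∞ (dfst f) :=
  (hf.fderiv_right (by simp)).clm_apply contDiff_const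

theorem parabolicFun_graph {p q : ℝ × ℝ → ℝ} (hp : ContDiff ℝ ∞ p) (hq : ContDiff ℝ ∞ q)
    (w : ℝ × ℝ) : parabolicFun (fun w => !₂[w.1, p w, q w]) w =
      (dfst (dfst q) w * dsnd p w - dfst (dfst p) w * dsnd q w) *
        (dsnd (dsnd q) w * dsnd p w - dsnd (dsnd p) w * dsnd q w) -
      (dfst (dsnd q) w * dsnd p w - dfst (dsnd p) w * dsnd q w) ^ 2 := by
  set G : ℝ × ℝ → E3 := fun w => !₂[w.1, p w, q w] with hG
  have hGs : ContDiff ℝ ∞ G := contDiff_vec contDiff_fst hp hq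
  have hd : ∀ w v, fderiv ℝ G w v = !₂[v.1, fderiv ℝ p w v, fderiv ℝ q w v] := by
    intro w v
    have hGd := hGs.differentiable (by simp) w
    apply ext_E3 <;> rw [fderiv_apply_E3 hGd]
    · change fderiv ℝ (fun w : ℝ × ℝ => w.1) w v = _
      rw [fderiv_fst]; rfl
    · rfl
    · rfl
  have hs : ∀ a b, second G w a b = !₂[0, fderiv ℝ (fun z => fderiv ℝ p z b) w a,
      fderiv ℝ (fun z => fderiv ℝ q z b) w a] := by
    intro a b
    rw [second_eq hGs.contDiffAt]
    simp only [hd]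
    have h1 : ContDiff ℝ ∞ fun z => (!₂[b.1, fderiv ℝ p z b, fderiv ℝ q z b] : E3) :=
      contDiff_vec contDiff_const ((hp.fderiv_right (by simp)).clm_apply contDiff_const)
        ((hq.fderiv_right (by simp)).clm_apply contDiff_const)
    have h1d := h1.differentiable (by simp) w
    apply ext_E3 <;> rw [fderiv_apply_E3 h1d]
    · change fderiv ℝ (fun _ : ℝ × ℝ => b.1) w a = _
      simp
    · rfl
    · rfl
  simp only [parabolicFun, hd, hs, inner_E3, cross_zero, cross_one, cross_two]
  have e1 : ∀ f : ℝ × ℝ → ℝ, (fun z => fderiv ℝ f z (1, 0)) = dfst f := fun _ => rfl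
  have e2 : ∀ f : ℝ × ℝ → ℝ, (fun z => fderiv ℝ f z (0, 1)) = dsnd f := fun _ => rfl
  have e3 : ∀ f : ℝ × ℝ → ℝ, fderiv ℝ f w (1, 0) = dfst f w := fun _ => rfl
  have e4 : ∀ f : ℝ × ℝ → ℝ, fderiv ℝ f w (0, 1) = dsnd f w := fun _ => rfl
  simp only [e1, e2, e3, e4]
  simp
  ring

theorem contDiff_normalForm (m : ℕ) {A B D : ℝ → ℝ} {E : ℝ × ℝ → ℝ} (hA : ContDiff ℝ ∞ A)
    (hB : ContDiff ℝ ∞ B) (hD : ContDiff ℝ ∞ D) (hE : ContDiff ℝ ∞ E) :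
    ContDiff ℝ ∞ (normalForm m A B D E) :=
  contDiff_vec (by fun_prop) (by fun_prop) (by fun_prop)

theorem dsnd_normalForm_one (m : ℕ) (A : ℝ → ℝ) {B : ℝ → ℝ} (D : ℝ → ℝ) (E : ℝ × ℝ → ℝ)
    (hB : ContDiff ℝ ∞ B) :
    dsnd (fun w => normalForm m A B D E w 1) = fun w => w.2 := by
  funext w
  refine dsnd_eq_of_hasDerivAt ((by fun_prop : ContDiff ℝ ∞ fun w : ℝ × ℝ =>
    w.2 ^ 2 / 2 + w.1 ^ 2 * B w.1).differentiable (by simp) w) ?_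
  have h1 : HasDerivAt (fun t : ℝ => t ^ 2 / 2 + w.1 ^ 2 * B w.1) w.2 w.2 := by
    convert! ((hasDerivAt_pow 2 w.2).div_const 2).add_const (w.1 ^ 2 * B w.1) using 1
    push_cast; ring
  exact h1

theorem dsnd_normalForm_two (m : ℕ) {A : ℝ → ℝ} (B : ℝ → ℝ) {D : ℝ → ℝ} {E : ℝ × ℝ → ℝ}
    (hA : ContDiff ℝ ∞ A) (hD : ContDiff ℝ ∞ D) (hE : ContDiff ℝ ∞ E) :
    dsnd (fun w => normalForm m A B D E w 2) =
      fun w => w.1 ^ m * D w.1 + w.2 * (2 * E w + w.2 * dsnd E w) := by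
  funext w
  refine dsnd_eq_of_hasDerivAt ((by fun_prop : ContDiff ℝ ∞ fun w : ℝ × ℝ =>
    w.1 ^ 2 * A w.1 + w.1 ^ m * D w.1 * w.2 + w.2 ^ 2 * E w).differentiable (by simp) w) ?_
  have h1 := ((hasDerivAt_id' w.2).const_mul (w.1 ^ m * D w.1)).const_add (w.1 ^ 2 * A w.1)
  have h2 := h1.add ((hasDerivAt_pow 2 w.2).mul
    (hasDerivAt_snd (hE.differentiable (by simp) w)))
  convert! h2 using 1
  push_cast; ring

/-- The blow-up of the parabolic set of a normal form along `v = u^m w` and its smooth branch. -/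
theorem exists_branch_normalForm {m : ℕ} (hm : 2 ≤ m) {A B D : ℝ → ℝ} {E : ℝ × ℝ → ℝ}
    (hA : ContDiff ℝ ∞ A) (hB : ContDiff ℝ ∞ B) (hD : ContDiff ℝ ∞ D) (hE : ContDiff ℝ ∞ E)
    (hA0 : A 0 ≠ 0) (hD0 : D 0 ≠ 0) (hE0 : E 0 = 0) :
    ∃ μ : ℝ → ℝ, ContDiff ℝ ∞ μ ∧ A 0 * μ 0 = B 0 * D 0 ∧
      (∀ᶠ t in 𝓝 0, parabolicFun (normalForm m A B D E) (t, t ^ m * μ t) = 0) ∧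
      ∀ᶠ t in 𝓝 (0 : ℝ), t ≠ 0 → ∀ᶠ p in 𝓝 (t, t ^ m * μ t),
        parabolicFun (normalForm m A B D E) p = 0 → p.2 = p.1 ^ m * μ p.1 := by
  let p : ℝ × ℝ → ℝ := fun w => w.2 ^ 2 / 2 + w.1 ^ 2 * B w.1
  let q : ℝ × ℝ → ℝ := fun w => w.1 ^ 2 * A w.1 + w.1 ^ m * D w.1 * w.2 + w.2 ^ 2 * E w
  have hp : ContDiff ℝ ∞ p := by fun_prop
  have hq : ContDiff ℝ ∞ q := by fun_prop
  have hN : normalForm m A B D E = fun w => !₂[w.1, p w, q w] := rfl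
  let K : ℝ × ℝ → ℝ := fun w => 2 * E w + w.2 * dsnd E w
  have hK : ContDiff ℝ ∞ K := by have := hE.dsnd; fun_prop
  have hK0 : K 0 = 0 := by simp [K, hE0]
  have hpv : dsnd p = fun w => w.2 := dsnd_normalForm_one m A D E hB
  have hqv : dsnd q = fun w => w.1 ^ m * D w.1 + w.2 * K w := dsnd_normalForm_two m B hA hD hE
  have hpvv : ∀ w, dsnd (dsnd p) w = 1 := by
    intro w
    rw [hpv]
    exact dsnd_eq_of_hasDerivAt differentiableAt_snd (hasDerivAt_id' w.2)
  have hpuv : ∀ w, dfst (dsnd p) w = 0 := by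
    intro w
    rw [hpv]
    exact dfst_eq_of_hasDerivAt differentiableAt_snd (hasDerivAt_const w.1 w.2)
  -- Here p_v = v, p_vv = 1, p_uv = 0 and q_v = u^m D + vK with K(0) = 0; every factor becomes
  -- divisible by u^m once v is.
  have hpar : ∀ w, parabolicFun (normalForm m A B D E) w =
      (dfst (dfst q) w * w.2 - dfst (dfst p) w * (w.1 ^ m * D w.1 + w.2 * K w)) *
        (dsnd (dsnd q) w * w.2 - (w.1 ^ m * D w.1 + w.2 * K w)) -
      (dfst (dsnd q) w * w.2) ^ 2 := by
    intro w
    rw [hN, parabolicFun_graph hp hq, hpvv, hpuv, congrFun hpv w, congrFun hqv w]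
    ring
  have hqvv0 : dsnd (dsnd q) 0 = 0 := by
    rw [hqv]
    refine dsnd_eq_of_hasDerivAt ((by fun_prop : ContDiff ℝ ∞ fun w : ℝ × ℝ =>
      w.1 ^ m * D w.1 + w.2 * K w).differentiable (by simp) 0) ?_
    have h1 := ((hasDerivAt_id' (0 : ℝ)).mul
      (hasDerivAt_snd (hK.differentiable (by simp) (0 : ℝ × ℝ)))).const_add ((0 : ℝ) ^ m * D 0)
    convert! h1 using 1
    simp only [one_mul, zero_mul, add_zero]
    exact hK0.symm
  have hqvu0 : dfst (dsnd q) 0 = 0 := by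
    rw [hqv]
    refine dfst_eq_of_hasDerivAt ((by fun_prop : ContDiff ℝ ∞ fun w : ℝ × ℝ =>
      w.1 ^ m * D w.1 + w.2 * K w).differentiable (by simp) 0) ?_
    have h1 := (hasDerivAt_pow m (0 : ℝ)).mul (hD.differentiable (by simp) 0).hasDerivAt
    have h2 : HasDerivAt (fun t : ℝ => t ^ m * D t + 0 * K (t, 0)) 0 0 := by
      simp only [zero_mul, add_zero]
      convert! h1 using 1
      simp [zero_pow (by omega : m ≠ 0), zero_pow (by omega : m - 1 ≠ 0)]
    exact h2
  have hsq : ∀ (C : ℝ → ℝ) (s : ℝ → ℝ), ContDiff ℝ ∞ C → ContDiff ℝ ∞ s →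
      (∃ d, ∀ t, s t = t ^ 2 * C t + d) → deriv (deriv s) 0 = 2 * C 0 := by
    rintro C s hC hs ⟨d, hd⟩
    have hC' : ContDiff ℝ ∞ (deriv C) := (contDiff_infty_iff_deriv.1 hC).2
    have h1 : deriv s = fun t => t * (2 * C t + t * deriv C t) := by
      funext t
      have h2 := ((hasDerivAt_pow 2 t).mul (hC.differentiable (by simp) t).hasDerivAt).add_const d
      have h3 : s = fun t => t ^ 2 * C t + d := funext hd
      rw [h3]
      have h4 : deriv (fun t => t ^ 2 * C t + d) t = _ := h2.deriv
      rw [h4]; push_cast; ring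
    have h5 : ContDiff ℝ ∞ fun t => 2 * C t + t * deriv C t := by fun_prop
    have h6 := (hasDerivAt_id' (0 : ℝ)).mul (h5.differentiable (by simp) 0).hasDerivAt
    have h7 : deriv (fun t => t * (2 * C t + t * deriv C t)) 0 = _ := h6.deriv
    rw [h1, h7]; simp
  have hdd : ∀ {f : ℝ × ℝ → ℝ}, ContDiff ℝ ∞ f →
      dfst (dfst f) 0 = deriv (deriv fun t => f (t, 0)) 0 := by
    intro f hf
    have h1 : (deriv fun t => f (t, 0)) = fun t => dfst f (t, 0) := by
      funext t
      exact (hasDerivAt_fst (hf.differentiable (by simp) (t, 0))).deriv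
    rw [h1]
    exact (hasDerivAt_fst (hf.dfst.differentiable (by simp) 0)).deriv.symm
  have hquu0 : dfst (dfst q) 0 = 2 * A 0 := by
    rw [hdd hq]
    exact hsq A _ hA (by fun_prop) ⟨0, fun t => by simp [q]⟩
  have hpuu0 : dfst (dfst p) 0 = 2 * B 0 := by
    rw [hdd hp]
    exact hsq B _ hB (by fun_prop) ⟨0, fun t => by simp [p]⟩
  -- the strict transform
  let σ : ℝ × ℝ → ℝ × ℝ := fun w => (w.1, w.1 ^ m * w.2)
  let F : ℝ × ℝ → ℝ := fun w =>
    (dfst (dfst q) (σ w) * w.2 - dfst (dfst p) (σ w) * (D w.1 + w.2 * K (σ w))) *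
      (dsnd (dsnd q) (σ w) * w.2 - (D w.1 + w.2 * K (σ w))) - (dfst (dsnd q) (σ w) * w.2) ^ 2
  have hF : ContDiff ℝ ∞ F := by
    have := hq.dfst.dfst
    have := hp.dfst.dfst
    have := hq.dsnd.dsnd
    have := hq.dsnd.dfst
    fun_prop
  have hparF : ∀ w, parabolicFun (normalForm m A B D E) (σ w) = w.1 ^ (2 * m) * F w := by
    intro w
    rw [hpar]
    simp only [F, σ]
    ring
  have hF0 : ∀ s, F (0, s) = -(2 * A 0 * s - 2 * B 0 * D 0) * D 0 := by
    intro s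
    have hσ : σ (0, s) = 0 := by simp [σ, zero_pow (by omega : m ≠ 0)]
    simp only [F, hσ, hquu0, hpuu0, hqvv0, hqvu0, hK0]
    ring
  -- The root of the strict transform on the exceptional line u = 0. It is simple because A(0) and
  -- D(0) are nonzero.
  set s₀ : ℝ := B 0 * D 0 / A 0 with hs₀
  have hs₀A : A 0 * s₀ = B 0 * D 0 := by rw [hs₀]; field_simp
  let F₀ : ℝ × ℝ → ℝ := fun w => F (w.1, s₀ + w.2)
  have hF₀ : ContDiff ℝ ∞ F₀ := by fun_prop
  have hF₀0 : ∀ s, F₀ (0, s) = s * (-2 * A 0 * D 0) := by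
    intro s
    simp only [F₀, hF0]
    linear_combination (-2 * D 0) * hs₀A
  obtain ⟨c, hc, hc0, hcz, hcu⟩ := exists_implicit hF₀.smoothGerm
    ((hF₀0 0).trans (by simp)) (by
      have h1 : HasDerivAt (fun s => F₀ (0, s)) (-2 * A 0 * D 0) 0 := by
        simp only [hF₀0]
        simpa using (hasDerivAt_id' (0 : ℝ)).mul_const (-2 * A 0 * D 0)
      rw [dsnd_eq_of_hasDerivAt (hF₀.differentiable (by simp) 0) h1]
      simp [hA0, hD0])
  refine ⟨fun t => s₀ + c t, by fun_prop, by simpa [hc0] using hs₀A, ?_, ?_⟩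
  · filter_upwards [hcz] with t ht
    have h1 := hparF (t, s₀ + c t)
    simp only [σ] at h1
    rw [h1]
    simp only [F₀] at ht
    rw [ht, mul_zero]
  · have htc : Tendsto (fun t => (t, c t)) (𝓝 0) (𝓝 0) :=
      (by fun_prop : Continuous fun t => (t, c t)).tendsto' _ _ (by simp [hc0])
    filter_upwards [htc.eventually hcu.eventually_nhds] with t ht ht0
    -- Away from u = 0 the blow-up has the continuous inverse (u, v) ↦ (u, v / u^m), so uniqueness
    -- of the implicit solution descends to the parabolic set near each point of the branch other
    -- than the origin.
    have hcont : ContinuousAt (fun p : ℝ × ℝ => (p.1, p.2 / p.1 ^ m - s₀))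
        (t, t ^ m * (s₀ + c t)) := by
      refine continuousAt_fst.prodMk (ContinuousAt.sub (ContinuousAt.div continuousAt_snd
        (continuousAt_fst.pow m) ?_) continuousAt_const)
      exact pow_ne_zero m ht0
    have hval : (fun p : ℝ × ℝ => (p.1, p.2 / p.1 ^ m - s₀)) (t, t ^ m * (s₀ + c t)) =
        (t, c t) := by
      simp only [Prod.mk.injEq, true_and]
      field_simp
      ring
    have hten : Tendsto (fun p : ℝ × ℝ => (p.1, p.2 / p.1 ^ m - s₀))
        (𝓝 (t, t ^ m * (s₀ + c t))) (𝓝 (t, c t)) := by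
      rw [← hval]; exact hcont
    filter_upwards [hten.eventually ht, continuousAt_fst.eventually_ne ht0] with w h1 h2 h3
    have hwm : w.1 ^ m ≠ 0 := pow_ne_zero m h2
    have hσw : σ (w.1, w.2 / w.1 ^ m) = w := by
      refine Prod.ext rfl ?_
      simp only [σ]; field_simp
    have h4 := hparF (w.1, w.2 / w.1 ^ m)
    rw [hσw, h3] at h4
    have h5 : F (w.1, w.2 / w.1 ^ m) = 0 :=
      (mul_eq_zero.1 h4.symm).resolve_left (pow_ne_zero _ h2)
    have h6 := h1 (by
      simp only [F₀]
      rw [add_sub_cancel]; exact h5)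
    rw [← h6]
    field_simp
    ring

/-- A branch of the zero set is carried along by a change of coordinates. -/
theorem isBranch_of_normalForm {m : ℕ} (hm : 1 ≤ m) {g N : ℝ × ℝ → E3} {R : E3 ≃ₗᵢ[ℝ] E3}
    {ψ θ : ℝ × ℝ → ℝ × ℝ} {μ : ℝ → ℝ}
    (hR : LinearMap.det (R.toLinearEquiv : E3 →ₗ[ℝ] E3) = 1) (hg : SmoothGerm g)
    (hN : ContDiff ℝ ∞ N) (hψ : DiffeoGerm ψ) (hθ : DiffeoGerm θ) (hθs : ContDiff ℝ ∞ θ)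
    (hθψ : ∀ᶠ w in 𝓝 0, θ (ψ w) = w) (hψθ : ∀ᶠ w in 𝓝 0, ψ (θ w) = w)
    (he : (fun w => R (g w)) =ᶠ[𝓝 0] fun w => N (ψ w)) (hμ : ContDiff ℝ ∞ μ)
    (hz : ∀ᶠ t in 𝓝 0, parabolicFun N (t, t ^ m * μ t) = 0)
    (hu : ∀ᶠ t in 𝓝 (0 : ℝ), t ≠ 0 → ∀ᶠ p in 𝓝 (t, t ^ m * μ t),
      parabolicFun N p = 0 → p.2 = p.1 ^ m * μ p.1) :
    IsBranch (parabolicSet g) fun t => θ (t, t ^ m * μ t) := by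
  let c : ℝ → ℝ × ℝ := fun t => (t, t ^ m * μ t)
  have hc : ContDiff ℝ ∞ c := by fun_prop
  have hc0 : c 0 = 0 := by simp [c, zero_pow (by omega : m ≠ 0)]
  have hct : Tendsto c (𝓝 0) (𝓝 0) := hc.continuous.tendsto' _ _ hc0
  have hcd : deriv c 0 ≠ 0 := by
    intro h
    have h2 := deriv_fst hc.smoothGerm
    rw [h] at h2
    simp [c] at h2
  have hiff : ∀ᶠ p in 𝓝 (0 : ℝ × ℝ), parabolicFun g p = 0 ↔ parabolicFun N (ψ p) = 0 := by
    filter_upwards [hg, hψ.2.1, hψ.2.1.differentiableAt.eventually_nhds, he.eventuallyEq_nhds,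
      hψ.jacobian_ne_zero] with p h1 h2 h3 h4 h5
    rw [parabolicFun_comp hR h1 hN h2 h3 h4, mul_eq_zero]
    exact ⟨fun h => h.resolve_left (pow_ne_zero 4 h5), Or.inr⟩
  have hθc : Tendsto (fun t => θ (c t)) (𝓝 0) (𝓝 0) := hθ.tendsto.comp hct
  -- A single interval on which all the local statements hold at every parameter; uniqueness is
  -- required at each point of the branch, hence the neighbourhoods of neighbourhoods.
  have hall := (((hz.and hu).and (hθc.eventually (hiff.and hθψ).eventually_nhds)).and
    (hct.eventually hψθ)).and (hθc.eventually hψ.2.1)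
  obtain ⟨ε, hε, hball⟩ := Metric.eventually_nhds_iff_ball.1 hall
  have hmem : ∀ t ∈ Set.Ioo (-ε) ε, t ∈ Metric.ball (0 : ℝ) ε := fun t ht => by
    rw [Real.ball_eq_Ioo]; simpa using ht
  refine ⟨by simp only [c] at hc0; simp [hc0, hθ.1], hθs.smoothGerm.comp hc.smoothGerm hc0,
    hθ.deriv_comp_ne_zero hc.smoothGerm hc0 hcd, ε, hε, fun t ht => ?_, fun t ht ht0 => ?_⟩
  · obtain ⟨⟨⟨⟨h1, -⟩, h2⟩, h3⟩, -⟩ := hball t (hmem t ht)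
    change parabolicFun g (θ (c t)) = 0
    rw [h2.self_of_nhds.1, h3]
    exact h1
  · obtain ⟨⟨⟨⟨-, h1⟩, h2⟩, h3⟩, h4⟩ := hball t (hmem t ht)
    have hψc : Tendsto ψ (𝓝 (θ (c t))) (𝓝 (c t)) := by
      have := h4.continuousAt.tendsto
      rwa [h3] at this
    have hIoo : ∀ᶠ p in 𝓝 (c t), p.1 ∈ Set.Ioo (-ε) ε :=
      continuousAt_fst.eventually_mem (isOpen_Ioo.mem_nhds ht)
    filter_upwards [h2, hψc.eventually (h1 ht0), hψc.eventually hIoo] with p h5 h6 h7 hp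
    refine ⟨(ψ p).1, h7, ?_⟩
    have h8 := h6 (h5.1.1 hp)
    have h9 : ((ψ p).1, (ψ p).1 ^ m * μ (ψ p).1) = ψ p := Prod.ext rfl h8.symm
    simp only [h9, h5.2]

/-! ### Derivatives of curves on the surface. -/

section Derivatives

variable {F G : Type*} [NormedAddCommGroup F] [NormedSpace ℝ F]
  [NormedAddCommGroup G] [NormedSpace ℝ G]

theorem map_deriv {f : ℝ → F} {t : ℝ} (hf : DifferentiableAt ℝ f t) (l : F →L[ℝ] G) :
    deriv (fun t => l (f t)) t = l (deriv f t) :=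
  (l.hasFDerivAt.comp_hasDerivAt t hf.hasDerivAt).deriv

theorem map_iteratedDeriv {f : ℝ → F} (hf : SmoothGerm f) (l : F →L[ℝ] G) (n : ℕ) :
    iteratedDeriv n (fun t => l (f t)) 0 = l (iteratedDeriv n f 0) := by
  induction n generalizing f with
  | zero => simp
  | succ n ih =>
    rw [iteratedDeriv_succ', iteratedDeriv_succ', ← ih hf.deriv]
    refine EventuallyEq.iteratedDeriv_eq n ?_
    filter_upwards [hf.differentiableAt] with t ht using map_deriv ht l

theorem iteratedDeriv_apply_E3 {f : ℝ → E3} (hf : SmoothGerm f) (n : ℕ) (i : Fin 3) :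
    iteratedDeriv n f 0 i = iteratedDeriv n (fun t => f t i) 0 :=
  (map_iteratedDeriv hf (EuclideanSpace.proj i : E3 →L[ℝ] ℝ) n).symm

theorem deriv_apply_E3 {f : ℝ → E3} (hf : SmoothGerm f) (i : Fin 3) :
    deriv f 0 i = deriv (fun t => f t i) 0 := by
  have := iteratedDeriv_apply_E3 hf 1 i
  simpa using this

theorem SmoothGerm.iteratedDeriv {f : ℝ → F} (hf : SmoothGerm f) (n : ℕ) :
    SmoothGerm (iteratedDeriv n f) := by
  induction n with
  | zero => simpa using hf
  | succ n ih => rw [iteratedDeriv_succ]; exact ih.deriv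

theorem deriv_of_isBigO_sub_sq {f : ℝ → ℝ} {a : ℝ} (hf : SmoothGerm f)
    (h : (fun t => f t - a * t ^ 2) =O[𝓝 0] fun t : ℝ => t ^ 3) :
    deriv f 0 = 0 ∧ iteratedDeriv 2 f 0 = 2 * a := by
  have hs : ContDiff ℝ ∞ fun t : ℝ => a * t ^ 2 := by fun_prop
  have hz := (isBigO_pow_iff 3 (hf.sub hs.smoothGerm)).1 h
  have hd : ∀ t : ℝ, HasDerivAt (fun t : ℝ => a * t ^ 2) (2 * a * t) t := by
    intro t
    convert! (hasDerivAt_pow 2 t).const_mul a using 1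
    push_cast; ring
  have hd1 : deriv (fun t : ℝ => a * t ^ 2) = fun t => 2 * a * t := funext fun t => (hd t).deriv
  have hsub : deriv (fun t => f t - a * t ^ 2) =ᶠ[𝓝 0] fun t => deriv f t - 2 * a * t := by
    filter_upwards [hf.differentiableAt] with t ht
    exact (ht.hasDerivAt.sub (hd t)).deriv
  have h1 := hz 1 (by norm_num)
  have h2 := hz 2 (by norm_num)
  rw [iteratedDeriv_one, hsub.self_of_nhds] at h1
  rw [iteratedDeriv_succ, iteratedDeriv_one, hsub.deriv_eq] at h2
  have h3 : deriv (fun t => deriv f t - 2 * a * t) 0 = _ :=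
    ((hf.deriv.contDiffAt.differentiableAt (by simp)).hasDerivAt.sub
      ((hasDerivAt_id' (0 : ℝ)).const_mul (2 * a))).deriv
  rw [h3] at h2
  refine ⟨by simpa using h1, ?_⟩
  rw [iteratedDeriv_succ, iteratedDeriv_one]
  linarith

end Derivatives

/-- `u² k - u'(0)² k(0) t²` is of third order. -/
theorem isBigO_sq_mul {u k : ℝ → ℝ} (hu : SmoothGerm u) (hu0 : u 0 = 0) (hk : SmoothGerm k) :
    (fun t => u t ^ 2 * k t - (deriv u 0 ^ 2 * k 0) * t ^ 2) =O[𝓝 0] fun t : ℝ => t ^ 3 := by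
  have h1 : u =O[𝓝 0] fun t : ℝ => t := isBigO_of_smoothGerm hu hu0
  have h2 : (fun t => k t - k 0) =O[𝓝 0] fun t : ℝ => t :=
    isBigO_of_smoothGerm (hk.sub contDiff_const.smoothGerm) (by simp)
  have h3 : (fun t => u t - deriv u 0 * t) =O[𝓝 0] fun t : ℝ => t ^ 2 := by
    refine smoothGerm_E3_isBigO_sq (hu.sub (by fun_prop :
      ContDiff ℝ ∞ fun t : ℝ => deriv u 0 * t).smoothGerm) (by simp [hu0]) ?_
    have h4 : deriv (fun t => u t - deriv u 0 * t) 0 = _ :=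
      ((hu.contDiffAt.differentiableAt (by simp)).hasDerivAt.sub
        ((hasDerivAt_id' (0 : ℝ)).const_mul (deriv u 0))).deriv
    rw [h4]; simp
  have h4 : (fun t => u t + deriv u 0 * t) =O[𝓝 0] fun t : ℝ => t :=
    h1.add (isBigO_const_mul_self _ _ _)
  have h5 := ((h1.pow 2).mul h2).add ((h3.mul h4).const_mul_left (k 0))
  have h6 : ∀ t : ℝ, t ^ 2 * t = t ^ 3 := fun t => by ring
  simp only [h6] at h5
  exact h5.congr_left fun t => by ring

/-- Coordinates bringing the germ `g` into normal form. -/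
structure NormalCoords (g : ℝ × ℝ → E3) (m : ℕ) (R : E3 ≃ₗᵢ[ℝ] E3) (ψ : ℝ × ℝ → ℝ × ℝ)
    (A B D : ℝ → ℝ) (E : ℝ × ℝ → ℝ) : Prop where
  two_le : 2 ≤ m
  smooth : SmoothGerm g
  zero : g 0 = 0
  det : LinearMap.det (R.toLinearEquiv : E3 →ₗ[ℝ] E3) = 1
  diffeo : DiffeoGerm ψ
  hA : ContDiff ℝ ∞ A
  hB : ContDiff ℝ ∞ B
  hD : ContDiff ℝ ∞ D
  hE : ContDiff ℝ ∞ E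
  D_ne_zero : D 0 ≠ 0
  E_zero : E 0 = 0
  eq : (fun w => R (g w)) =ᶠ[𝓝 0] fun w => normalForm m A B D E (ψ w)

section Curve

variable {m : ℕ} {A B D : ℝ → ℝ} {E : ℝ × ℝ → ℝ}

theorem normalForm_zero : normalForm m A B D E 0 = 0 := by
  apply ext_E3 <;> simp [normalForm]

/-- First and second derivatives of a curve on the surface in normal form. -/
theorem deriv_normalForm_curve (hm : 2 ≤ m) (hA : ContDiff ℝ ∞ A) (hB : ContDiff ℝ ∞ B)
    (hD : ContDiff ℝ ∞ D) (hE : ContDiff ℝ ∞ E) (hE0 : E 0 = 0) {c : ℝ → ℝ × ℝ}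
    (hc : SmoothGerm c) (hc0 : c 0 = 0) :
    deriv (fun t => normalForm m A B D E (c t)) 0 = !₂[(deriv c 0).1, 0, 0] ∧
    iteratedDeriv 2 (fun t => normalForm m A B D E (c t)) 0 1 =
      (deriv c 0).2 ^ 2 + 2 * B 0 * (deriv c 0).1 ^ 2 ∧
    iteratedDeriv 2 (fun t => normalForm m A B D E (c t)) 0 2 = 2 * A 0 * (deriv c 0).1 ^ 2 := by
  have hu0 : (c 0).1 = 0 := by rw [hc0]; rfl
  have hv0 : (c 0).2 = 0 := by rw [hc0]; rfl
  have hct := hc.tendsto hc0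
  have hN : SmoothGerm fun t => normalForm m A B D E (c t) :=
    (contDiff_normalForm m hA hB hD hE).smoothGerm.comp hc hc0
  have hu := isBigO_of_smoothGerm hc.fst hu0
  have hv := isBigO_of_smoothGerm hc.snd hv0
  have h1 := deriv_of_isBigO_sub_sq (a := (deriv c 0).2 ^ 2 / 2 + B 0 * (deriv c 0).1 ^ 2)
    (hN.apply_E3 1) (by
      have hB' : SmoothGerm fun t => B (c t).1 := hB.smoothGerm.comp hc.fst hu0
      have h2 := isBigO_sq_mul hc.fst hu0 hB'
      have h3 := isBigO_sq_mul hc.snd hv0 (k := fun _ => 1 / 2) contDiff_const.smoothGerm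
      rw [deriv_fst hc, hu0] at h2
      rw [deriv_snd hc] at h3
      refine (h3.add h2).congr_left fun t => ?_
      simp [normalForm]; ring)
  have h2 := deriv_of_isBigO_sub_sq (a := A 0 * (deriv c 0).1 ^ 2)
    (hN.apply_E3 2) (by
      have hA' : SmoothGerm fun t => A (c t).1 := hA.smoothGerm.comp hc.fst hu0
      have hD' : SmoothGerm fun t => D (c t).1 := hD.smoothGerm.comp hc.fst hu0
      have hE' : SmoothGerm fun t => E (c t) := hE.smoothGerm.comp hc hc0
      have h2 := isBigO_sq_mul hc.fst hu0 hA'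
      rw [deriv_fst hc, hu0] at h2
      -- The mixed term is of order m + 1 ≥ 3, so it does not contribute to the second derivative.
      have h3 : (fun t => (c t).1 ^ m * D (c t).1 * (c t).2) =O[𝓝 0] fun t : ℝ => t ^ 3 := by
        have := (((hu.pow m).trans (pow_isBigO_pow hm)).mul (hD'.continuousAt.isBigO_one ℝ)).mul hv
        refine this.congr_right fun t => ?_
        ring
      have h4 : (fun t => (c t).2 ^ 2 * E (c t)) =O[𝓝 0] fun t : ℝ => t ^ 3 := by
        have := (hv.pow 2).mul (isBigO_of_smoothGerm hE' (by rw [hc0, hE0]))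
        refine this.congr_right fun t => ?_
        ring
      refine ((h2.add h3).add h4).congr_left fun t => ?_
      simp [normalForm]; ring)
  refine ⟨?_, ?_, ?_⟩
  · apply ext_E3 <;> rw [deriv_apply_E3 hN]
    · exact deriv_fst hc
    · exact h1.1
    · exact h2.1
  · rw [iteratedDeriv_apply_E3 hN, h1.2]; ring
  · rw [iteratedDeriv_apply_E3 hN, h2.2]; ring

end Curve

/-! ### Inflections, the principal plane and characteristic curves. -/

namespace NormalCoords

variable {g : ℝ × ℝ → E3} {m : ℕ} {R : E3 ≃ₗᵢ[ℝ] E3} {ψ : ℝ × ℝ → ℝ × ℝ}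
  {A B D : ℝ → ℝ} {E : ℝ × ℝ → ℝ}

theorem curve (h : NormalCoords g m R ψ A B D E) {σ : ℝ → ℝ × ℝ} (hσ : SmoothGerm σ)
    (hσ0 : σ 0 = 0) :
    R (fderiv ℝ g 0 (deriv σ 0)) = !₂[(fderiv ℝ ψ 0 (deriv σ 0)).1, 0, 0] ∧
    R (iteratedDeriv 2 (fun t => g (σ t)) 0) 1 =
      (fderiv ℝ ψ 0 (deriv σ 0)).2 ^ 2 + 2 * B 0 * (fderiv ℝ ψ 0 (deriv σ 0)).1 ^ 2 ∧
    R (iteratedDeriv 2 (fun t => g (σ t)) 0) 2 = 2 * A 0 * (fderiv ℝ ψ 0 (deriv σ 0)).1 ^ 2 := by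
  have hc : SmoothGerm fun t => ψ (σ t) := h.diffeo.2.1.comp hσ hσ0
  have hgσ : SmoothGerm fun t => g (σ t) := h.smooth.comp hσ hσ0
  have hcd := deriv_comp_curve h.diffeo.2.1 hσ hσ0
  have hN := deriv_normalForm_curve h.two_le h.hA h.hB h.hD h.hE h.E_zero hc
    (by simp [hσ0, h.diffeo.1])
  have he : (fun t => R (g (σ t))) =ᶠ[𝓝 0] fun t => normalForm m A B D E (ψ (σ t)) :=
    (hσ.tendsto hσ0).eventually h.eq
  have h2 := map_iteratedDeriv hgσ (R.toContinuousLinearEquiv : E3 →L[ℝ] E3)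
  have h2' : ∀ n, R (iteratedDeriv n (fun t => g (σ t)) 0) =
      iteratedDeriv n (fun t => normalForm m A B D E (ψ (σ t))) 0 := by
    intro n
    rw [← he.iteratedDeriv_eq n]
    exact (h2 n).symm
  rw [hcd] at hN
  refine ⟨?_, ?_, ?_⟩
  · rw [← deriv_comp_curve h.smooth hσ hσ0, ← hN.1]
    have := h2' 1
    simpa using this
  · rw [h2', hN.2.1]
  · rw [h2', hN.2.2]

theorem _root_.SingSurf.line (w : ℝ × ℝ) : SmoothGerm (fun t : ℝ => t • w) ∧
    (fun t : ℝ => t • w) 0 = 0 ∧ deriv (fun t : ℝ => t • w) 0 = w := by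
  refine ⟨(contDiff_id.smul contDiff_const).smoothGerm, zero_smul _ _, ?_⟩
  have := (hasDerivAt_id' (0 : ℝ)).smul_const w
  rw [this.deriv, one_smul]

theorem _root_.SingSurf.second_eq_iteratedDeriv (hg : SmoothGerm g) (w : ℝ × ℝ) :
    second g 0 w w = iteratedDeriv 2 (fun t : ℝ => g (t • w)) 0 := by
  obtain ⟨h1, h2, h3⟩ := line w
  have hct := h1.tendsto h2
  have hd : ∀ t : ℝ, HasDerivAt (fun t : ℝ => t • w) w t := fun t => by
    simpa using (hasDerivAt_id' t).smul_const w
  have he : deriv (fun t : ℝ => g (t • w)) =ᶠ[𝓝 0] fun t => fderiv ℝ g (t • w) w := by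
    filter_upwards [hct.eventually hg.differentiableAt] with t ht
    exact (ht.hasFDerivAt.comp_hasDerivAt t (hd t)).deriv
  rw [iteratedDeriv_succ, iteratedDeriv_one, he.deriv_eq, second_eq hg.contDiffAt]
  have hs : SmoothGerm fun q => fderiv ℝ g q w := hg.fderiv.mono fun q hq =>
    hq.clm_apply contDiffAt_const
  have := deriv_comp_curve hs h1 h2
  rw [h3] at this
  exact this.symm

theorem map_fderiv (h : NormalCoords g m R ψ A B D E) (v : ℝ × ℝ) :
    R (fderiv ℝ g 0 v) = !₂[(fderiv ℝ ψ 0 v).1, 0, 0] := by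
  obtain ⟨h1, h2, h3⟩ := line v
  have := (h.curve h1 h2).1
  rwa [h3] at this

theorem map_second_apply (h : NormalCoords g m R ψ A B D E) (v : ℝ × ℝ) :
    R (second g 0 v v) 1 = (fderiv ℝ ψ 0 v).2 ^ 2 + 2 * B 0 * (fderiv ℝ ψ 0 v).1 ^ 2 ∧
      R (second g 0 v v) 2 = 2 * A 0 * (fderiv ℝ ψ 0 v).1 ^ 2 := by
  obtain ⟨h1, h2, h3⟩ := line v
  have := (h.curve h1 h2).2
  rw [second_eq_iteratedDeriv h.smooth]
  rwa [h3] at this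

theorem _root_.SingSurf.inner_symm_single (R : E3 ≃ₗᵢ[ℝ] E3) (i : Fin 3) (x : E3) :
    inner ℝ x (R.symm (EuclideanSpace.single i 1)) = R x i := by
  rw [← R.inner_map_map, R.apply_symm_apply, inner_E3]
  fin_cases i <;> simp

theorem symm_single_mem (h : NormalCoords g m R ψ A B D E) {i : Fin 3} (hi : i ≠ 0) :
    R.symm (EuclideanSpace.single i 1) ∈ (tangentLine g)ᗮ := by
  rw [Submodule.mem_orthogonal]
  rintro _ ⟨v, rfl⟩
  rw [inner_symm_single]
  change R (fderiv ℝ g 0 v) i = 0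
  rw [h.map_fderiv]
  fin_cases i
  · exact absurd rfl hi
  · rfl
  · rfl

/-- At a point which is not an inflection point, the second fundamental form in the direction
normal to the principal plane does not vanish. -/
theorem A_ne_zero (h : NormalCoords g m R ψ A B D E) (hinf : ¬ IsInflection g) : A 0 ≠ 0 := by
  intro hA0
  apply hinf
  obtain ⟨e, he⟩ := h.diffeo.2.2
  have hpair : ∀ w, normalPair g (R.symm (EuclideanSpace.single 1 1))
      (R.symm (EuclideanSpace.single 2 1)) w = (((e w).2 ^ 2 + 2 * B 0 * (e w).1 ^ 2) / 2, 0) := by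
    intro w
    have h1 := h.map_second_apply w
    rw [hA0, ← he] at h1
    rw [normalPair, inner_symm_single, inner_symm_single, h1.1, h1.2]
    simp
  -- A rescaling that normalizes the coefficient 2B(0) to 1, -1 or 0. These three cases are the
  -- three nonzero inflection orbits.
  obtain ⟨β, hβ, hcase⟩ : ∃ β : ℝ, β ≠ 0 ∧
      (2 * B 0 * β ^ 2 = 1 ∨ 2 * B 0 * β ^ 2 = -1 ∨ 2 * B 0 * β ^ 2 = 0) := by
    rcases lt_trichotomy (B 0) 0 with hb | hb | hb
    · have hpos : 0 < -(2 * B 0) := by linarith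
      refine ⟨(Real.sqrt (-(2 * B 0)))⁻¹, (inv_pos.2 (Real.sqrt_pos.2 hpos)).ne', Or.inr (Or.inl ?_)⟩
      rw [inv_pow, Real.sq_sqrt hpos.le]
      field_simp
      rw [div_self hb.ne]
    · exact ⟨1, one_ne_zero, Or.inr (Or.inr (by rw [hb]; simp))⟩
    · have hpos : 0 < 2 * B 0 := by linarith
      refine ⟨(Real.sqrt (2 * B 0))⁻¹, (inv_pos.2 (Real.sqrt_pos.2 hpos)).ne', Or.inl ?_⟩
      rw [inv_pow, Real.sq_sqrt hpos.le]
      field_simp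
  -- The variables are exchanged so that the form v² + 2B(0)u² starts with the square of the first
  -- one; `M` below removes the factor 1/2.
  let sw : (ℝ × ℝ) ≃ₗ[ℝ] (ℝ × ℝ) := (LinearEquiv.prodComm ℝ ℝ ℝ).trans
    ((LinearEquiv.smulOfNeZero ℝ ℝ β hβ).prodCongr (LinearEquiv.refl ℝ ℝ))
  let a : (ℝ × ℝ) ≃ₗ[ℝ] (ℝ × ℝ) := sw.trans e.symm.toLinearEquiv
  let M : (ℝ × ℝ) ≃ₗ[ℝ] (ℝ × ℝ) := LinearEquiv.smulOfNeZero ℝ (ℝ × ℝ) 2 two_ne_zero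
  have hval : ∀ w : ℝ × ℝ, M (normalPair g (R.symm (EuclideanSpace.single 1 1))
      (R.symm (EuclideanSpace.single 2 1)) (a w)) = (w.1 ^ 2 + 2 * B 0 * β ^ 2 * w.2 ^ 2, 0) := by
    intro w
    have hea : e (a w) = (β * w.2, w.1) := by
      change e (e.symm (sw w)) = _
      rw [e.apply_symm_apply]; rfl
    have hM : ∀ z, M z = (2 : ℝ) • z := fun z => rfl
    rw [hpair, hea, hM]
    refine Prod.ext ?_ ?_
    · simp; ring
    · simp
  have horth : Orthonormal ℝ ![R.symm (EuclideanSpace.single 1 1 : E3),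
      R.symm (EuclideanSpace.single 2 1)] := by
    rw [orthonormal_iff_ite]
    intro i j
    fin_cases i <;> fin_cases j <;> simp <;> simp [inner_E3]
  refine ⟨_, _, horth, h.symm_single_mem (by decide), h.symm_single_mem (by decide), ?_⟩
  rcases hcase with hc | hc | hc
  · exact Or.inl ⟨a, M, fun w => by rw [hval, hc]; simp⟩
  · exact Or.inr (Or.inl ⟨a, M, fun w => by rw [hval, hc]; simp; ring⟩)
  · exact Or.inr (Or.inr (Or.inl ⟨a, M, fun w => by rw [hval, hc]; simp⟩))

theorem symm_single_one_mem (h : NormalCoords g m R ψ A B D E) :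
    R.symm (EuclideanSpace.single 1 1) ∈ principalPlane g := by
  obtain ⟨e, he⟩ := h.diffeo.2.2
  have he' : ∀ v, fderiv ℝ ψ 0 v = e v := fun v => by rw [← he]; rfl
  have hη : fderiv ℝ g 0 (e.symm (0, 1)) = 0 := by
    apply R.injective
    rw [h.map_fderiv, he', e.apply_symm_apply, map_zero]
    apply ext_E3 <;> simp
  have hs := h.map_second_apply (e.symm (0, 1))
  rw [he', e.apply_symm_apply] at hs
  set z := second g 0 (e.symm (0, 1)) (e.symm (0, 1)) with hz
  -- In the rotated frame ηηg has second component 1 and third component 0. Its first component is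
  -- tangential and is cancelled by a vector of the tangent line.
  have hR : R.symm (EuclideanSpace.single 1 1) =
      fderiv ℝ g 0 (e.symm (-(R z 0), 0)) + z := by
    apply R.injective
    rw [R.apply_symm_apply, map_add, h.map_fderiv, he', e.apply_symm_apply]
    apply ext_E3
    · simp
    · simp [hs.1]
    · simp [hs.2]
  rw [hR]
  refine Submodule.add_mem_sup ⟨_, rfl⟩ (Submodule.subset_span ⟨_, hη, rfl⟩)

theorem norm_fderiv (h : NormalCoords g m R ψ A B D E) (v : ℝ × ℝ) :
    ‖fderiv ℝ g 0 v‖ ^ 2 = (fderiv ℝ ψ 0 v).1 ^ 2 := by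
  rw [← R.norm_map, ← real_inner_self_eq_norm_sq, h.map_fderiv, inner_E3]
  simp; ring

/-- The unit normal lies in the principal plane and orthogonal projections are self-adjoint, so
projecting does not change the inner product with it. -/
theorem signedCurvature_eq (h : NormalCoords g m R ψ A B D E) {σ : ℝ → ℝ × ℝ}
    (hσ : SmoothGerm σ) (hσ0 : σ 0 = 0) :
    signedCurvature (R.symm (EuclideanSpace.single 1 1)) (projectedCurve g σ) =
      ((fderiv ℝ ψ 0 (deriv σ 0)).2 ^ 2 + 2 * B 0 * (fderiv ℝ ψ 0 (deriv σ 0)).1 ^ 2) /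
        (fderiv ℝ ψ 0 (deriv σ 0)).1 ^ 2 := by
  have hgσ : SmoothGerm fun t => g (σ t) := h.smooth.comp hσ hσ0
  have h1 : iteratedDeriv 2 (projectedCurve g σ) 0 =
      (principalPlane g).starProjection (iteratedDeriv 2 (fun t => g (σ t)) 0) :=
    map_iteratedDeriv hgσ _ 2
  have h2 : deriv (projectedCurve g σ) 0 = fderiv ℝ g 0 (deriv σ 0) := by
    have h3 : deriv (projectedCurve g σ) 0 =
        (principalPlane g).starProjection (deriv (fun t => g (σ t)) 0) :=
      map_deriv (hgσ.contDiffAt.differentiableAt (by simp)) _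
    rw [h3, deriv_comp_curve h.smooth hσ hσ0]
    rw [Submodule.starProjection_eq_self_iff]
    exact Submodule.mem_sup_left ⟨_, rfl⟩
  rw [signedCurvature, h1, h2, h.norm_fderiv, Submodule.inner_starProjection_left_eq_right,
    Submodule.starProjection_eq_self_iff.2 h.symm_single_one_mem, inner_symm_single,
    (h.curve hσ hσ0).2.1]

/-- The signed curvature is (v'/u')² + 2B(0), hence minimal exactly when v' = 0. -/
theorem isCharacteristic (h : NormalCoords g m R ψ A B D E) {γ : ℝ → ℝ × ℝ}
    (hγ : SmoothGerm γ) (hγ0 : γ 0 = 0) (h1 : (fderiv ℝ ψ 0 (deriv γ 0)).1 ≠ 0)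
    (h2 : (fderiv ℝ ψ 0 (deriv γ 0)).2 = 0) : IsCharacteristic g γ := by
  have htan : ∀ v, fderiv ℝ g 0 v ≠ 0 ↔ (fderiv ℝ ψ 0 v).1 ≠ 0 := by
    intro v
    rw [← norm_ne_zero_iff, ← pow_ne_zero_iff two_ne_zero, h.norm_fderiv,
      pow_ne_zero_iff two_ne_zero]
  refine ⟨⟨hγ0, hγ, (htan _).2 h1⟩, R.symm (EuclideanSpace.single 1 1), h.symm_single_one_mem,
    h.symm_single_mem (by decide), by simp, Or.inl fun σ hσ => ?_⟩
  obtain ⟨hσ0, hσ, hσd⟩ := hσ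
  have hd := (htan _).1 hσd
  simp only [Set.mem_ofPred_eq]
  rw [h.signedCurvature_eq hγ hγ0, h.signedCurvature_eq hσ hσ0, h2, add_div, add_div,
    mul_div_assoc, mul_div_assoc, div_self (pow_ne_zero 2 h1), div_self (pow_ne_zero 2 hd)]
  have : 0 ≤ (fderiv ℝ ψ 0 (deriv σ 0)).2 ^ 2 / (fderiv ℝ ψ 0 (deriv σ 0)).1 ^ 2 := by positivity
  simp
  linarith

end NormalCoords

/-! ### Contact with the tangent line in an arbitrary normal form. -/

theorem exists_taylor (n : ℕ) : ∀ {f : ℝ → ℝ}, ContDiff ℝ ∞ f →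
    ∃ c : ℕ → ℝ, (fun t => f t - ∑ i ∈ Finset.range n, c i * t ^ i) =O[𝓝 0] fun t : ℝ => t ^ n := by
  induction n with
  | zero =>
    intro f hf
    refine ⟨fun _ => 0, ?_⟩
    simpa using hf.continuous.continuousAt.isBigO_one ℝ
  | succ n ih =>
    intro f hf
    have h1 : (fun t => f t - f 0) =O[𝓝 0] fun t : ℝ => t ^ 1 := by
      simpa using isBigO_of_smoothGerm (hf.smoothGerm.sub contDiff_const.smoothGerm) (sub_self (f 0))
    obtain ⟨k, hk, hfk⟩ := exists_eq_pow_mul (hf.smoothGerm.sub contDiff_const.smoothGerm) h1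
    obtain ⟨c, hc⟩ := ih hk
    refine ⟨fun | 0 => f 0 | i + 1 => c i, ?_⟩
    have h2 := (isBigO_refl (fun t : ℝ => t) (𝓝 0)).mul hc
    refine h2.congr' ?_ (Eventually.of_forall fun t => by ring)
    filter_upwards [hfk] with t ht
    have h3 : f t = f 0 + t * k t := by linarith
    rw [Finset.sum_range_succ', h3, mul_sub, Finset.mul_sum]
    have h4 : ∀ i, c i * t ^ (i + 1) = t * (c i * t ^ i) := fun i => by ring
    simp only [h4, pow_zero]
    ring

theorem isBigO_fst_norm : (fun w : ℝ × ℝ => w.1) =O[𝓝 0] fun w => ‖w‖ :=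
  isBigO_fst_prod'.norm_right

theorem isBigO_snd_norm : (fun w : ℝ × ℝ => w.2) =O[𝓝 0] fun w => ‖w‖ :=
  isBigO_snd_prod'.norm_right

theorem isBigO_norm_of_contDiff {f : ℝ × ℝ → ℝ} (hf : ContDiff ℝ ∞ f) (h0 : f 0 = 0) :
    f =O[𝓝 0] fun w => ‖w‖ := by
  have := (hf.differentiable (by simp) 0).isBigO_sub
  simpa [h0] using this.norm_right

/-- The same coordinates serve for every K: p is v²/2 plus a function of u alone, and the b_i are
its Taylor coefficients. -/
theorem isNormalForm_normalForm {m : ℕ} (hm : 2 ≤ m) {A B D : ℝ → ℝ} {E : ℝ × ℝ → ℝ}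
    (hA : ContDiff ℝ ∞ A) (hB : ContDiff ℝ ∞ B) (hD : ContDiff ℝ ∞ D) (hE : ContDiff ℝ ∞ E)
    (hE0 : E 0 = 0) {K : ℕ} (hK : 2 ≤ K) : IsNormalForm K (normalForm m A B D E) := by
  refine ⟨(contDiff_normalForm m hA hB hD hE).smoothGerm, Eventually.of_forall fun w => rfl, ?_,
    2 * A 0, ?_⟩
  · obtain ⟨c, hc⟩ := exists_taylor (K - 1) hB
    refine ⟨fun i => (Nat.factorial i : ℝ) * c (i - 2), ?_⟩
    have h1 : Finset.Icc 2 K = Finset.Ico 2 (K + 1) := by ext i; simp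
    have h2 : ∀ w : ℝ × ℝ, ∑ i ∈ Finset.Icc 2 K,
        (Nat.factorial i : ℝ) * c (i - 2) / (Nat.factorial i : ℝ) * w.1 ^ i =
        w.1 ^ 2 * ∑ i ∈ Finset.range (K - 1), c i * w.1 ^ i := by
      intro w
      rw [h1, Finset.sum_Ico_eq_sum_range, Finset.mul_sum, show K + 1 - 2 = K - 1 by omega]
      refine Finset.sum_congr rfl fun i _ => ?_
      rw [mul_div_cancel_left₀ _ (by positivity), Nat.add_sub_cancel_left]
      ring
    simp only [h2]
    have ht : Tendsto (fun w : ℝ × ℝ => w.1) (𝓝 0) (𝓝 0) := continuous_fst.tendsto' _ _ rfl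
    have h3 := (isBigO_fst_norm.pow 2).mul ((hc.comp_tendsto ht).trans (isBigO_fst_norm.pow (K - 1)))
    refine (h3.congr_left fun w => ?_).congr_right fun w => ?_
    · simp [normalForm]; ring
    · rw [← pow_add]; congr 1; omega
  · have h1 := (isBigO_fst_norm.pow 2).mul (isBigO_norm_of_contDiff
      (f := fun w : ℝ × ℝ => A w.1 - A 0) (by fun_prop) (by simp))
    have h2 : (fun w : ℝ × ℝ => w.1 ^ m) =O[𝓝 0] fun w => ‖w‖ ^ 2 := by
      have ht : Tendsto (fun w : ℝ × ℝ => w.1) (𝓝 0) (𝓝 0) := continuous_fst.tendsto' _ _ rfl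
      exact ((pow_isBigO_pow hm).comp_tendsto ht).trans (isBigO_fst_norm.pow 2)
    have h3 := (h2.mul ((hD.continuous.comp continuous_fst).continuousAt.isBigO_one ℝ)).mul
      isBigO_snd_norm
    have h4 := (isBigO_snd_norm.pow 2).mul (isBigO_norm_of_contDiff hE hE0)
    have h5 : ∀ w : ℝ × ℝ, ‖w‖ ^ 2 * 1 * ‖w‖ = ‖w‖ ^ 2 * ‖w‖ := fun w => by ring
    simp only [h5] at h3
    refine (((h1.add h3).add h4).congr_left fun w => ?_).congr_right fun w => ?_
    · simp [normalForm]; ring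
    · ring

/-- The bound on F is differentiated by means of a family: at c(t) + (0, ts) the function F is
O(t^{K+1}), hence equal to t^{K+1} k(s,t) with k smooth. The s-derivative at s = 0 gives t F_v(c(t))
= O(t^{K+1}). -/
theorem isBigO_dsnd_along {F : ℝ × ℝ → ℝ} {K : ℕ} (hF : SmoothGerm F)
    (hO : F =O[𝓝 0] fun w => ‖w‖ ^ (K + 1)) {c : ℝ → ℝ × ℝ} (hc : SmoothGerm c) (hc0 : c 0 = 0) :
    (fun t => dsnd F (c t)) =O[𝓝 0] fun t : ℝ => t ^ K := by
  let q : ℝ × ℝ → ℝ × ℝ := fun z => ((c z.2).1, (c z.2).2 + z.2 * z.1)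
  have hcz : SmoothGerm fun z : ℝ × ℝ => c z.2 := hc.comp contDiff_snd.smoothGerm rfl
  have hq : SmoothGerm q := by
    refine hcz.fst.prodMk ?_
    filter_upwards [hcz.snd] with z hz
    exact hz.add (contDiff_snd.mul contDiff_fst).contDiffAt
  have hq0 : q 0 = 0 := by simp [q, hc0]
  have ht2 : Tendsto (fun z : ℝ × ℝ => z.2) (𝓝 0) (𝓝 0) := continuous_snd.tendsto' _ _ rfl
  have hqO : q =O[𝓝 0] fun z : ℝ × ℝ => z.2 := by
    have h1 := (isBigO_of_smoothGerm hc.fst (by simp [hc0])).comp_tendsto ht2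
    have h2 := (isBigO_of_smoothGerm hc.snd (by simp [hc0])).comp_tendsto ht2
    have h3 : (fun z : ℝ × ℝ => z.2 * z.1) =O[𝓝 0] fun z : ℝ × ℝ => z.2 := by
      simpa using (isBigO_refl (fun z : ℝ × ℝ => z.2) (𝓝 0)).mul
        (continuous_fst.continuousAt.isBigO_one ℝ)
    exact IsBigO.prod_left h1 (h2.add h3)
  obtain ⟨k, hk, hFk⟩ := exists_eq_snd_pow_mul (K + 1) (hF.comp hq hq0)
    ((hO.comp_tendsto (hq.tendsto hq0)).trans (hqO.norm_left.pow (K + 1)))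
  have hmul : ∀ᶠ t in 𝓝 (0 : ℝ), t * dsnd F (c t) = t ^ (K + 1) * fderiv ℝ k (0, t) (1, 0) := by
    filter_upwards [tendsto_inr.eventually hFk.eventually_nhds,
      (hc.tendsto hc0).eventually hF.differentiableAt] with t h1 h2
    have h3 : (fun s : ℝ => F ((c t).1, (c t).2 + t * s)) =ᶠ[𝓝 0] fun s => t ^ (K + 1) * k (s, t) := by
      have : Tendsto (fun s : ℝ => (s, t)) (𝓝 0) (𝓝 (0, t)) :=
        (by fun_prop : Continuous fun s : ℝ => (s, t)).tendsto' _ _ rfl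
      exact this.eventually h1
    have h4 : HasDerivAt (fun s : ℝ => (c t).2 + t * s) t 0 := by
      simpa using ((hasDerivAt_id' (0 : ℝ)).const_mul t).const_add (c t).2
    have h5 : HasDerivAt (fun s : ℝ => F ((c t).1, (c t).2 + t * s)) (dsnd F (c t) * t) 0 := by
      refine HasDerivAt.comp (h₂ := fun y => F ((c t).1, y)) (0 : ℝ) ?_ h4
      simpa using hasDerivAt_snd h2
    have h6 : HasDerivAt (fun s : ℝ => (s, t)) ((1 : ℝ), (0 : ℝ)) 0 :=
      (hasDerivAt_id (0 : ℝ)).prodMk (hasDerivAt_const _ _)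
    have h7 := ((hk.differentiable (by simp) ((0 : ℝ), t)).hasFDerivAt.comp_hasDerivAt (0 : ℝ)
      h6).const_mul (t ^ (K + 1))
    rw [mul_comm, ← h5.deriv, h3.deriv_eq]
    exact h7.deriv
  have hcont : ContinuousAt (fun t => dsnd F (c t)) 0 := (hF.dsnd.comp hc hc0).continuousAt
  have hk' : ContinuousAt (fun t : ℝ => fderiv ℝ k (0, t) (1, 0)) 0 := by
    have h1 : Continuous (fderiv ℝ k) := hk.continuous_fderiv (by simp)
    exact ((h1.comp (by fun_prop : Continuous fun t : ℝ => ((0 : ℝ), t))).clm_apply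
      continuous_const).continuousAt
  -- The factor t is cancelled for t ≠ 0 and the identity extends to t = 0 by continuity.
  have he : (fun t => dsnd F (c t)) =ᶠ[𝓝 0] fun t => t ^ K * fderiv ℝ k (0, t) (1, 0) := by
    refine (ContinuousAt.eventuallyEq_nhds_iff_eventuallyEq_nhdsNE hcont
      ((continuous_pow K).continuousAt.mul hk')).1 ?_
    filter_upwards [hmul.filter_mono nhdsWithin_le_nhds, self_mem_nhdsWithin] with t h1 h2
    refine mul_left_cancel₀ h2 ?_
    rw [h1, Pi.mul_apply]; ring
  refine IsBigO.congr' ?_ he.symm EventuallyEq.rfl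
  simpa using (isBigO_refl (fun t : ℝ => t ^ K) (𝓝 0)).mul (hk'.isBigO_one ℝ)

/-- In normal form, a curve along which the differential is flat is tangent to the first axis. -/
theorem IsNormalForm.isBigO_snd {m K : ℕ} (hm : 1 ≤ m) (hK : m ≤ K) {G : ℝ × ℝ → E3}
    (hG : IsNormalForm K G) {c ξ : ℝ → ℝ × ℝ} (h : FieldFlat m G c ξ) :
    (fun t => (c t).2) =O[𝓝 0] fun t : ℝ => t ^ m := by
  obtain ⟨hs, h1, ⟨b, hb⟩, -⟩ := hG
  let P : ℝ × ℝ → ℝ := fun w => w.2 ^ 2 / 2 +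
    ∑ i ∈ Finset.Icc 2 K, b i / (Nat.factorial i : ℝ) * w.1 ^ i
  have hP : ContDiff ℝ ∞ P := by fun_prop
  have hF : SmoothGerm fun w => G w 1 - P w := (hs.apply_E3 1).sub hP.smoothGerm
  -- The polynomial P has P_v = v, and p - P = O(K + 1), so p_v and v differ by O(t^K) along the
  -- curve. Since K ≥ m, this is within O(t^m).
  have hO := (isBigO_dsnd_along hF hb h.smooth h.zero).trans (pow_isBigO_pow hK)
  have hv := (h.vertical hm hs h1 1).sub hO
  refine hv.congr' ?_ EventuallyEq.rfl
  filter_upwards [(h.smooth.tendsto h.zero).eventually (hs.apply_E3 1).differentiableAt] with t ht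
  have hdP : HasDerivAt (fun y => P ((c t).1, y)) (c t).2 (c t).2 := by
    convert! ((hasDerivAt_pow 2 (c t).2).div_const 2).add_const
      (∑ i ∈ Finset.Icc 2 K, b i / (Nat.factorial i : ℝ) * (c t).1 ^ i) using 1
    push_cast; ring
  have hd : dsnd (fun w => G w 1 - P w) (c t) = dsnd (fun w => G w 1) (c t) - (c t).2 :=
    dsnd_eq_of_hasDerivAt (ht.sub (hP.differentiable (by simp) _)) ((hasDerivAt_snd ht).sub hdP)
  rw [hd]; ring

theorem contactAtLeast_of_isBigO {m : ℕ} (hm : 2 ≤ m) {c : ℝ → ℝ × ℝ} (hc : SmoothGerm c)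
    (hd : deriv c 0 ≠ 0) (hO : (fun t => (c t).2) =O[𝓝 0] fun t : ℝ => t ^ m) :
    ContactAtLeast m c := by
  intro l hl
  have h2 : (deriv c 0).2 = 0 := by rw [← deriv_snd hc]; exact deriv_eq_zero_of_isBigO hm hc.snd hO
  have h1 : (deriv c 0).1 ≠ 0 := fun h => hd (Prod.ext h h2)
  have hlin : ∀ w : ℝ × ℝ, l w = w.1 * l (1, 0) + w.2 * l (0, 1) := by
    intro w
    conv_lhs => rw [show w = w.1 • ((1 : ℝ), (0 : ℝ)) + w.2 • ((0 : ℝ), (1 : ℝ)) by ext <;> simp]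
    rw [map_add, map_smul, map_smul, smul_eq_mul, smul_eq_mul]
  have hl1 : l (1, 0) = 0 := by
    rw [hlin, h2, zero_mul, add_zero] at hl
    exact (mul_eq_zero.1 hl).resolve_left h1
  refine (isBigO_pow_iff m (hc.clm_comp l)).1 ((hO.const_mul_left (l (0, 1))).congr_left fun t => ?_)
  rw [hlin (c t), hl1]; ring

/-! ### Torsion and its derivative. -/

section Torsion

theorem SmoothGerm.cross {f g : ℝ → E3} (hf : SmoothGerm f) (hg : SmoothGerm g) :
    SmoothGerm fun t => cross (f t) (g t) := by
  have h : ∀ t, SingSurf.cross (f t) (g t) = !₂[f t 1 * g t 2 - f t 2 * g t 1,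
      f t 2 * g t 0 - f t 0 * g t 2, f t 0 * g t 1 - f t 1 * g t 0] := by
    intro t
    apply ext_E3
    · rw [cross_zero]; rfl
    · rw [cross_one]; rfl
    · rw [cross_two]; rfl
  simp only [h]
  filter_upwards [hf.apply_E3 0, hf.apply_E3 1, hf.apply_E3 2, hg.apply_E3 0, hg.apply_E3 1,
    hg.apply_E3 2] with t a0 a1 a2 b0 b1 b2
  rw [contDiffAt_euclidean]
  intro i
  fin_cases i
  · exact (a1.mul b2).sub (a2.mul b1)
  · exact (a2.mul b0).sub (a0.mul b2)
  · exact (a0.mul b1).sub (a1.mul b0)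

theorem inner_cross_deriv (L : ℝ → E3) (t : ℝ) :
    inner ℝ (curveNormal L t) (deriv L t) = 0 ∧
      inner ℝ (curveNormal L t) (iteratedDeriv 2 L t) = 0 := by
  constructor <;> rw [inner_E3, curveNormal, cross_zero, cross_one, cross_two] <;> ring

variable {L : ℝ → E3}

theorem torsion_eq_zero_iff (hn : curveNormal L 0 ≠ 0) :
    torsion L 0 = 0 ↔ inner ℝ (curveNormal L 0) (iteratedDeriv 3 L 0) = 0 := by
  rw [torsion, div_eq_zero_iff, or_iff_left (pow_ne_zero 2 (norm_ne_zero_iff.2 hn))]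

/-- The derivative of the torsion at a point where it vanishes. -/
theorem deriv_torsion (hL : SmoothGerm L) (hn : curveNormal L 0 ≠ 0) (h0 : torsion L 0 = 0) :
    deriv (torsion L) 0 =
      inner ℝ (curveNormal L 0) (iteratedDeriv 4 L 0) / ‖curveNormal L 0‖ ^ 2 := by
  have hN : SmoothGerm (curveNormal L) := hL.deriv.cross (hL.iteratedDeriv 2)
  have hd : ∀ n, HasDerivAt (iteratedDeriv n L) (iteratedDeriv (n + 1) L 0) 0 := by
    intro n
    rw [iteratedDeriv_succ]
    exact ((hL.iteratedDeriv n).contDiffAt.differentiableAt (by simp)).hasDerivAt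
  have hd1 : HasDerivAt (deriv L) (iteratedDeriv 2 L 0) 0 := by
    have := hd 1
    rwa [iteratedDeriv_one] at this
  have hN' : HasDerivAt (curveNormal L) (deriv (curveNormal L) 0) 0 :=
    (hN.contDiffAt.differentiableAt (by simp)).hasDerivAt
  have hcomp : ∀ {f : ℝ → E3} {f' : E3} (i : Fin 3), HasDerivAt f f' 0 →
      HasDerivAt (fun t => f t i) (f' i) 0 := fun i hf =>
    (EuclideanSpace.proj i : E3 →L[ℝ] ℝ).hasFDerivAt.comp_hasDerivAt 0 hf
  -- The other term L'' × L'' of the product rule vanishes, and L' × L''' is orthogonal to L'''. So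
  -- the numerator of the torsion has derivative ⟨L' × L'', L''''⟩.
  have hNv : deriv (curveNormal L) 0 = cross (deriv L 0) (iteratedDeriv 3 L 0) := by
    have h2 := hd 2
    apply ext_E3
    · refine (hcomp 0 hN').unique ?_
      simp only [curveNormal, cross_zero]
      convert! ((hcomp 1 hd1).mul (hcomp 2 h2)).sub ((hcomp 2 hd1).mul (hcomp 1 h2)) using 1
      ring
    · refine (hcomp 1 hN').unique ?_
      simp only [curveNormal, cross_one]
      convert! ((hcomp 2 hd1).mul (hcomp 0 h2)).sub ((hcomp 0 hd1).mul (hcomp 2 h2)) using 1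
      ring
    · refine (hcomp 2 hN').unique ?_
      simp only [curveNormal, cross_two]
      convert! ((hcomp 0 hd1).mul (hcomp 1 h2)).sub ((hcomp 1 hd1).mul (hcomp 0 h2)) using 1
      ring
  have hnum : HasDerivAt (fun t => inner ℝ (curveNormal L t) (iteratedDeriv 3 L t))
      (inner ℝ (curveNormal L 0) (iteratedDeriv 4 L 0)) 0 := by
    have h := hN'.inner ℝ (hd 3)
    have hz : inner ℝ (deriv (curveNormal L) 0) (iteratedDeriv 3 L 0) = 0 := by
      rw [hNv, inner_E3, cross_zero, cross_one, cross_two]; ring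
    rwa [hz, add_zero] at h
  have hden := hN'.norm_sq
  have hz := (torsion_eq_zero_iff hn).1 h0
  have h := hnum.div hden (pow_ne_zero 2 (norm_ne_zero_iff.2 hn))
  have h' : deriv (torsion L) 0 = _ := h.deriv
  have hne : ‖curveNormal L 0‖ ≠ 0 := norm_ne_zero_iff.2 hn
  rw [h', hz, zero_mul, sub_zero]
  field_simp

end Torsion

/-! ### Height functions along the binormal. -/

namespace NormalCoords

variable {g : ℝ × ℝ → E3} {m : ℕ} {R : E3 ≃ₗᵢ[ℝ] E3} {ψ : ℝ × ℝ → ℝ × ℝ}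
  {A B D : ℝ → ℝ} {E : ℝ × ℝ → ℝ}

/-- For a curve tangent to v = 0, the vector L' × L'' depends on the curve only through u'. This
fixes the direction of the binormal as (0, -A(0), B(0)). -/
theorem map_curveNormal (h : NormalCoords g m R ψ A B D E) {σ : ℝ → ℝ × ℝ} (hσ : SmoothGerm σ)
    (hσ0 : σ 0 = 0) (h2 : (fderiv ℝ ψ 0 (deriv σ 0)).2 = 0) :
    R (curveNormal (fun t => g (σ t)) 0) =
      (2 * (fderiv ℝ ψ 0 (deriv σ 0)).1 ^ 3) • !₂[0, -A 0, B 0] := by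
  obtain ⟨h3, h4, h5⟩ := h.curve hσ hσ0
  rw [curveNormal, deriv_comp_curve h.smooth hσ hσ0, ← cross_map h.det, h3]
  apply ext_E3
  · rw [cross_zero]; simp
  · rw [cross_one, h5]; simp; ring
  · rw [cross_two, h4, h2]; simp; ring

/-- The types of the height function in a direction normal to the osculating plane of the image of
a curve along which `∂/∂v` is flat for that function. -/
theorem height_type_iff (h : NormalCoords g m R ψ A B D E) (hA0 : A 0 ≠ 0) {μ : ℝ → ℝ}
    (hμ : ContDiff ℝ ∞ μ) (hμ0 : A 0 * μ 0 = B 0 * D 0) {σ : ℝ → ℝ × ℝ} (hσ : SmoothGerm σ)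
    (hσ0 : σ 0 = 0) {s : ℝ → ℝ} (hs : DiffeoGerm s)
    (hψσ : ∀ᶠ t in 𝓝 0, ψ (σ t) = (s t, s t ^ m * μ (s t))) {L : ℝ → E3}
    (hL : L =ᶠ[𝓝 0] fun t => g (σ t)) :
    curveNormal L 0 ≠ 0 ∧ ∀ v : E3, v = binormal L 0 ∨ v = -binormal L 0 →
      (IsA 2 (height g v) ↔ torsion L 0 ≠ 0) ∧
      (IsA 3 (height g v) ↔ torsion L 0 = 0 ∧ deriv (torsion L) 0 ≠ 0) ∧
      (IsAGe 4 (height g v) ↔ torsion L 0 = 0 ∧ deriv (torsion L) 0 = 0) := by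
  have hm := h.two_le
  have hLs : SmoothGerm L := (h.smooth.comp hσ hσ0).congr hL
  let c : ℝ → ℝ × ℝ := fun t => (s t, s t ^ m * μ (s t))
  have hc : SmoothGerm c :=
    (by fun_prop : ContDiff ℝ ∞ fun u : ℝ => (u, u ^ m * μ u)).smoothGerm.comp hs.2.1 hs.1
  have hc0 : c 0 = 0 := by simp [c, hs.1, zero_pow (by omega : m ≠ 0)]
  have hsO : s =O[𝓝 0] fun t : ℝ => t := isBigO_of_smoothGerm hs.2.1 hs.1
  have hμs : SmoothGerm fun t => μ (s t) := hμ.smoothGerm.comp hs.2.1 hs.1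
  have hc2 : (fun t => (c t).2) =O[𝓝 0] fun t : ℝ => t ^ m := by
    simpa using (hsO.pow m).mul (hμs.continuousAt.isBigO_one ℝ)
  have hcd : fderiv ℝ ψ 0 (deriv σ 0) = (deriv s 0, 0) := by
    rw [← deriv_comp_curve h.diffeo.2.1 hσ hσ0, EventuallyEq.deriv_eq hψσ]
    exact Prod.ext (deriv_fst hc).symm
      ((deriv_snd hc).symm.trans (deriv_eq_zero_of_isBigO hm hc.snd hc2))
  have hnormal : R (curveNormal L 0) = (2 * deriv s 0 ^ 3) • !₂[0, -A 0, B 0] := by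
    have he : curveNormal L 0 = curveNormal (fun t => g (σ t)) 0 := by
      rw [curveNormal, curveNormal, hL.deriv_eq, hL.iteratedDeriv_eq 2]
    rw [he, h.map_curveNormal hσ hσ0 (by rw [hcd]), hcd]
  have hsd := hs.deriv_ne_zero
  have hk0 : 2 * deriv s 0 ^ 3 ≠ 0 := mul_ne_zero two_ne_zero (pow_ne_zero 3 hsd)
  have hn : curveNormal L 0 ≠ 0 := by
    intro h0
    rw [h0, map_zero] at hnormal
    have := congrArg (fun x : E3 => x 1) hnormal
    simp [hA0, hsd] at this
  refine ⟨hn, fun v hv => ?_⟩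
  -- Both unit binormals are nonzero multiples of L' × L'', and only this matters for the types.
  obtain ⟨κ, hκ, rfl⟩ : ∃ κ : ℝ, κ ≠ 0 ∧ v = κ • curveNormal L 0 := by
    have hne := inv_ne_zero (norm_ne_zero_iff.2 hn)
    rcases hv with rfl | rfl
    · exact ⟨_, hne, rfl⟩
    · exact ⟨_, neg_ne_zero.2 hne, (neg_smul _ _).symm⟩
  set v := κ • curveNormal L 0 with hv_def
  have hdot : ∀ n, iteratedDeriv n (fun t => inner ℝ (L t) v) 0 =
      κ * inner ℝ (curveNormal L 0) (iteratedDeriv n L 0) := by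
    intro n
    have := map_iteratedDeriv hLs (innerSL ℝ v) n
    simp only [innerSL_apply_apply] at this
    simp only [real_inner_comm v]
    rw [this, hv_def, real_inner_smul_left]
  obtain ⟨ρ, hρ, hRv⟩ : ∃ ρ : ℝ, ρ ≠ 0 ∧ R v = ρ • !₂[0, -A 0, B 0] :=
    ⟨_, mul_ne_zero hκ hk0, by rw [hv_def, map_smul, hnormal, smul_smul]⟩
  let N := normalForm m A B D E
  let H : ℝ × ℝ → ℝ := fun w => ρ * (B 0 * N w 2 - A 0 * N w 1)
  have hNs : ContDiff ℝ ∞ N := contDiff_normalForm m h.hA h.hB h.hD h.hE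
  have hN1 : ContDiff ℝ ∞ fun w => N w 1 := contDiff_euclidean.1 hNs 1
  have hN2 : ContDiff ℝ ∞ fun w => N w 2 := contDiff_euclidean.1 hNs 2
  have hHs : ContDiff ℝ ∞ H := contDiff_const.mul ((contDiff_const.mul hN2).sub (contDiff_const.mul hN1))
  have hHinner : ∀ w, inner ℝ (N w) (R v) = H w := by
    intro w
    rw [hRv, inner_E3]; simp [H]; ring
  have hheight : height g v =ᶠ[𝓝 0] fun w => H (ψ w) := by
    filter_upwards [h.eq] with w hw
    rw [← hHinner, show N (ψ w) = R (g w) from hw.symm, R.inner_map_map]; rfl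
  have hHL : (fun t => H (c t)) =ᶠ[𝓝 0] fun t => inner ℝ (L t) v := by
    filter_upwards [hL, hψσ, (hσ.tendsto hσ0).eventually h.eq] with t h1 h2 h3
    rw [← hHinner, h1, ← R.inner_map_map (g (σ t)), h3, h2]
  let J : ℝ × ℝ → ℝ := fun w => 2 * E w + w.2 * dsnd E w
  have hJ : ContDiff ℝ ∞ J := (contDiff_const.mul h.hE).add (contDiff_snd.mul h.hE.dsnd)
  have hJ0 : J 0 = 0 := by simp [J, h.E_zero]
  have hdH : dsnd H = fun w => ρ * (B 0 * (w.1 ^ m * D w.1 + w.2 * J w) - A 0 * w.2) := by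
    funext w
    refine dsnd_eq_of_hasDerivAt (hHs.differentiable (by simp) w) ?_
    have h1 := hasDerivAt_snd (hN1.differentiable (by simp) w)
    have h2 := hasDerivAt_snd (hN2.differentiable (by simp) w)
    rw [dsnd_normalForm_one m A D E h.hB] at h1
    rw [dsnd_normalForm_two m B h.hA h.hD h.hE] at h2
    exact ((h2.const_mul (B 0)).sub (h1.const_mul (A 0))).const_mul ρ
  have hdH0 : dsnd H 0 = 0 := by rw [hdH]; simp [zero_pow (by omega : m ≠ 0)]
  have hddH : dsnd (dsnd H) 0 = -(ρ * A 0) := by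
    refine dsnd_eq_of_hasDerivAt (hHs.dsnd.differentiable (by simp) 0) ?_
    rw [hdH]
    have h1 := (hasDerivAt_id' (0 : ℝ)).mul
      (hasDerivAt_snd (hJ.differentiable (by simp) (0 : ℝ × ℝ)))
    have h2 := (((h1.const_add ((0 : ℝ) ^ m * D 0)).const_mul (B 0)).sub
      ((hasDerivAt_id' (0 : ℝ)).const_mul (A 0))).const_mul ρ
    convert! h2 using 1
    have hJ00 : J (0, 0) = 0 := hJ0
    simp [hJ00]
  -- Along the branch H_v = ρ s^m (B(0)(D + μJ) - A(0)μ). The bracket vanishes at 0 by the relation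
  -- A(0)μ(0) = B(0)D(0), which raises the order from m to m + 1 ≥ 3.
  have hcrit : (fun t => dsnd H (c t)) =O[𝓝 0] fun t : ℝ => t ^ 3 := by
    have hDs : SmoothGerm fun t => D (s t) := h.hD.smoothGerm.comp hs.2.1 hs.1
    have hJs : SmoothGerm fun t => J (c t) := hJ.smoothGerm.comp hc hc0
    have hK : SmoothGerm fun t => B 0 * (D (s t) + μ (s t) * J (c t)) - A 0 * μ (s t) := by
      filter_upwards [hDs, hJs, hμs] with t h1 h2 h3
      exact (contDiffAt_const.mul (h1.add (h3.mul h2))).sub (contDiffAt_const.mul h3)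
    have h1 := ((hsO.pow m).trans (pow_isBigO_pow hm)).mul
      (isBigO_of_smoothGerm hK (by simp [hc0, hJ0, hs.1, hμ0]))
    refine ((h1.const_mul_left ρ).congr_left fun t => ?_).congr_right fun t => by ring
    rw [hdH]; simp only [c]; ring
  have hHc : SmoothGerm fun t => H (c t) := hHs.smoothGerm.comp hc hc0
  -- The height vanishes at 0 with its first two derivatives along L, because v is orthogonal to L'
  -- and L''.
  have hval : (fun t => H (c t)) =O[𝓝 0] fun t : ℝ => t ^ 3 := by
    refine (isBigO_pow_iff 3 hHc).2 fun j hj => ?_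
    rw [hHL.iteratedDeriv_eq j, hdot]
    obtain ⟨e1, e2⟩ := inner_cross_deriv L 0
    have e0 : L 0 = 0 := by simp [hL.self_of_nhds, hσ0, h.zero]
    interval_cases j
    · simp [e0]
    · rw [iteratedDeriv_one, e1, mul_zero]
    · rw [e2, mul_zero]
  obtain ⟨t2, t3, t4⟩ := type_iff_along_curve hHs.smoothGerm hdH0
    (by rw [hddH]; exact neg_ne_zero.2 (mul_ne_zero hρ hA0)) hc hc0 hs hcrit hval
  have d3 : iteratedDeriv 3 (fun t => H (c t)) 0 = 0 ↔ torsion L 0 = 0 := by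
    rw [hHL.iteratedDeriv_eq 3, hdot, torsion_eq_zero_iff hn, mul_eq_zero, or_iff_right hκ]
  have d4 : torsion L 0 = 0 →
      (iteratedDeriv 4 (fun t => H (c t)) 0 = 0 ↔ deriv (torsion L) 0 = 0) := by
    intro h0
    rw [hHL.iteratedDeriv_eq 4, hdot, deriv_torsion hLs hn h0, mul_eq_zero, or_iff_right hκ,
      div_eq_zero_iff, or_iff_left (pow_ne_zero 2 (norm_ne_zero_iff.2 hn))]
  rw [isA_comp_iff h.diffeo hheight, isA_comp_iff h.diffeo hheight, isAGe_comp_iff h.diffeo hheight,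
    t2, t3, t4, d3]
  exact ⟨not_congr d3, and_congr_right fun h0 => not_congr (d4 h0), and_congr_right d4⟩

end NormalCoords

end SingSurf

/-! ### The theorem. -/

theorem theorem4p1 (T : SingSurf.SingType) (hT : T.Admissible)
    (g : ℝ × ℝ → SingSurf.E3) (hg0 : g 0 = 0) (hg : SingSurf.SmoothGerm g)
    (hgT : SingSurf.HasType g T) (hinf : ¬ SingSurf.IsInflection g) :
    ∃ γ : ℝ → ℝ × ℝ,
      -- (1) a branch of the parabolic set which is a characteristic tangential curve
      (SingSurf.IsBranch (SingSurf.parabolicSet g) γ ∧ SingSurf.IsCharacteristic g γ) ∧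
      -- (2) contact with its tangent line, in the coordinates of the normal form
      (∀ K ≥ T.contactOrder,
        (∃ R ψ, SingSurf.Normalizes K g R ψ) ∧
        ∀ R ψ, SingSurf.Normalizes K g R ψ →
          SingSurf.ContactAtLeast T.contactOrder (fun t => ψ (γ t))) ∧
      -- (3) any regular parametrization of the branch on the surface
      (∀ s : ℝ → ℝ, SingSurf.DiffeoGerm s → ∀ L : ℝ → SingSurf.E3,
        (∀ᶠ t in 𝓝 (0 : ℝ), L t = g (γ (s t))) →
        SingSurf.curveNormal L 0 ≠ 0 ∧
        ∀ v : SingSurf.E3, v = SingSurf.binormal L 0 ∨ v = -SingSurf.binormal L 0 →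
          (SingSurf.IsA 2 (SingSurf.height g v) ↔ SingSurf.torsion L 0 ≠ 0) ∧
          (SingSurf.IsA 3 (SingSurf.height g v) ↔
            SingSurf.torsion L 0 = 0 ∧ deriv (SingSurf.torsion L) 0 ≠ 0) ∧
          (SingSurf.IsAGe 4 (SingSurf.height g v) ↔
            SingSurf.torsion L 0 = 0 ∧ deriv (SingSurf.torsion L) 0 = 0)) := by
  obtain ⟨R, ψ, A, B, D, E, hR, hψ, hA, hB, hD, hE, hD0, hE0, he⟩ :=
    SingSurf.exists_normalForm hT hgT
  set m := T.contactOrder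
  have hm : 2 ≤ m := SingSurf.SingType.two_le_contactOrder hT
  have h : SingSurf.NormalCoords g m R ψ A B D E :=
    ⟨hm, hg, hg0, hR, hψ, hA, hB, hD, hE, hD0, hE0, he⟩
  have hA0 := h.A_ne_zero hinf
  have hN := SingSurf.contDiff_normalForm m hA hB hD hE
  obtain ⟨μ, hμ, hμ0, hz, hu⟩ := SingSurf.exists_branch_normalForm hm hA hB hD hE hA0 hD0 hE0
  obtain ⟨θ, hθs, hθ, hθψ, hψθ⟩ := hψ.exists_inverse
  let c : ℝ → ℝ × ℝ := fun t => (t, t ^ m * μ t)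
  have hc : ContDiff ℝ ∞ c := by fun_prop
  have hc0 : c 0 = 0 := by simp [c, zero_pow (by omega : m ≠ 0)]
  have hct := hc.smoothGerm.tendsto hc0
  have hθc : SingSurf.SmoothGerm fun t => θ (c t) := (hθs.comp hc).smoothGerm
  have hθc0 : θ (c 0) = 0 := by rw [hc0, hθ.1]
  have hψγ : (fun t => ψ (θ (c t))) =ᶠ[𝓝 0] c := hct.eventually hψθ
  have hμO : (fun t => t ^ m * μ t) =O[𝓝 0] fun t : ℝ => t ^ m := by
    simpa using (isBigO_refl (fun t : ℝ => t ^ m) (𝓝 0)).mul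
      (hμ.continuous.continuousAt.isBigO_one ℝ)
  have hcd : fderiv ℝ ψ 0 (deriv (fun t => θ (c t)) 0) = (1, 0) := by
    rw [← SingSurf.deriv_comp_curve hψ.2.1 hθc hθc0, hψγ.deriv_eq]
    refine Prod.ext ((SingSurf.deriv_fst hc.smoothGerm).symm.trans (deriv_id (0 : ℝ))) ?_
    exact (SingSurf.deriv_snd hc.smoothGerm).symm.trans
      (SingSurf.deriv_eq_zero_of_isBigO hm hc.smoothGerm.snd hμO)
  refine ⟨fun t => θ (c t), ⟨SingSurf.isBranch_of_normalForm (by omega) hR hg hN hψ hθ hθs hθψ hψθ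
    he hμ hz hu, h.isCharacteristic hθc hθc0 (by rw [hcd]; exact one_ne_zero) (by rw [hcd])⟩,
    fun K hK => ⟨⟨R, ψ, hR, hψ, _, SingSurf.isNormalForm_normalForm hm hA hB hD hE hE0
      (hm.trans hK), he⟩, ?_⟩, ?_⟩
  · rintro R' ψ' ⟨-, hψ', G, hG, he'⟩
    -- On v = u^m μ(u) both p_v = v and q_v = u^m D + vK are O(u^m). This property is carried over
    -- to any other normal form by the change between the two coordinate systems and the rotation
    -- between the targets.
    have hflat : SingSurf.FieldFlat m (SingSurf.normalForm m A B D E) c fun _ => (0, 1) := by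
      refine SingSurf.fieldFlat_of_isBigO hN.smoothGerm (Eventually.of_forall fun w => rfl)
        (hc.snd).smoothGerm (congrArg Prod.snd hc0) ?_ ?_
      · rw [SingSurf.dsnd_normalForm_one m A D E hB]
        exact hμO
      · rw [SingSurf.dsnd_normalForm_two m B hA hD hE]
        have h1 : ContinuousAt (fun t : ℝ => D t + μ t * (2 * E (c t) +
            t ^ m * μ t * SingSurf.dsnd E (c t))) 0 := by
          have h3 := hE.dsnd.continuous
          have h4 := hE.continuous
          have h5 := hD.continuous
          have h6 := hμ.continuous
          have h7 := hc.continuous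
          exact Continuous.continuousAt (by fun_prop)
        have h2 := (isBigO_refl (fun t : ℝ => t ^ m) (𝓝 0)).mul (h1.isBigO_one ℝ)
        refine (h2.congr_left fun t => ?_).congr_right fun t => mul_one _
        simp only [c]; ring
    have hφ : SingSurf.DiffeoGerm fun w => ψ' (θ w) := hψ'.comp hθ
    have hΦ : SingSurf.SmoothGerm fun x : SingSurf.E3 => R' (R.symm x) :=
      (R'.contDiff.comp R.symm.contDiff).smoothGerm
    have heq : (fun w => G (ψ' (θ w))) =ᶠ[𝓝 0] fun w =>
        R' (R.symm (SingSurf.normalForm m A B D E w)) := by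
      filter_upwards [hθ.tendsto.eventually he', hθ.tendsto.eventually he, hψθ] with w h1 h2 h3
      rw [← h1, ← R.symm_apply_apply (g (θ w)), h2, h3]
    have ht := hflat.transport hN.smoothGerm hG.1 SingSurf.normalForm_zero hφ hΦ heq
    exact SingSurf.contactAtLeast_of_isBigO hm ht.smooth ht.regular
      (hG.isBigO_snd (by omega) hK ht)
  · intro s hs L hL
    exact h.height_type_iff hA0 hμ hμ0 (hθc.comp hs.2.1 hs.1) (by simp only [hs.1, hθc0]) hs
      (hs.tendsto.eventually hψγ) hL
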